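/- **Setting.** Fix $d\in\mathbb N$, $d\ge1$, and a Lipschitz function $\sigma:\mathbb R\to\mathbb R$ (the activation function). A *network* $f$ with $L\ge1$ hidden layers ($\mathrm{depth}(f)=L$) and widths $p_0=d$, $p_1,\dots,p_L\ge1$, $p_{L+1}=1$ is given by weight matrices $W_\ell\in\mathbb R^{p_\ell\times p_{\ell-1}}$ and shifts $b_\ell\in\mathbb R^{p_\ell}$, $1\le\ell\le L+1$, and computes $A_{L+1}\circ\sigma\circ A_L\circ\cdots\circ\sigma\circ A_1$ with $A_\ell(x)=W_\ell x+b_\ell$ and $\sigma$ applied coordinatewise; $\mathrm{width}(f)=\max_{1\le\ell\le L}p_\ell$ and $\theta(f)$ is the vector of all entries of the $W_\ell$ and $b_\ell$. Let $\mathcal F_\sigma(L,N,B,F)$ be the class of all networks $f$ with $\mathrm{depth}(f)\le L$, $\mathrm{width}(f)\le N$, $|\theta(f)|_\infty\le B$ and $\sup_{[0,1]^d}|f|\le F$; an element $f$ of this class is always used as the function $f\mathbf 1_{[0,1]^d}$. For $\lambda,\tau>0$ put $J_{\lambda,\tau}(f)=\lambda\sum_j\bigl(|\theta_j(f)|/\tau\wedge1\bigr)$.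 For σ-fields $\mathcal A,\mathcal B$ let $\beta(\mathcal A,\mathcal B)=\frac12\sup\sum_{i,j}|P(A_i\cap B_j)-P(A_i)P(B_j)|$ over finite partitions $(A_i)\subset\mathcal A$, $(B_j)\subset\mathcal B$ of $\Omega$, and for a process $X=(X_t)_{t=1}^T$ let $\beta_X(t)=\sup_k\beta(\sigma(X_s:s\le k),\sigma(X_s:s\ge k+t))$. **Model.** Let $T\ge3$, let $(\Omega,\mathcal G,(\mathcal G_t)_{t\ge0},P)$ be a filtered probability space, $m,\eta:\mathbb R^d\to\mathbb R$ measurable, and $$Y_t=m(X_t)+\eta(X_t)v_t,\qquad t=1,\dots,T,$$ where, for $1\le t\le T$, $v_t$ is $\mathcal G_t$-measurable, $X_t\in\mathbb R^d$ is $\mathcal G_{t-1}$-measurable, $E[v_t\mid\mathcal G_{t-1}]=0$, $E[v_t^2\mid\mathcal G_{t-1}]=1$, and $E[\exp(v_t^2/K_t^2)\mid\mathcal G_{t-1}]\le2$ for constants $0<K_t\le K$; $\sup_{[0,1]^d}|\eta|\le C_\eta$; and $\beta_X(t)\le C_{1,\beta}\exp(-C_{2,\beta}t)$ for all $t\ge1$,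 where $C_{1,\beta},C_{2,\beta}>0$. Let $F\ge1$ and $f_0=m\mathbf 1_{[0,1]^d}$ with $\sup_{[0,1]^d}|f_0|\le F$. **Theorem.** Let $C_L,C_N,C_B,C_\tau,\nu_0,\nu_1,\nu_2>0$, and let $\iota_\lambda$ be a strictly increasing function with $\iota_\lambda(x)/\log x\to\infty$ as $x\to\infty$. There is a constant $C>0$ depending only on $d$, $\sigma$ and $(C_\eta,C_{1,\beta},C_{2,\beta},C_L,C_N,C_B,C_\tau,\nu_0,\nu_1,\nu_2,K,\iota_\lambda)$ such that the following holds for every $T\ge3$ and every model as above. Let $L_T,N_T,B_T$ be positive reals with $$L_T\le C_L\log^{\nu_0}T,\qquad N_T\le C_NT^{\nu_1},\qquad 1\le B_T\le C_BT^{\nu_2},$$ and let $\lambda_T,\tau_T>0$ satisfy $$\lambda_T=\frac{F^2\,\iota_\lambda(T)\log^{2+\nu_0}T}{T},\qquad \tau_T(L_T+1)\bigl((N_T+1)B_T\bigr)^{L_T+1}\le C_\tau T^{-1}.$$ Put $\mathcal F=\mathcal F_\sigma(L_T,N_T,B_T,F)$, $J_T=J_{\lambda_T,\tau_T}$ and $\bar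 Q_T(f)=\frac1T\sum_{t=1}^T(Y_t-f(X_t))^2+J_T(f)$. Let $\hat f_T$ be any estimator with values in $\mathcal F$, i.e. a random element of $\mathcal F$ such that $(\omega,x)\mapsto\hat f_T(\omega,x)$ is measurable for the product of $\sigma((Y_t,X_t)_{t\le T})$ and the Borel σ-field and $J_T(\hat f_T)$ is a random variable. With $$R(\hat f_T,f_0)=E\Bigl[\frac1T\sum_{t=1}^T\bigl(\hat f_T(X_t^*)-f_0(X_t^*)\bigr)^2\Bigr],\qquad \bar\Psi_T^{\mathcal F}(\hat f_T)=E\Bigl[\bar Q_T(\hat f_T)-\inf_{f\in\mathcal F}\bar Q_T(f)\Bigr],$$ where $(X_t^*)_{t=1}^T$ is a copy of $(X_t)_{t=1}^T$ independent of everything else, one has $$R(\hat f_T,f_0)\le6\Bigl(\bar\Psi_T^{\mathcal F}(\hat f_T)+\inf_{f\in\mathcal F}\bigl(R(f,f_0)+J_T(f)\bigr)\Bigr)+C\,F^2\,\frac{1+\log T}{T}.$$ -/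

import Mathlib

open MeasureTheory ProbabilityTheory Filter Topology
open scoped ENNReal NNReal Matrix

noncomputable section

namespace SparseDNN

/-! ### Deep neural networks -/

/-- Real-valued feed-forward networks `A_{L+1} ∘ σ_L ∘ A_L ∘ ⋯ ∘ σ_1 ∘ A_1` with input dimension
`n`, given by their parameters. `output W b` is the last affine map `A_{L+1}`, and
`hidden m hm W b f` puts the affine map `x ↦ W x + b` into `ℝ^m`, followed by the coordinatewise
activation, in front of the network `f`. -/
inductive DNN : ℕ → Type
  | output {n : ℕ} (W : Matrix (Fin 1) (Fin n) ℝ) (b : Fin 1 → ℝ) : DNN n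
  | hidden {n : ℕ} (m : ℕ) (hm : 0 < m) (W : Matrix (Fin m) (Fin n) ℝ) (b : Fin m → ℝ)
      (f : DNN m) : DNN n

namespace DNN

/-- The function `ℝ^n → ℝ` computed by a network with activation function `σ`. -/
def eval (σ : ℝ → ℝ) : {n : ℕ} → DNN n → (Fin n → ℝ) → ℝ
  | _, output W b, x => (W *ᵥ x + b) 0
  | _, hidden _ _ W b f, x => eval σ f (fun i => σ ((W *ᵥ x + b) i))

/-- The number `L` of hidden layers. -/
def depth : {n : ℕ} → DNN n → ℕ
  | _, output _ _ => 0
  | _, hidden _ _ _ _ f => depth f + 1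

/-- The largest dimension of a hidden layer. -/
def width : {n : ℕ} → DNN n → ℕ
  | _, output _ _ => 0
  | _, hidden m _ _ _ f => max m (width f)

/-- The entries of a matrix, column after column. -/
def vec {m n : ℕ} (W : Matrix (Fin m) (Fin n) ℝ) : List ℝ :=
  (List.finRange n).flatMap fun j => (List.finRange m).map fun i => W i j

/-- The parameter vector `θ(f) = (vec W_1, b_1, …, vec W_{L+1}, b_{L+1})`. -/
def params : {n : ℕ} → DNN n → List ℝ
  | _, output W b => vec W ++ List.ofFn b
  | _, hidden _ _ W b f => vec W ++ List.ofFn b ++ params f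

end DNN

/-- The clipped `L₁` norm `∑ⱼ min (|θⱼ| / τ) 1`. -/
def clipNorm (τ : ℝ) (θ : List ℝ) : ℝ := (θ.map fun a => min (|a| / τ) 1).sum

/-- The sparse penalty `J_{lam, τ}(f) = lam ‖θ(f)‖_{clip, τ}`. -/
def penalty (lam τ : ℝ) {d : ℕ} (f : DNN d) : ℝ := lam * clipNorm τ f.params

/-- The cube `[0,1]^d`. -/
def cube (d : ℕ) : Set (Fin d → ℝ) := Set.Icc 0 1

/-- The function `f · 1_{[0,1]^d}`. -/
def DNN.fn (σ : ℝ → ℝ) {d : ℕ} (f : DNN d) : (Fin d → ℝ) → ℝ := (cube d).indicator (f.eval σ)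

/-- The class `F_σ(L, N, B, F)`: networks with at least one hidden layer, depth at most `L`, width
at most `N`, parameters bounded by `B`, and values on the cube bounded by `F`. The function
attached to an element `f` of the class is `f.fn σ`, that is `f · 1_{[0,1]^d}`. -/
def dnnClass (σ : ℝ → ℝ) (d : ℕ) (L N B F : ℝ) : Set (DNN d) :=
  {f | 1 ≤ f.depth ∧ (f.depth : ℝ) ≤ L ∧ (f.width : ℝ) ≤ N ∧ (∀ a ∈ f.params, |a| ≤ B) ∧
    ∀ x ∈ cube d, |f.eval σ x| ≤ F}

/-! ### Mixing -/

/-- The β-mixing coefficient of two σ-fields,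
`(1/2) sup ∑ᵢ ∑ⱼ |P(Aᵢ ∩ Bⱼ) - P(Aᵢ) P(Bⱼ)|` over all finite partitions `(Aᵢ)` of the space into
sets of `𝒜` and `(Bⱼ)` into sets of `ℬ`. -/
def betaCoeff {Ω : Type*} {mΩ : MeasurableSpace Ω} (P : Measure Ω) (𝒜 ℬ : MeasurableSpace Ω) :
    ℝ≥0∞ :=
  ⨆ (k : ℕ) (l : ℕ) (A : Fin k → Set Ω) (B : Fin l → Set Ω)
    (_ : (∀ i, MeasurableSet[𝒜] (A i)) ∧ Pairwise (Function.onFun Disjoint A) ∧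
      ⋃ i, A i = Set.univ)
    (_ : (∀ j, MeasurableSet[ℬ] (B j)) ∧ Pairwise (Function.onFun Disjoint B) ∧
      ⋃ j, B j = Set.univ),
    ENNReal.ofReal ((1 / 2) * ∑ i, ∑ j, |P.real (A i ∩ B j) - P.real (A i) * P.real (B j)|)

/-- The σ-field generated by `X_t`, `t ∈ I`. -/
abbrev sigmaOf {Ω E : Type*} [MeasurableSpace E] (X : ℕ → Ω → E) (I : Finset ℕ) :
    MeasurableSpace Ω :=
  ⨆ t ∈ I, MeasurableSpace.comap (X t) inferInstance

/-- The β-mixing coefficient of lag `t` of the process `X_1, …, X_T`,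
`sup_k β(σ(X_1, …, X_k), σ(X_{k+t}, …, X_T))`. -/
def betaMixing {Ω E : Type*} {mΩ : MeasurableSpace Ω} [MeasurableSpace E] (P : Measure Ω) (T : ℕ)
    (X : ℕ → Ω → E) (t : ℕ) : ℝ≥0∞ :=
  ⨆ k : ℕ, betaCoeff P (sigmaOf X (Finset.Icc 1 k ∩ Finset.Icc 1 T))
    (sigmaOf X (Finset.Icc (k + t) T ∩ Finset.Icc 1 T))

/-! ### The regression model -/

/-- The nonparametric time series regression model `Y_t = m(X_t) + η(X_t) v_t`, `t = 1, …, T`, with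
a volatility function bounded by `Cη` on the cube, a predictable covariate process `X` that is
β-mixing with exponential rate, and noise variables that are conditionally centered, conditionally
of variance one and conditionally sub-Gaussian with constants `K_t ≤ K`. The values of the processes
at times outside `{1, …, T}` are irrelevant. -/
structure RegressionModel {Ω : Type*} {mΩ : MeasurableSpace Ω} (P : Measure Ω)
    (𝒢 : Filtration ℕ mΩ) {d : ℕ} (T : ℕ) (m η : (Fin d → ℝ) → ℝ) (X : ℕ → Ω → Fin d → ℝ)
    (Y v : ℕ → Ω → ℝ) (Cη C₁ C₂ K : ℝ) : Prop where
  measurable_m : Measurable m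
  measurable_η : Measurable η
  model : ∀ t ∈ Finset.Icc 1 T, ∀ ω, Y t ω = m (X t ω) + η (X t ω) * v t ω
  η_le : ∀ x ∈ cube d, |η x| ≤ Cη
  adapted : ∀ t ∈ Finset.Icc 1 T, Measurable[𝒢 t] (v t)
  predictable : ∀ t ∈ Finset.Icc 1 T, Measurable[𝒢 (t - 1)] (X t)
  centered : ∀ t ∈ Finset.Icc 1 T, P[v t | 𝒢 (t - 1)] =ᵐ[P] 0
  variance_one : ∀ t ∈ Finset.Icc 1 T, P[fun ω => v t ω ^ 2 | 𝒢 (t - 1)] =ᵐ[P] 1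
  subgaussian : ∀ t ∈ Finset.Icc 1 T, ∃ Kt : ℝ, 0 < Kt ∧ Kt ≤ K ∧
    Integrable (fun ω => Real.exp (v t ω ^ 2 / Kt ^ 2)) P ∧
    ∀ᵐ ω ∂P, (P[fun ω' => Real.exp (v t ω' ^ 2 / Kt ^ 2) | 𝒢 (t - 1)]) ω ≤ 2
  mixing : ∀ t : ℕ, 1 ≤ t → betaMixing P T X t ≤ ENNReal.ofReal (C₁ * Real.exp (-C₂ * t))

/-! ### Risks -/

/-- The generalization error
`R(f̂, f₀) = E[(1/T) ∑ₜ (f̂(X*_t) - f₀(X*_t))²]` of a random function `f̂`, where `X*` is an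
independent copy of `X`: it is realized on the product space `Ω × Ω` as `X` evaluated at the second
coordinate, whereas `f̂` is evaluated at the first one. -/
def risk {Ω : Type*} {mΩ : MeasurableSpace Ω} (P : Measure Ω) {d : ℕ} (T : ℕ)
    (X : ℕ → Ω → Fin d → ℝ) (fhat : Ω → (Fin d → ℝ) → ℝ) (f₀ : (Fin d → ℝ) → ℝ) : ℝ :=
  ∫ q : Ω × Ω, (1 / (T : ℝ)) *
    ∑ t ∈ Finset.Icc 1 T, (fhat q.1 (X t q.2) - f₀ (X t q.2)) ^ 2 ∂(P.prod P)

/-- The penalized empirical risk `Q̄_T(f)` of a network at the outcome `ω`. -/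
def penRisk {Ω : Type*} {d : ℕ} (T : ℕ) (X : ℕ → Ω → Fin d → ℝ) (Y : ℕ → Ω → ℝ) (σ : ℝ → ℝ)
    (lam τ : ℝ) (ω : Ω) (f : DNN d) : ℝ :=
  (1 / (T : ℝ)) * ∑ t ∈ Finset.Icc 1 T, (Y t ω - f.fn σ (X t ω)) ^ 2 + penalty lam τ f

/-- The expected optimization gap `E[Q̄_T(f̂) - inf_{f ∈ 𝓕} Q̄_T(f)]`. -/
def optGap {Ω : Type*} {mΩ : MeasurableSpace Ω} (P : Measure Ω) {d : ℕ} (T : ℕ)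
    (X : ℕ → Ω → Fin d → ℝ) (Y : ℕ → Ω → ℝ) (σ : ℝ → ℝ) (lam τ : ℝ) (𝓕 : Set (DNN d))
    (fhat : Ω → DNN d) : ℝ :=
  ∫ ω, (penRisk T X Y σ lam τ ω (fhat ω) - ⨅ f : 𝓕, penRisk T X Y σ lam τ ω f) ∂P

/-- A network estimator with values in `𝓕`: the random function `(ω, x) ↦ f̂(ω)(x)` is measurable
for the product of the σ-field generated by the data `(Y_t, X_t)`, `t = 1, …, T`, and the Borel
σ-field, and its penalty is a random variable. -/
structure IsEstimator {Ω : Type*} [MeasurableSpace Ω] {d : ℕ} (T : ℕ) (X : ℕ → Ω → Fin d → ℝ)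
    (Y : ℕ → Ω → ℝ) (σ : ℝ → ℝ) (lam τ : ℝ) (𝓕 : Set (DNN d)) (fhat : Ω → DNN d) : Prop where
  mem : ∀ ω, fhat ω ∈ 𝓕
  measurable_fn :
    Measurable[(sigmaOf Y (Finset.Icc 1 T) ⊔ sigmaOf X (Finset.Icc 1 T)).prod inferInstance]
      (fun q : Ω × (Fin d → ℝ) => (fhat q.1).fn σ q.2)
  measurable_penalty : Measurable fun ω => penalty lam τ (fhat ω)

end SparseDNN

end

open SparseDNN MeasureTheory

open MeasureTheory ProbabilityTheory Filter Topology
open scoped ENNReal NNReal Matrix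

noncomputable section

namespace SparseDNN

/-! ### Consequences of β-mixing -/

section Mixing

variable {Ω : Type*} {mΩ : MeasurableSpace Ω} {P : Measure Ω}

/-! Let `f` be any network of the class, `J` the penalty, and D(h) the empirical squared distance of
h to f₀. Networks vanish off the cube, so expanding squares there gives the basic inequality D(f̂) ≤
D(f) + noise(f̂) - noise(f) + J(f) - J(f̂) + gap, in which noise(f) has mean zero. It remains to
bound noise(f̂) by D(f̂)/2, and the population distance of f̂ by 2 D(f̂), each up to a remainder of
mean O(F² log T / T) and a multiple of the complexity of f̂ that J(f̂) absorbs.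

Both bounds hold uniformly over a finite net with weights p_i ≥ 0 satisfying ∑ exp(-p_i) ≤ 4, by
exponential union bounds in which the element i pays a multiple of p_i (`exists_noise_remainder`,
`exists_mixing_remainder`). For the noise, the exponential moments come from a supermartingale built
on e^x ≤ x + e^{x²} (`lintegral_exp_sum_le_one`). For the covariates, time is cut into blocks of
length a of order log T; each block sum is replaced in turn by an independent copy at the cost of
one mixing coefficient, the integrand being truncated at 1 (`integral_min_one_sum_exp_block_le`).

The net (`exists_net`) consists of networks with parameters on a grid, weighted by E times the
number of nonzero parameters, where E is of order log^{1+ν₀} T. The penalty dominates these weights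
only if each network is within O(1/T) of a grid network whose number of nonzero parameters is at
most a constant times the clipped norm (`exists_sparse_approx`). Plain error propagation would cost
a power of the Lipschitz constant of σ, for which the condition on τ leaves no room. However, a
layer with s nonzero parameters has Frobenius norm at most B√s, and κB√s ≤ (wB/2) exp(2κ²s/w²) when
w exceeds the width by one. If the thresholded network is sparse, the gained powers of 1/2
compensate the exponential. If not, its number of nonzero parameters is comparable to the number of
all parameters, so no thresholding is needed and a finer grid compensates the exponential instead.
-/

lemma le_betaCoeff {ι κ : Type*} [Fintype ι] [Fintype κ] {𝒜 ℬ : MeasurableSpace Ω}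
    (A : ι → Set Ω) (B : κ → Set Ω)
    (hA : ∀ i, MeasurableSet[𝒜] (A i)) (hAd : Pairwise (Function.onFun Disjoint A))
    (hAu : ⋃ i, A i = Set.univ)
    (hB : ∀ j, MeasurableSet[ℬ] (B j)) (hBd : Pairwise (Function.onFun Disjoint B))
    (hBu : ⋃ j, B j = Set.univ) :
    ENNReal.ofReal ((1 / 2) * ∑ i, ∑ j, |P.real (A i ∩ B j) - P.real (A i) * P.real (B j)|)
      ≤ betaCoeff P 𝒜 ℬ := by
  set e := (Fintype.equivFin ι).symm
  set e' := (Fintype.equivFin κ).symm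
  have hsum : ∑ i, ∑ j, |P.real (A i ∩ B j) - P.real (A i) * P.real (B j)|
      = ∑ i, ∑ j, |P.real (A (e i) ∩ B (e' j)) - P.real (A (e i)) * P.real (B (e' j))| := by
    rw [← e.sum_comp]
    exact Finset.sum_congr rfl fun i _ => (e'.sum_comp _).symm
  rw [hsum]
  unfold betaCoeff
  refine le_iSup_of_le _ (le_iSup_of_le _ (le_iSup_of_le (fun i => A (e i))
    (le_iSup_of_le (fun j => B (e' j)) (le_iSup_of_le ⟨fun i => hA _, ?_, ?_⟩
      (le_iSup_of_le ⟨fun i => hB _, ?_, ?_⟩ le_rfl)))))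
  · exact fun i j hij => hAd (e.injective.ne hij)
  · rw [← hAu]; exact e.surjective.iUnion_comp A
  · exact fun i j hij => hBd (e'.injective.ne hij)
  · rw [← hBu]; exact e'.surjective.iUnion_comp B

lemma betaCoeff_mono {𝒜 𝒜' ℬ ℬ' : MeasurableSpace Ω} (h : 𝒜 ≤ 𝒜') (h' : ℬ ≤ ℬ') :
    betaCoeff P 𝒜 ℬ ≤ betaCoeff P 𝒜' ℬ' := by
  unfold betaCoeff
  refine iSup_le fun k => iSup_le fun l => iSup_le fun A => iSup_le fun B => iSup_le fun hA =>
    iSup_le fun hB => ?_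
  exact le_iSup_of_le k (le_iSup_of_le l (le_iSup_of_le A (le_iSup_of_le B
    (le_iSup_of_le ⟨fun i => h _ (hA.1 i), hA.2⟩
      (le_iSup_of_le ⟨fun i => h' _ (hB.1 i), hB.2⟩ le_rfl)))))

lemma betaCoeff_bot_left [IsProbabilityMeasure P] (ℬ : MeasurableSpace Ω) :
    betaCoeff P ⊥ ℬ = 0 := by
  unfold betaCoeff
  simp only [ENNReal.iSup_eq_zero]
  intro k l A B hA hB
  rw [ENNReal.ofReal_eq_zero]
  refine le_of_eq ?_
  rw [Finset.sum_eq_zero, mul_zero]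
  intro i _
  refine Finset.sum_eq_zero fun j _ => ?_
  rcases MeasurableSpace.measurableSet_bot_iff.1 (hA.1 i) with h | h <;> simp [h]

/-- With finitely many values both expectations are sums over pairs of level sets, and these form
admissible partitions. The factor 2 undoes the 1/2 in the definition of β. -/
lemma integral_prod_comp_le_of_finite [IsProbabilityMeasure P] {α : Type*} [Fintype α]
    {A B : Ω → α} (hA : ∀ a, MeasurableSet (A ⁻¹' {a})) (hB : ∀ a, MeasurableSet (B ⁻¹' {a}))
    {𝒜 ℬ : MeasurableSpace Ω} (hA' : ∀ a, MeasurableSet[𝒜] (A ⁻¹' {a}))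
    (hB' : ∀ a, MeasurableSet[ℬ] (B ⁻¹' {a})) {b : ℝ} (hb : 0 ≤ b)
    (hβ : betaCoeff P 𝒜 ℬ ≤ ENNReal.ofReal b)
    (h : α → α → ℝ) (h0 : ∀ x y, 0 ≤ h x y) (h1 : ∀ x y, h x y ≤ 1) :
    ∫ ω, h (A ω) (B ω) ∂P ≤ ∫ ω, ∫ ω', h (A ω) (B ω') ∂P ∂P + 2 * b := by
  classical
  have hdis : ∀ C : Ω → α, Pairwise (Function.onFun Disjoint fun a => C ⁻¹' {a}) := by
    intro C x y hxy
    exact Disjoint.preimage C (by simpa using hxy)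
  have huni : ∀ C : Ω → α, ⋃ a, C ⁻¹' {a} = Set.univ := by
    intro C; ext ω; simp
  have hsum := (le_betaCoeff (P := P) _ _ hA' (hdis A) (huni A) hB' (hdis B) (huni B)).trans hβ
  rw [ENNReal.ofReal_le_ofReal_iff hb] at hsum
  have h_int : ∀ (C : Ω → α), (∀ a, MeasurableSet[mΩ] (C ⁻¹' {a})) → ∀ g : α → ℝ,
      ∫ ω, g (C ω) ∂P = ∑ a, g a * P.real (C ⁻¹' {a}) := by
    intro C hC g
    have : ∀ ω, g (C ω) = ∑ a, (C ⁻¹' {a}).indicator (fun _ => g a) ω := by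
      intro ω
      rw [Finset.sum_eq_single (C ω)] <;> simp +contextual [Set.indicator, eq_comm]
    simp_rw [this]
    rw [integral_finsetSum _ fun a _ => (integrable_const _).indicator (hC a)]
    refine Finset.sum_congr rfl fun a _ => ?_
    rw [integral_indicator_const _ (hC a), smul_eq_mul, mul_comm]
  have h2 : ∫ ω, h (A ω) (B ω) ∂P
      = ∑ x, ∑ y, h x y * P.real (A ⁻¹' {x} ∩ B ⁻¹' {y}) := by
    have : ∀ ω, h (A ω) (B ω) = ∑ x, ∑ y, (A ⁻¹' {x} ∩ B ⁻¹' {y}).indicator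
        (fun _ => h x y) ω := by
      intro ω
      rw [Finset.sum_eq_single (A ω), Finset.sum_eq_single (B ω)] <;>
        simp +contextual [Set.indicator, eq_comm]
    simp_rw [this]
    rw [integral_finsetSum _ fun x _ => integrable_finsetSum _ fun y _ =>
      (integrable_const _).indicator ((hA x).inter (hB y))]
    refine Finset.sum_congr rfl fun x _ => ?_
    rw [integral_finsetSum _ fun y _ => (integrable_const _).indicator ((hA x).inter (hB y))]
    refine Finset.sum_congr rfl fun y _ => ?_
    rw [integral_indicator_const _ ((hA x).inter (hB y)), smul_eq_mul, mul_comm]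
  have h3 : ∫ ω, ∫ ω', h (A ω) (B ω') ∂P ∂P
      = ∑ x, ∑ y, h x y * (P.real (A ⁻¹' {x}) * P.real (B ⁻¹' {y})) := by
    simp_rw [h_int B hB]
    rw [h_int A hA (fun x => ∑ a, h x a * P.real (B ⁻¹' {a}))]
    refine Finset.sum_congr rfl fun x _ => ?_
    rw [Finset.sum_mul]
    exact Finset.sum_congr rfl fun y _ => by ring
  rw [h2, h3]
  have h4 : ∑ x, ∑ y, h x y * P.real (A ⁻¹' {x} ∩ B ⁻¹' {y})
      - ∑ x, ∑ y, h x y * (P.real (A ⁻¹' {x}) * P.real (B ⁻¹' {y}))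
      ≤ ∑ x, ∑ y, |P.real (A ⁻¹' {x} ∩ B ⁻¹' {y}) - P.real (A ⁻¹' {x}) * P.real (B ⁻¹' {y})| := by
    rw [← Finset.sum_sub_distrib]
    refine Finset.sum_le_sum fun x _ => ?_
    rw [← Finset.sum_sub_distrib]
    refine Finset.sum_le_sum fun y _ => ?_
    rw [← mul_sub]
    refine (le_abs_self _).trans ?_
    rw [abs_mul, abs_of_nonneg (h0 x y)]
    exact mul_le_of_le_one_left (abs_nonneg _) (h1 x y)
  linarith

/-- Replacing a pair of random variables by an independent pair with the same marginals changes
the expectation of a `[0,1]`-valued function by at most twice their β-mixing coefficient. -/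
lemma integral_prod_comp_le [IsProbabilityMeasure P] {E : Type*} [PseudoEMetricSpace E]
    [MeasurableSpace E] [OpensMeasurableSpace E] [TopologicalSpace.SeparableSpace E] [Nonempty E]
    {A B : Ω → E} (hA : Measurable A) (hB : Measurable B) {b : ℝ} (hb : 0 ≤ b)
    (hβ : betaCoeff P (MeasurableSpace.comap A inferInstance)
      (MeasurableSpace.comap B inferInstance) ≤ ENNReal.ofReal b)
    (h : E → E → ℝ) (hc : Continuous (Function.uncurry h)) (h0 : ∀ x y, 0 ≤ h x y)
    (h1 : ∀ x y, h x y ≤ 1) :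
    ∫ ω, h (A ω) (B ω) ∂P ≤ ∫ ω, ∫ ω', h (A ω) (B ω') ∂P ∂P + 2 * b := by
  obtain ⟨y₀⟩ := ‹Nonempty E›
  -- Finite-valued approximations of the identity: `φ n ∘ A` and `φ n ∘ B` stay measurable for the
  -- σ-fields of `A` and `B`, so the mixing bound survives, and both sides converge by dominated
  -- convergence since `h` is continuous and bounded.
  set φ : ℕ → SimpleFunc E E := fun n =>
    SimpleFunc.approxOn id measurable_id Set.univ y₀ (Set.mem_univ _) n with hφ
  have hlim : ∀ x, Tendsto (fun n => φ n x) atTop (𝓝 x) := fun x =>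
    SimpleFunc.tendsto_approxOn measurable_id (Set.mem_univ _) (by simp)
  have hn : ∀ n, ∫ ω, h (φ n (A ω)) (φ n (B ω)) ∂P
      ≤ ∫ ω, ∫ ω', h (φ n (A ω)) (φ n (B ω')) ∂P ∂P + 2 * b := by
    intro n
    have hpre : ∀ (C : Ω → E) (a : (φ n).range),
        (fun ω => (⟨φ n (C ω), SimpleFunc.mem_range_self _ _⟩ : (φ n).range)) ⁻¹' {a}
          = C ⁻¹' (φ n ⁻¹' {a.1}) := by
      intro C a; ext ω; simp [Subtype.ext_iff]
    refine integral_prod_comp_le_of_finite (P := P) (α := (φ n).range)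
      (A := fun ω => ⟨φ n (A ω), SimpleFunc.mem_range_self _ _⟩)
      (B := fun ω => ⟨φ n (B ω), SimpleFunc.mem_range_self _ _⟩) ?_ ?_ ?_ ?_ hb hβ
      (fun x y => h x y) (fun _ _ => h0 _ _) (fun _ _ => h1 _ _)
    · intro a; rw [hpre]; exact hA ((φ n).measurableSet_fiber _)
    · intro a; rw [hpre]; exact hB ((φ n).measurableSet_fiber _)
    · intro a; rw [hpre]; exact ⟨_, (φ n).measurableSet_fiber _, rfl⟩
    · intro a; rw [hpre]; exact ⟨_, (φ n).measurableSet_fiber _, rfl⟩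
  have habs : ∀ x y, ‖h x y‖ ≤ 1 := fun x y => by
    rw [Real.norm_eq_abs, abs_of_nonneg (h0 x y)]; exact h1 x y
  have hms : ∀ n (k : Ω → Ω → ℝ), (∀ p : Ω × Ω, k p.1 p.2 = h (φ n (A p.1)) (φ n (B p.2))) →
      Measurable (Function.uncurry k) := by
    intro n k hk
    have : Function.uncurry k = (fun p : E × E => h (φ n p.1) (φ n p.2)) ∘
        (fun p : Ω × Ω => (A p.1, B p.2)) := by
      ext p; exact hk p
    rw [this]
    refine Measurable.comp ?_ (by fun_prop)
    let ψ : SimpleFunc (E × E) (E × E) :=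
      ((φ n).comp Prod.fst measurable_fst).pair ((φ n).comp Prod.snd measurable_snd)
    exact (ψ.map (Function.uncurry h)).measurable
  refine le_of_tendsto_of_tendsto' (b := atTop)
    (f := fun n => ∫ ω, h (φ n (A ω)) (φ n (B ω)) ∂P)
    (g := fun n => ∫ ω, ∫ ω', h (φ n (A ω)) (φ n (B ω')) ∂P ∂P + 2 * b) ?_ ?_ hn
  · refine tendsto_integral_of_dominated_convergence (fun _ => (1 : ℝ)) ?_ (integrable_const _)
      (fun n => ae_of_all _ fun ω => habs _ _) (ae_of_all _ fun ω => ?_)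
    · intro n
      have := (hms n (fun ω ω' => h (φ n (A ω)) (φ n (B ω'))) fun _ => rfl).comp
        (measurable_id.prodMk measurable_id : Measurable
        fun ω : Ω => (ω, ω))
      exact this.aestronglyMeasurable
    · exact (hc.tendsto (A ω, B ω)).comp ((hlim _).prodMk_nhds (hlim _))
  · refine Tendsto.add_const _ ?_
    refine tendsto_integral_of_dominated_convergence (fun _ => (1 : ℝ)) ?_ (integrable_const _)
      (fun n => ae_of_all _ fun ω => ?_) (ae_of_all _ fun ω => ?_)
    · intro n
      have := (hms n (fun ω ω' => h (φ n (A ω)) (φ n (B ω'))) fun _ => rfl).stronglyMeasurable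
      exact (this.integral_prod_right (ν := P)).aestronglyMeasurable
    · refine (norm_integral_le_of_norm_le_const (ae_of_all _ fun _ => habs _ _)).trans ?_
      simp
    · refine tendsto_integral_of_dominated_convergence (fun _ => (1 : ℝ)) ?_ (integrable_const _)
        (fun n => ae_of_all _ fun ω => habs _ _) (ae_of_all _ fun ω' => ?_)
      · intro n
        have := (hms n (fun ω ω' => h (φ n (A ω)) (φ n (B ω'))) fun _ => rfl).comp
          (measurable_prodMk_left (x := ω))
        exact this.aestronglyMeasurable
      · exact (hc.tendsto (A ω, B ω')).comp ((hlim _).prodMk_nhds (hlim _))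

/-- An exponential union bound for partial sums of weakly dependent vectors. -/
lemma integral_min_one_sum_exp_le [IsProbabilityMeasure P] {I : Type*} [Fintype I]
    {W : ℕ → Ω → I → ℝ} (hW : ∀ k, Measurable (W k))
    (hWi : ∀ k i, Integrable (fun ω => Real.exp (W k ω i)) P)
    (hW1 : ∀ k i, ∫ ω, Real.exp (W k ω i) ∂P ≤ 1) {b : ℝ} (hb : 0 ≤ b)
    (hβ : ∀ k, betaCoeff P
      (MeasurableSpace.comap (fun ω => ∑ j ∈ Finset.range k, W j ω) inferInstance)
      (MeasurableSpace.comap (W k) inferInstance) ≤ ENNReal.ofReal b)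
    {w : I → ℝ} (hw : ∀ i, 0 ≤ w i) (n : ℕ) :
    ∫ ω, min 1 (∑ i, w i * Real.exp ((∑ j ∈ Finset.range n, W j ω) i)) ∂P
      ≤ 2 * b * n + ∑ i, w i := by
  induction n with
  | zero => simp
  | succ n ih =>
    have hS : Measurable fun ω => ∑ j ∈ Finset.range n, W j ω :=
      Finset.measurable_fun_sum _ fun j _ => hW j
    have h01 : ∀ s : I → ℝ, 0 ≤ min 1 (∑ i, w i * Real.exp (s i)) := fun s =>
      le_min zero_le_one (Finset.sum_nonneg fun i _ => mul_nonneg (hw i) (Real.exp_pos _).le)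
    have hcont : Continuous fun s : I → ℝ => min 1 (∑ i, w i * Real.exp (s i)) := by fun_prop
    -- The last increment is traded for an independent copy at the cost 2b. The truncation at 1
    -- provides the boundedness that this exchange needs.
    have hstep := integral_prod_comp_le hS (hW n) hb (hβ n)
      (fun x y => min 1 (∑ i, w i * Real.exp ((x + y) i))) (by
        simp only [Function.uncurry_def]; fun_prop) (fun _ _ => h01 _)
      (fun _ _ => min_le_left _ _)
    simp only [Finset.sum_range_succ]
    refine hstep.trans ?_
    -- With the past frozen at `s`, averaging over the copy does not increase the truncated sum: the
    -- mean of a minimum is at most the minimum of the means, and each exponential moment is at most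
    -- 1.
    have hle : ∀ s : I → ℝ, ∫ ω', min 1 (∑ i, w i * Real.exp ((s + W n ω') i)) ∂P
        ≤ min 1 (∑ i, w i * Real.exp (s i)) := by
      intro s
      have hi : Integrable (fun ω' => ∑ i, w i * Real.exp ((s + W n ω') i)) P := by
        refine integrable_finsetSum _ fun i _ => ?_
        simp only [Pi.add_apply, Real.exp_add]
        exact ((hWi n i).const_mul _).const_mul _
      have him : Integrable (fun ω' => min 1 (∑ i, w i * Real.exp ((s + W n ω') i))) P :=
        (integrable_const 1).inf hi
      refine le_min ?_ ?_
      · calc _ ≤ ∫ _, (1 : ℝ) ∂P := integral_mono him (integrable_const _)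
              fun _ => min_le_left _ _
          _ = 1 := by simp
      · refine (integral_mono him hi fun _ => min_le_right _ _).trans ?_
        rw [integral_finsetSum]
        · refine Finset.sum_le_sum fun i _ => ?_
          simp only [Pi.add_apply, Real.exp_add]
          rw [integral_const_mul, integral_const_mul]
          exact mul_le_mul_of_nonneg_left
            (mul_le_of_le_one_right (Real.exp_pos _).le (hW1 n i)) (hw i)
        · intro i _
          simp only [Pi.add_apply, Real.exp_add]
          exact ((hWi n i).const_mul _).const_mul _
    have h_int : Integrable (fun ω => min 1 (∑ i, w i * Real.exp
        ((∑ j ∈ Finset.range n, W j ω) i))) P :=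
      Integrable.of_bound (hcont.measurable.comp hS).aestronglyMeasurable 1
        (ae_of_all _ fun ω => by
          rw [Real.norm_eq_abs, abs_of_nonneg (h01 _)]; exact min_le_left _ _)
    have := integral_mono_of_nonneg (ae_of_all _ fun ω => integral_nonneg fun ω' => h01 _) h_int
      (ae_of_all P fun ω => hle (∑ j ∈ Finset.range n, W j ω))
    push_cast
    linarith

end Mixing

/-! ### Blocking of the covariate process -/

section Blocks

lemma measurable_centered_sum {Ω : Type*} {m' : MeasurableSpace Ω} {E I : Type*} [MeasurableSpace E]
    {X : ℕ → Ω → E} {D : I → E → ℝ} (hD : ∀ i, Measurable (D i)) {s : Finset ℕ}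
    (hX : ∀ t ∈ s, Measurable (X t)) (c c' : ℝ) (e : I → ℝ) :
    Measurable fun ω i => c * (e i - 2 * (c' * ∑ t ∈ s, D i (X t ω))) :=
  measurable_pi_iff.2 fun i => Measurable.const_mul (measurable_const.sub (Measurable.const_mul
    (Measurable.const_mul (Finset.measurable_fun_sum _ fun t ht => (hD i).comp (hX t ht)) _) 2)) _

lemma measurable_finset_sum_vector {Ω : Type*} {m' : MeasurableSpace Ω} {I : Type*} {s : Finset ℕ}
    {W : ℕ → Ω → I → ℝ} (hW : ∀ j ∈ s, Measurable (W j)) : Measurable fun ω => ∑ j ∈ s, W j ω :=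
  Finset.measurable_fun_sum _ hW

variable {Ω : Type*} {mΩ : MeasurableSpace Ω} {P : Measure Ω}

/-- On [0,1], (1 - u/2)(1 + u + u²/2) = 1 + u/2 - u³/4 ≥ 1. -/
lemma exp_neg_le_one_sub_half {u : ℝ} (h0 : 0 ≤ u) (h1 : u ≤ 1) : Real.exp (-u) ≤ 1 - u / 2 := by
  have hpos : 0 < 1 + u + u ^ 2 / 2 := by positivity
  have h4 : 1 + u + u ^ 2 / 2 ≤ Real.exp u := Real.quadratic_le_exp_of_nonneg h0
  rw [Real.exp_neg]
  calc (Real.exp u)⁻¹ ≤ (1 + u + u ^ 2 / 2)⁻¹ := inv_anti₀ hpos h4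
    _ ≤ 1 - u / 2 := by
      rw [inv_le_iff_one_le_mul₀ hpos]
      nlinarith [mul_nonneg h0 h0, mul_nonneg h0 (sub_nonneg.2 h1),
        mul_nonneg (mul_nonneg h0 h0) (sub_nonneg.2 h1)]

/-- A one-sided exponential moment bound for nonnegative bounded variables. -/
lemma integral_exp_sub_two_mul_le_one [IsProbabilityMeasure P] {V : Ω → ℝ} (hV : Measurable V)
    {M : ℝ} (hM : 0 < M) (h0 : ∀ ω, 0 ≤ V ω) (h1 : ∀ ω, V ω ≤ M) :
    ∫ ω, Real.exp (1 / (2 * M) * (∫ ω', V ω' ∂P - 2 * V ω)) ∂P ≤ 1 := by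
  have hVi : Integrable V P := Integrable.of_bound hV.aestronglyMeasurable M
    (ae_of_all _ fun ω => by rw [Real.norm_eq_abs, abs_of_nonneg (h0 ω)]; exact h1 ω)
  have heq : ∀ ω, Real.exp (1 / (2 * M) * (∫ ω', V ω' ∂P - 2 * V ω))
      = Real.exp (1 / (2 * M) * ∫ ω', V ω' ∂P) * Real.exp (-(V ω / M)) := by
    intro ω
    rw [← Real.exp_add]; congr 1; field_simp; ring
  simp_rw [heq]
  rw [integral_const_mul]
  -- E exp(-V/M) ≤ 1 - EV/(2M) ≤ exp(-EV/(2M)). Because `V` enters with the factor 2 against its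
  -- mean, no variance term appears.
  have hle : ∫ ω, Real.exp (-(V ω / M)) ∂P ≤ ∫ ω, (1 - V ω / M / 2) ∂P := by
    refine integral_mono_of_nonneg (ae_of_all _ fun _ => (Real.exp_pos _).le) ?_
      (ae_of_all _ fun ω => ?_)
    · exact (integrable_const _).sub ((hVi.div_const _).div_const _)
    · exact exp_neg_le_one_sub_half (div_nonneg (h0 ω) hM.le) ((div_le_one hM).2 (h1 ω))
  rw [integral_sub (integrable_const _) ((hVi.div_const _).div_const _), integral_div,
    integral_div] at hle
  have h3 : 1 - (∫ ω, V ω ∂P) / M / 2 ≤ Real.exp (-(1 / (2 * M) * ∫ ω', V ω' ∂P)) := by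
    refine le_trans (le_of_eq ?_) (Real.add_one_le_exp _)
    field_simp; ring
  have h4 : ∫ ω, Real.exp (-(V ω / M)) ∂P ≤ Real.exp (-(1 / (2 * M) * ∫ ω', V ω' ∂P)) := by
    refine hle.trans (le_trans (le_of_eq ?_) h3); simp
  calc _ ≤ Real.exp (1 / (2 * M) * ∫ ω', V ω' ∂P) * Real.exp (-(1 / (2 * M) * ∫ ω', V ω' ∂P)) :=
        mul_le_mul_of_nonneg_left h4 (Real.exp_pos _).le
    _ = 1 := by rw [← Real.exp_add]; simp

lemma measurable_sigmaOf {E : Type*} [MeasurableSpace E] (X : ℕ → Ω → E) {I : Finset ℕ} {t : ℕ}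
    (ht : t ∈ I) : Measurable[sigmaOf X I] (X t) :=
  (comap_measurable (X t)).mono (le_iSup₂_of_le t ht le_rfl) le_rfl

/-- Indices of a block of length `a`. -/
def block (T a q : ℕ) : Finset ℕ := (Finset.Icc 1 T).filter fun t => t / a = q

lemma card_block_le (T : ℕ) {a : ℕ} (ha : 0 < a) (q : ℕ) : (block T a q).card ≤ a := by
  have : block T a q ⊆ Finset.Ico (q * a) (q * a + a) := by
    intro t ht
    simp only [block, Finset.mem_filter] at ht
    rw [Finset.mem_Ico, ← ht.2]
    exact ⟨Nat.div_mul_le_self t a, Nat.lt_div_mul_add ha⟩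
  simpa using Finset.card_le_card this

/-- The exponential union bound for the blocks of one parity. -/
lemma integral_min_one_sum_exp_block_le [IsProbabilityMeasure P] {E : Type*} [MeasurableSpace E]
    {I : Type*} [Fintype I] {T : ℕ} (hT : 0 < T) {X : ℕ → Ω → E}
    (hX : ∀ t ∈ Finset.Icc 1 T, Measurable (X t)) {D : I → E → ℝ} (hD : ∀ i, Measurable (D i))
    {M : ℝ} (hM : 0 < M) (hD0 : ∀ i x, 0 ≤ D i x) (hDM : ∀ i x, D i x ≤ M)
    {a : ℕ} (ha : 0 < a) {b : ℝ} (hb : 0 ≤ b) (hβ : betaMixing P T X a ≤ ENNReal.ofReal b)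
    {w : I → ℝ} (hw : ∀ i, 0 ≤ w i) {r : ℕ} (hr : r < 2) :
    ∫ ω, min 1 (∑ i, w i * Real.exp (T / (2 * (a * M)) * ((1 / (T : ℝ)) *
      ∑ t ∈ (Finset.Icc 1 T).filter (fun t => t / a % 2 = r),
        (∫ ω', D i (X t ω') ∂P - 2 * D i (X t ω))))) ∂P ≤ 2 * b * (T + 1) + ∑ i, w i := by
  have hTr : (0 : ℝ) < T := by exact_mod_cast hT
  have har : (0 : ℝ) < a := by exact_mod_cast ha
  set U : ℕ → Ω → I → ℝ := fun q ω i => (1 / (T : ℝ)) * ∑ t ∈ block T a q, D i (X t ω) with hU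
  have hUm : ∀ q i, Measurable fun ω => U q ω i := by
    intro q i
    refine Measurable.const_mul (Finset.measurable_fun_sum _ fun t ht => (hD i).comp (hX t ?_)) _
    exact (Finset.mem_filter.1 ht).1
  have hU0 : ∀ q ω i, 0 ≤ U q ω i := fun q ω i =>
    mul_nonneg (by positivity) (Finset.sum_nonneg fun t _ => hD0 _ _)
  have hU1 : ∀ q ω i, U q ω i ≤ a * M / T := by
    intro q ω i
    have : ∑ t ∈ block T a q, D i (X t ω) ≤ a * M := by
      refine (Finset.sum_le_card_nsmul _ _ M fun t _ => hDM _ _).trans ?_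
      rw [nsmul_eq_mul]
      exact mul_le_mul_of_nonneg_right (by exact_mod_cast card_block_le T ha q) hM.le
    simp only [hU]
    rw [one_div, inv_mul_eq_div]
    gcongr
  -- The blocks of parity `r` are those with index 2j + r. The scale is the one allowed for
  -- variables in [0, aM/T].
  set W : ℕ → Ω → I → ℝ := fun j ω i =>
    1 / (2 * (a * M / T)) * (∫ ω', U (2 * j + r) ω' i ∂P - 2 * U (2 * j + r) ω i) with hWdef
  have hWm : ∀ j, Measurable (W j) := fun j => measurable_pi_iff.2 fun i =>
    ((measurable_const.sub ((hUm _ i).const_mul 2)).const_mul _)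
  have hpos : 0 < a * M / T := by positivity
  have hWi : ∀ k i, Integrable (fun ω => Real.exp (W k ω i)) P := by
    intro k i
    refine Integrable.of_bound (((measurable_pi_iff.1 (hWm k)) i).exp).aestronglyMeasurable
      (Real.exp (1 / (2 * (a * M / T)) * ∫ ω', U (2 * k + r) ω' i ∂P)) (ae_of_all _ fun ω => ?_)
    rw [Real.norm_eq_abs, Real.abs_exp]
    refine Real.exp_le_exp.2 (mul_le_mul_of_nonneg_left ?_ (by positivity))
    linarith [hU0 (2 * k + r) ω i]
  -- T + 1 summands suffice, since t / a / 2 ≤ T for every t ≤ T; superfluous blocks are empty.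
  have key := integral_min_one_sum_exp_le hWm hWi
    (fun k i => integral_exp_sub_two_mul_le_one (hUm _ i) hpos (fun ω => hU0 _ ω i)
      (fun ω => hU1 _ ω i)) hb (fun k => ?_) hw (T + 1)
  · push_cast at key
    convert key using 8 with ω i _
    rw [Finset.sum_apply]
    simp only [hWdef]
    rw [← Finset.mul_sum]
    have hDi : ∀ t ∈ Finset.Icc 1 T, Integrable (fun ω => D i (X t ω)) P := fun t ht =>
      Integrable.of_bound ((hD i).comp (hX t ht)).aestronglyMeasurable M (ae_of_all _ fun ω => by
        rw [Real.norm_eq_abs, abs_of_nonneg (hD0 _ _)]; exact hDM _ _)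
    have hEU : ∀ q, ∫ ω', U q ω' i ∂P - 2 * U q ω i
        = (1 / (T : ℝ)) * ∑ t ∈ block T a q, (∫ ω', D i (X t ω') ∂P - 2 * D i (X t ω)) := by
      intro q
      simp only [hU]
      rw [integral_const_mul, integral_finsetSum (block T a q) fun t ht => hDi t (Finset.mem_filter.1 ht).1,
        Finset.sum_sub_distrib, ← Finset.mul_sum]
      ring
    simp_rw [hEU]
    rw [← Finset.mul_sum]
    congr 1
    · field_simp
    · congr 1
      have hmap : ∀ t ∈ (Finset.Icc 1 T).filter (fun t => t / a % 2 = r),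
          t / a / 2 ∈ Finset.range (T + 1) := by
        intro t ht
        simp only [Finset.mem_filter, Finset.mem_Icc, Finset.mem_range] at ht ⊢
        have h1 := Nat.div_le_self t a
        have h2 := Nat.div_le_self (t / a) 2
        omega
      rw [← Finset.sum_fiberwise_of_maps_to hmap]
      refine Finset.sum_congr rfl fun j _ => Finset.sum_congr ?_ fun _ _ => rfl
      ext t
      simp only [block, Finset.mem_filter, Finset.mem_Icc]
      constructor
      · rintro ⟨⟨h, h'⟩, h''⟩; exact ⟨h, by omega⟩
      · rintro ⟨h, h'⟩; exact ⟨⟨h, by omega⟩, by omega⟩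
  -- For k = 0 there is no past. For k ≥ 1 the earlier blocks of the same parity end before (2k + r
  -- - 1)a and the next one starts at (2k + r)a, so the skipped block of the other parity provides
  -- the lag a.
  · rcases Nat.eq_zero_or_pos k with rfl | hk
    · simp only [Finset.range_zero, Finset.sum_empty]
      rw [MeasurableSpace.comap_const, betaCoeff_bot_left]
      exact zero_le
    · refine le_trans ?_ ((le_iSup _ ((2 * k + r - 1) * a)).trans hβ)
      refine betaCoeff_mono ?_ ?_
      · rw [← measurable_iff_comap_le]
        refine measurable_finset_sum_vector fun j hj => measurable_centered_sum hD (fun t ht => ?_) _ _ _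
        refine measurable_sigmaOf X ?_
        simp only [block, Finset.mem_filter, Finset.mem_Icc, Finset.mem_inter,
          Finset.mem_range] at ht hj ⊢
        refine ⟨⟨ht.1.1, ?_⟩, ht.1⟩
        have h1 : t < (t / a) * a + a := Nat.lt_div_mul_add ha
        rw [ht.2] at h1
        have h2 : (2 * j + r + 1) * a ≤ (2 * k + r - 1) * a := Nat.mul_le_mul_right _ (by omega)
        nlinarith
      · rw [← measurable_iff_comap_le]
        refine measurable_centered_sum hD (fun t ht => ?_) _ _ _
        refine measurable_sigmaOf X ?_
        simp only [block, Finset.mem_filter, Finset.mem_Icc, Finset.mem_inter] at ht ⊢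
        refine ⟨⟨?_, ht.1.2⟩, ht.1⟩
        have h1 : (t / a) * a ≤ t := Nat.div_mul_le_self t a
        rw [ht.2] at h1
        refine le_trans (le_of_eq ?_) h1
        obtain ⟨q, hq⟩ : ∃ q, 2 * k + r = q + 1 := ⟨2 * k + r - 1, by omega⟩
        rw [hq]; simp; ring

end Blocks

/-! ### An exponential supermartingale -/

section Martingale

/-- For |x| ≤ 1 compare the second-order remainder with x²; for x > 1 use x ≤ x²; for x < -1 use e^x
≤ 1. The linear term is what conditional centering removes. -/
lemma exp_le_add_exp_sq (x : ℝ) : Real.exp x ≤ x + Real.exp (x ^ 2) := by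
  rcases le_or_gt |x| 1 with h | h
  · have h1 := (abs_le.1 (Real.abs_exp_sub_one_sub_id_le h)).2
    linarith [Real.add_one_le_exp (x ^ 2)]
  · rcases lt_abs.1 h with h | h
    · have : Real.exp x ≤ Real.exp (x ^ 2) := Real.exp_le_exp.2 (by nlinarith)
      linarith
    · have h1 : Real.exp x ≤ 1 := Real.exp_le_one_iff.2 (by linarith)
      nlinarith [Real.add_one_le_exp (x ^ 2)]

/-- Convexity of exp between 0 and y. It transfers the conditional moment at scale `K_t` to smaller
exponents. -/
lemma exp_mul_le_one_add {q y : ℝ} (h0 : 0 ≤ q) (h1 : q ≤ 1) :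
    Real.exp (q * y) ≤ 1 + q * (Real.exp y - 1) := by
  have := convexOn_exp.2 (Set.mem_univ y) (Set.mem_univ 0) h0 (sub_nonneg.2 h1) (by ring)
  simp only [smul_eq_mul, mul_zero, add_zero, Real.exp_zero, mul_one] at this
  linarith

variable {Ω : Type*} {G mΩ : MeasurableSpace Ω} {P : Measure Ω}

lemma integral_mul_condExp_eq [IsFiniteMeasure P] (hG : G ≤ mΩ)
    {g f : Ω → ℝ} (hg : Measurable[G] g) {c : ℝ} (hgc : ∀ ω, |g ω| ≤ c) (hf : Integrable f P) :
    ∫ ω, g ω * f ω ∂P = ∫ ω, g ω * (P[f | G]) ω ∂P := by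
  have h := condExp_stronglyMeasurable_mul_of_bound hG hg.stronglyMeasurable hf c
    (ae_of_all _ fun ω => hgc ω)
  rw [← integral_condExp hG]
  exact integral_congr_ae h

/-- One step of the supermartingale. With q = k²c² ≤ 1, the conditional mean of e^{cv} is at most
that of cv + 1 + q(e^{v²/k²} - 1), hence at most 1 + q ≤ e^q. Boundedness of `Z` makes all products
integrable. -/
lemma integral_mul_exp_le [IsProbabilityMeasure P] (hG : G ≤ mΩ)
    {v : Ω → ℝ} (hv : Measurable v) {k : ℝ} (hk : 0 < k)
    (hv0 : P[v | G] =ᵐ[P] 0) (hi : Integrable (fun ω => Real.exp (v ω ^ 2 / k ^ 2)) P)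
    (hle : ∀ᵐ ω ∂P, (P[fun ω' => Real.exp (v ω' ^ 2 / k ^ 2) | G]) ω ≤ 2)
    {c : Ω → ℝ} (hc : Measurable[G] c) (hck : ∀ ω, |c ω| * k ≤ 1)
    {Z : Ω → ℝ} (hZ : Measurable[G] Z) (hZ0 : ∀ ω, 0 ≤ Z ω) {n : ℝ} (hZn : ∀ ω, Z ω ≤ n) :
    Integrable (fun ω => Z ω * Real.exp (c ω * v ω - k ^ 2 * c ω ^ 2)) P ∧
    ∫ ω, Z ω * Real.exp (c ω * v ω - k ^ 2 * c ω ^ 2) ∂P ≤ ∫ ω, Z ω ∂P := by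
  have hvi : Integrable v P := by
    refine (hi.const_mul k).mono' hv.aestronglyMeasurable (ae_of_all _ fun ω => ?_)
    have h1 := Real.add_one_le_exp (v ω ^ 2 / k ^ 2)
    rw [Real.norm_eq_abs]
    have h2 : |v ω| / k ≤ 1 + v ω ^ 2 / k ^ 2 := by
      rw [← sq_abs (v ω), ← div_pow]; nlinarith [sq_nonneg (|v ω| / k - 1)]
    rw [div_le_iff₀ hk] at h2
    nlinarith
  have hq0 : ∀ ω, 0 ≤ k ^ 2 * c ω ^ 2 := fun ω => by positivity
  have hq1 : ∀ ω, k ^ 2 * c ω ^ 2 ≤ 1 := fun ω => by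
    have : (|c ω| * k) ^ 2 ≤ 1 := pow_le_one₀ (by positivity) (hck ω)
    rw [mul_pow, sq_abs] at this; linarith
  have hc1 : ∀ ω, |c ω| ≤ 1 / k := fun ω => by rw [le_div_iff₀ hk]; exact hck ω
  set q : Ω → ℝ := fun ω => k ^ 2 * c ω ^ 2 with hq
  have hqm : Measurable[G] q := (hc.pow_const 2).const_mul _
  set A : Ω → ℝ := fun ω => Z ω * Real.exp (-q ω) with hA
  have hAm : Measurable[G] A := hZ.mul (Real.measurable_exp.comp hqm.neg)
  have hA0 : ∀ ω, 0 ≤ A ω := fun ω => mul_nonneg (hZ0 ω) (Real.exp_pos _).le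
  have hAn : ∀ ω, A ω ≤ n := fun ω =>
    (mul_le_of_le_one_right (hZ0 ω) (Real.exp_le_one_iff.2 (by simpa using hq0 ω))).trans (hZn ω)
  have hn : ∀ ω : Ω, 0 ≤ n := fun ω => (hZ0 ω).trans (hZn ω)
  have hbd : ∀ ω, |A ω * q ω| ≤ n := fun ω => by
    rw [abs_of_nonneg (mul_nonneg (hA0 ω) (hq0 ω))]
    exact (mul_le_of_le_one_right (hA0 ω) (hq1 ω)).trans (hAn ω)
  have hbd2 : ∀ ω, |A ω * c ω| ≤ n * (1 / k) := fun ω => by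
    rw [abs_mul, abs_of_nonneg (hA0 ω)]
    exact mul_le_mul (hAn ω) (hc1 ω) (abs_nonneg _) (hn ω)
  have hAi : Integrable A P := Integrable.of_bound (hAm.mono hG le_rfl).aestronglyMeasurable n
    (ae_of_all _ fun ω => by rw [Real.norm_eq_abs, abs_of_nonneg (hA0 ω)]; exact hAn ω)
  have hAqi : Integrable (fun ω => A ω * q ω) P :=
    Integrable.of_bound ((hAm.mul hqm).mono hG le_rfl).aestronglyMeasurable n (ae_of_all _ hbd)
  have hI1 : Integrable (fun ω => (A ω * c ω) * v ω) P :=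
    hvi.bdd_mul ((hAm.mul hc).mono hG le_rfl).aestronglyMeasurable (ae_of_all _ hbd2)
  have hI2 : Integrable (fun ω => (A ω * q ω) * Real.exp (v ω ^ 2 / k ^ 2)) P :=
    hi.bdd_mul ((hAm.mul hqm).mono hG le_rfl).aestronglyMeasurable (ae_of_all _ hbd)
  have hI3 : Integrable (fun ω => (A ω * q ω) *
      (P[fun ω' => Real.exp (v ω' ^ 2 / k ^ 2) | G]) ω) P :=
    integrable_condExp.bdd_mul ((hAm.mul hqm).mono hG le_rfl).aestronglyMeasurable
      (ae_of_all _ hbd)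
  have hpt : ∀ ω, Z ω * Real.exp (c ω * v ω - k ^ 2 * c ω ^ 2)
      ≤ (A ω * c ω) * v ω + (A ω - A ω * q ω) + (A ω * q ω) * Real.exp (v ω ^ 2 / k ^ 2) := by
    intro ω
    have h1 := exp_le_add_exp_sq (c ω * v ω)
    have h2 : (c ω * v ω) ^ 2 = q ω * (v ω ^ 2 / k ^ 2) := by
      simp only [hq]; field_simp
    rw [h2] at h1
    have h3 := h1.trans (add_le_add_right
      (exp_mul_le_one_add (y := v ω ^ 2 / k ^ 2) (hq0 ω) (hq1 ω)) _)
    have h4 := mul_le_mul_of_nonneg_left h3 (hA0 ω)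
    have h5 : Z ω * Real.exp (c ω * v ω - k ^ 2 * c ω ^ 2) = A ω * Real.exp (c ω * v ω) := by
      simp only [hA, hq]; rw [mul_assoc, ← Real.exp_add]; ring_nf
    rw [h5]
    refine h4.trans (le_of_eq ?_)
    simp only [hq]; ring
  have hIR := (hI1.add (hAi.sub hAqi)).add hI2
  have hZm : Measurable fun ω => Z ω * Real.exp (c ω * v ω - k ^ 2 * c ω ^ 2) := by
    have h1 := hZ.mono hG le_rfl
    have h2 := hc.mono hG le_rfl
    fun_prop
  have hInt : Integrable (fun ω => Z ω * Real.exp (c ω * v ω - k ^ 2 * c ω ^ 2)) P := by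
    refine hIR.mono' hZm.aestronglyMeasurable (ae_of_all _ fun ω => ?_)
    rw [Real.norm_eq_abs, abs_of_nonneg (mul_nonneg (hZ0 ω) (Real.exp_pos _).le)]
    exact hpt ω
  refine ⟨hInt, ?_⟩
  have hZi : Integrable Z P := Integrable.of_bound (hZ.mono hG le_rfl).aestronglyMeasurable n
    (ae_of_all _ fun ω => by rw [Real.norm_eq_abs, abs_of_nonneg (hZ0 ω)]; exact hZn ω)
  calc ∫ ω, Z ω * Real.exp (c ω * v ω - k ^ 2 * c ω ^ 2) ∂P
      ≤ ∫ ω, ((A ω * c ω) * v ω + (A ω - A ω * q ω)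
          + (A ω * q ω) * Real.exp (v ω ^ 2 / k ^ 2)) ∂P := integral_mono hInt hIR hpt
    _ = ∫ ω, (A ω * c ω) * v ω ∂P + ∫ ω, (A ω - A ω * q ω) ∂P
          + ∫ ω, (A ω * q ω) * Real.exp (v ω ^ 2 / k ^ 2) ∂P := by
        refine (integral_add (hI1.add (hAi.sub hAqi)) hI2).trans ?_
        congr 1
        exact integral_add hI1 (hAi.sub hAqi)
    _ ≤ 0 + ∫ ω, (A ω - A ω * q ω) ∂P + ∫ ω, (A ω * q ω) * 2 ∂P := by
        refine add_le_add (add_le_add (le_of_eq ?_) le_rfl) ?_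
        · refine (integral_mul_condExp_eq hG (hAm.mul hc) hbd2 hvi).trans ?_
          refine (integral_congr_ae ?_).trans (integral_zero _ _)
          filter_upwards [hv0] with ω h; simp [h]
        · refine (integral_mul_condExp_eq hG (hAm.mul hqm) hbd hi).le.trans ?_
          refine integral_mono_ae hI3 (hAqi.mul_const 2) ?_
          filter_upwards [hle] with ω h
          exact mul_le_mul_of_nonneg_left h (mul_nonneg (hA0 ω) (hq0 ω))
    _ = ∫ ω, A ω * (1 + q ω) ∂P := by
        rw [zero_add]
        refine (integral_add (hAi.sub hAqi) (hAqi.mul_const 2)).symm.trans ?_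
        congr 1; ext ω; simp only [Pi.sub_apply]; ring
    _ ≤ ∫ ω, Z ω ∂P := by
        refine integral_mono ?_ hZi fun ω => ?_
        · refine (hAi.add hAqi).congr (ae_of_all _ fun ω => ?_)
          simp only [Pi.add_apply]; ring
        · have h1 : 1 + q ω ≤ Real.exp (q ω) := by linarith [Real.add_one_le_exp (q ω)]
          calc A ω * (1 + q ω) ≤ A ω * Real.exp (q ω) := mul_le_mul_of_nonneg_left h1 (hA0 ω)
            _ = Z ω := by simp only [hA]; rw [mul_assoc, ← Real.exp_add]; simp

/-- Truncating `Z` and passing to the limit by monotone convergence removes its bound, as is needed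
when `Z` is the exponential of the past. -/
lemma lintegral_mul_exp_le [IsProbabilityMeasure P] (hG : G ≤ mΩ)
    {v : Ω → ℝ} (hv : Measurable v) {k : ℝ} (hk : 0 < k)
    (hv0 : P[v | G] =ᵐ[P] 0) (hi : Integrable (fun ω => Real.exp (v ω ^ 2 / k ^ 2)) P)
    (hle : ∀ᵐ ω ∂P, (P[fun ω' => Real.exp (v ω' ^ 2 / k ^ 2) | G]) ω ≤ 2)
    {c : Ω → ℝ} (hc : Measurable[G] c) (hck : ∀ ω, |c ω| * k ≤ 1)
    {Z : Ω → ℝ} (hZ : Measurable[G] Z) (hZ0 : ∀ ω, 0 ≤ Z ω) :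
    ∫⁻ ω, ENNReal.ofReal (Z ω * Real.exp (c ω * v ω - k ^ 2 * c ω ^ 2)) ∂P
      ≤ ∫⁻ ω, ENNReal.ofReal (Z ω) ∂P := by
  set e : Ω → ℝ := fun ω => Real.exp (c ω * v ω - k ^ 2 * c ω ^ 2) with he
  have hem : Measurable e := by
    have h2 := hc.mono hG le_rfl
    fun_prop
  have hZm : Measurable Z := hZ.mono hG le_rfl
  have h := lintegral_tendsto_of_tendsto_of_monotone (μ := P)
    (f := fun (n : ℕ) ω => ENNReal.ofReal (min (Z ω) n * e ω))
    (F := fun ω => ENNReal.ofReal (Z ω * e ω)) (fun n => by fun_prop)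
    (ae_of_all _ fun ω n n' hn => ENNReal.ofReal_le_ofReal (mul_le_mul_of_nonneg_right
      (min_le_min_left _ (by exact_mod_cast hn)) (Real.exp_pos _).le))
    (ae_of_all _ fun ω => by
      refine tendsto_const_nhds.congr' ?_
      filter_upwards [eventually_ge_atTop ⌈Z ω⌉₊] with n hn
      rw [min_eq_left ((Nat.le_ceil _).trans (by exact_mod_cast hn))])
  refine le_of_tendsto' h fun n => ?_
  have h0 : ∀ ω, 0 ≤ min (Z ω) (n : ℝ) := fun ω => le_min (hZ0 ω) n.cast_nonneg
  obtain ⟨h1, h2⟩ := integral_mul_exp_le hG hv hk hv0 hi hle hc hck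
    (hZ.min measurable_const) h0 (n := n) (fun ω => min_le_right _ _)
  rw [← ofReal_integral_eq_lintegral_ofReal h1
    (ae_of_all _ fun ω => mul_nonneg (h0 ω) (Real.exp_pos _).le)]
  refine (ENNReal.ofReal_le_ofReal h2).trans ?_
  rw [ofReal_integral_eq_lintegral_ofReal _ (ae_of_all _ h0)]
  · exact lintegral_mono fun ω => ENNReal.ofReal_le_ofReal (min_le_left _ _)
  · exact Integrable.of_bound (hZm.min measurable_const).aestronglyMeasurable n
      (ae_of_all _ fun ω => by
        rw [Real.norm_eq_abs, abs_of_nonneg (h0 ω)]; exact min_le_right _ _)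

/-- The exponential supermartingale of a conditionally sub-Gaussian sequence with predictable
coefficients. -/
lemma lintegral_exp_sum_le_one [IsProbabilityMeasure P] {𝒢 : Filtration ℕ mΩ} {T : ℕ}
    {v c : ℕ → Ω → ℝ} {K : ℝ} (hv : ∀ t ∈ Finset.Icc 1 T, Measurable[𝒢 t] (v t))
    (hv0 : ∀ t ∈ Finset.Icc 1 T, P[v t | 𝒢 (t - 1)] =ᵐ[P] 0)
    (hsub : ∀ t ∈ Finset.Icc 1 T, ∃ Kt : ℝ, 0 < Kt ∧ Kt ≤ K ∧
      Integrable (fun ω => Real.exp (v t ω ^ 2 / Kt ^ 2)) P ∧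
      ∀ᵐ ω ∂P, (P[fun ω' => Real.exp (v t ω' ^ 2 / Kt ^ 2) | 𝒢 (t - 1)]) ω ≤ 2)
    (hc : ∀ t ∈ Finset.Icc 1 T, Measurable[𝒢 (t - 1)] (c t))
    (hcK : ∀ t ∈ Finset.Icc 1 T, ∀ ω, |c t ω| * K ≤ 1) :
    ∫⁻ ω, ENNReal.ofReal (Real.exp (∑ t ∈ Finset.Icc 1 T,
      (c t ω * v t ω - K ^ 2 * c t ω ^ 2))) ∂P ≤ 1 := by
  suffices H : ∀ n ≤ T, ∫⁻ ω, ENNReal.ofReal (Real.exp (∑ t ∈ Finset.Icc 1 n,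
      (c t ω * v t ω - K ^ 2 * c t ω ^ 2))) ∂P ≤ 1 from H T le_rfl
  intro n
  induction n with
  | zero => simp
  | succ n ih =>
    intro hn
    have hmem : n + 1 ∈ Finset.Icc 1 T := by simp [hn]
    obtain ⟨k, hk, hkK, hki, hk2⟩ := hsub _ hmem
    simp only [Nat.add_sub_cancel] at hk2
    have hZ : Measurable[𝒢 n] fun ω => Real.exp (∑ t ∈ Finset.Icc 1 n,
        (c t ω * v t ω - K ^ 2 * c t ω ^ 2)) := by
      refine Real.measurable_exp.comp (Finset.measurable_fun_sum _ fun t ht => ?_)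
      have ht' := Finset.mem_Icc.1 ht
      have hmt : t ∈ Finset.Icc 1 T := Finset.mem_Icc.2 ⟨ht'.1, by omega⟩
      have h1 : Measurable[𝒢 n] (c t) := (hc t hmt).mono (𝒢.mono (by omega)) le_rfl
      have h2 : Measurable[𝒢 n] (v t) := (hv t hmt).mono (𝒢.mono ht'.2) le_rfl
      exact (h1.mul h2).sub ((h1.pow_const 2).const_mul _)
    have key := lintegral_mul_exp_le (𝒢.le n) ((hv _ hmem).mono (𝒢.le _) le_rfl) hk
      (by simpa using hv0 _ hmem) hki hk2 (by simpa using hc _ hmem)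
      (fun ω => (mul_le_mul_of_nonneg_left hkK (abs_nonneg _)).trans (hcK _ hmem ω))
      hZ (fun ω => (Real.exp_pos _).le)
    refine le_trans (lintegral_mono fun ω => ENNReal.ofReal_le_ofReal ?_)
      (key.trans (ih (by omega)))
    rw [Finset.sum_Icc_succ_top (by omega), Real.exp_add]
    refine mul_le_mul_of_nonneg_left (Real.exp_le_exp.2 ?_) (Real.exp_pos _).le
    have : k ^ 2 ≤ K ^ 2 := pow_le_pow_left₀ hk.le hkK 2
    nlinarith [sq_nonneg (c (n + 1) ω)]

end Martingale

/-! ### Perturbation of the parameters of a network -/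

section Perturbation

/-- The Euclidean norm of a vector. -/
def l2 {n : ℕ} (x : Fin n → ℝ) : ℝ := ‖WithLp.toLp 2 x‖

lemma l2_nonneg {n : ℕ} (x : Fin n → ℝ) : 0 ≤ l2 x := norm_nonneg _

lemma l2_sq {n : ℕ} (x : Fin n → ℝ) : l2 x ^ 2 = ∑ i, x i ^ 2 := by
  simp [l2, EuclideanSpace.norm_sq_eq]

lemma l2_add_le {n : ℕ} (x y : Fin n → ℝ) : l2 (x + y) ≤ l2 x + l2 y := by
  simpa [l2] using norm_add_le (WithLp.toLp 2 x) (WithLp.toLp 2 y)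

lemma l2_le_of_sq_le {n : ℕ} {x : Fin n → ℝ} {c : ℝ} (hc : 0 ≤ c) (h : ∑ i, x i ^ 2 ≤ c ^ 2) :
    l2 x ≤ c := by
  rw [← l2_sq] at h
  exact (sq_le_sq₀ (l2_nonneg _) hc).1 h

lemma l2_le_mul_of_abs_le {n : ℕ} {x y : Fin n → ℝ} {c : ℝ} (hc : 0 ≤ c)
    (h : ∀ i, |x i| ≤ c * |y i|) : l2 x ≤ c * l2 y := by
  refine l2_le_of_sq_le (mul_nonneg hc (l2_nonneg _)) ?_
  rw [mul_pow, l2_sq, Finset.mul_sum]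
  refine Finset.sum_le_sum fun i _ => ?_
  rw [← sq_abs (x i), ← sq_abs (y i), ← mul_pow]
  exact pow_le_pow_left₀ (abs_nonneg _) (h i) 2

lemma l2_const_le {n : ℕ} {x : Fin n → ℝ} {c : ℝ} (hc : 0 ≤ c) (h : ∀ i, |x i| ≤ c) :
    l2 x ≤ c * √n := by
  refine l2_le_of_sq_le (by positivity) ?_
  rw [mul_pow, Real.sq_sqrt (by positivity)]
  refine (Finset.sum_le_card_nsmul _ _ (c ^ 2) fun i _ => ?_).trans (by simp [mul_comm])
  rw [← sq_abs]; exact pow_le_pow_left₀ (abs_nonneg _) (h i) 2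

/-- The sum of squares of a list. -/
def sumSq (l : List ℝ) : ℝ := (l.map (· ^ 2)).sum

/-- The number of nonzero entries of a list. -/
def nnz (l : List ℝ) : ℕ := l.countP (· ≠ 0)

lemma nnz_append (l l' : List ℝ) : nnz (l ++ l') = nnz l + nnz l' := List.countP_append

lemma nnz_le_length (l : List ℝ) : nnz l ≤ l.length := List.countP_le_length

lemma sumSq_append (l l' : List ℝ) : sumSq (l ++ l') = sumSq l + sumSq l' := by simp [sumSq]

lemma sumSq_nonneg (l : List ℝ) : 0 ≤ sumSq l :=
  List.sum_nonneg fun a ha => by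
    obtain ⟨x, -, rfl⟩ := List.mem_map.1 ha; positivity

lemma sumSq_le_mul_nnz {l : List ℝ} {B : ℝ} (h : ∀ a ∈ l, |a| ≤ B) :
    sumSq l ≤ B ^ 2 * nnz l := by
  induction l with
  | nil => simp [sumSq, nnz]
  | cons a l ih =>
    have ih' := ih fun x hx => h x (List.mem_cons_of_mem _ hx)
    have ha := h a List.mem_cons_self
    simp only [sumSq, nnz, List.map_cons, List.sum_cons, List.countP_cons] at ih' ⊢
    by_cases h0 : a = 0
    · simpa [h0] using ih'
    · have : a ^ 2 ≤ B ^ 2 := by rw [← sq_abs]; exact pow_le_pow_left₀ (abs_nonneg _) ha 2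
      simp only [ne_eq, h0, not_false_eq_true, decide_true, if_true]
      push_cast
      linarith

lemma sumSq_vec {m n : ℕ} (W : Matrix (Fin m) (Fin n) ℝ) :
    sumSq (DNN.vec W) = ∑ i, ∑ j, W i j ^ 2 := by
  rw [Finset.sum_comm, sumSq, DNN.vec, List.map_flatMap, List.flatMap, List.sum_flatten,
    List.map_map, Fin.sum_univ_def]
  congr 1
  refine List.map_congr_left fun j _ => ?_
  simp only [Function.comp_apply, List.map_map, Fin.sum_univ_def]
  rfl

lemma sumSq_ofFn {m : ℕ} (b : Fin m → ℝ) : sumSq (List.ofFn b) = ∑ i, b i ^ 2 := by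
  rw [sumSq, List.map_ofFn, List.sum_ofFn]; rfl

lemma length_vec {m n : ℕ} (W : Matrix (Fin m) (Fin n) ℝ) : (DNN.vec W).length = n * m := by
  simp [DNN.vec, List.length_flatMap]

lemma mem_vec {m n : ℕ} (W : Matrix (Fin m) (Fin n) ℝ) (i : Fin m) (j : Fin n) :
    W i j ∈ DNN.vec W := by
  simp only [DNN.vec, List.mem_flatMap, List.mem_map]
  exact ⟨j, List.mem_finRange j, i, List.mem_finRange i, rfl⟩

lemma l2_mulVec_le {m n : ℕ} (W : Matrix (Fin m) (Fin n) ℝ) (x : Fin n → ℝ) :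
    l2 (W *ᵥ x) ≤ √(sumSq (DNN.vec W)) * l2 x := by
  refine l2_le_of_sq_le (mul_nonneg (Real.sqrt_nonneg _) (l2_nonneg _)) ?_
  rw [mul_pow, Real.sq_sqrt (sumSq_nonneg _), sumSq_vec, l2_sq, Finset.sum_mul]
  refine Finset.sum_le_sum fun i _ => ?_
  have h : (∑ j, W i j * x j) ^ 2 ≤ (∑ j, W i j ^ 2) * ∑ j, x j ^ 2 :=
    Finset.sum_mul_sq_le_sq_mul_sq _ _ _
  exact h

/-- Cauchy–Schwarz for the augmented matrix (W, b) applied to (x, 1), whose norm is at most `M`. -/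
lemma l2_affine_le {m n : ℕ} (W : Matrix (Fin m) (Fin n) ℝ) (b : Fin m → ℝ) (x : Fin n → ℝ)
    {M : ℝ} (hx : l2 x ^ 2 + 1 ≤ M ^ 2) (hM : 0 ≤ M) :
    l2 (W *ᵥ x + b) ≤ √(sumSq (DNN.vec W ++ List.ofFn b)) * M := by
  refine l2_le_of_sq_le (mul_nonneg (Real.sqrt_nonneg _) hM) ?_
  rw [mul_pow, Real.sq_sqrt (sumSq_nonneg _), sumSq_append, sumSq_vec, sumSq_ofFn,
    ← Finset.sum_add_distrib, Finset.sum_mul]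
  refine Finset.sum_le_sum fun i _ => ?_
  have h1 : (∑ j, W i j * x j) ^ 2 ≤ (∑ j, W i j ^ 2) * ∑ j, x j ^ 2 :=
    Finset.sum_mul_sq_le_sq_mul_sq _ _ _
  rw [← l2_sq x] at h1
  have hU : 0 ≤ ∑ j, W i j ^ 2 := Finset.sum_nonneg fun _ _ => sq_nonneg _
  set U := ∑ j, W i j ^ 2
  set p := ∑ j, W i j * x j
  have heq : (W *ᵥ x + b) i = p + b i := rfl
  rw [heq]
  have h2 : |p| ≤ √U * l2 x := by
    refine abs_le_of_sq_le_sq ?_ (mul_nonneg (Real.sqrt_nonneg _) (l2_nonneg _))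
    rw [mul_pow, Real.sq_sqrt hU]; exact h1
  have h3 : p * b i ≤ √U * l2 x * |b i| := (le_abs_self _).trans (by
    rw [abs_mul]; exact mul_le_mul_of_nonneg_right h2 (abs_nonneg _))
  have h4 : 2 * (√U * (l2 x * |b i|)) ≤ U + l2 x ^ 2 * b i ^ 2 := by
    have := sq_nonneg (√U - l2 x * |b i|)
    rw [sub_sq, Real.sq_sqrt hU, mul_pow, sq_abs] at this
    linarith
  have h5 : (p + b i) ^ 2 ≤ (U + b i ^ 2) * (l2 x ^ 2 + 1) := by nlinarith
  exact h5.trans (mul_le_mul_of_nonneg_left hx (by positivity))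

namespace DNN

/-- Apply a function to all parameters of a network. -/
def map (φ : ℝ → ℝ) : {n : ℕ} → DNN n → DNN n
  | _, output W b => output (W.map φ) (φ ∘ b)
  | _, hidden m hm W b f => hidden m hm (W.map φ) (φ ∘ b) (map φ f)

lemma vec_map (φ : ℝ → ℝ) {m n : ℕ} (W : Matrix (Fin m) (Fin n) ℝ) :
    vec (W.map φ) = (vec W).map φ := by
  simp [vec, List.map_flatMap, Function.comp_def]

lemma params_map (φ : ℝ → ℝ) {n : ℕ} (f : DNN n) : (f.map φ).params = f.params.map φ := by
  induction f with
  | output W b => simp [map, params, vec_map]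
  | hidden m hm W b f ih => simp [map, params, vec_map, List.map_ofFn, ih]

lemma depth_map (φ : ℝ → ℝ) {n : ℕ} (f : DNN n) : (f.map φ).depth = f.depth := by
  induction f with
  | output W b => rfl
  | hidden m hm W b f ih => simp [map, depth, ih]

lemma width_map (φ : ℝ → ℝ) {n : ℕ} (f : DNN n) : (f.map φ).width = f.width := by
  induction f with
  | output W b => rfl
  | hidden m hm W b f ih => simp [map, width, ih]

end DNN

/-- The perturbation bound of a single affine map. -/
lemma l2_affine_sub_le {m n w : ℕ} {W : Matrix (Fin m) (Fin n) ℝ} {b : Fin m → ℝ} {B ρ : ℝ}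
    {φ : ℝ → ℝ} (hρ : 0 ≤ ρ) (hφ : ∀ a, |a| ≤ B → |a - φ a| ≤ ρ)
    (hp : ∀ a ∈ DNN.vec W ++ List.ofFn b, |a| ≤ B) (hmn : m * (n + 1) ≤ w ^ 2)
    {x : Fin n → ℝ} {M : ℝ} (hx : l2 x ^ 2 + 1 ≤ M ^ 2) (hM : 0 ≤ M) :
    l2 ((W - W.map φ) *ᵥ x + (b - φ ∘ b)) ≤ ρ * w * M := by
  refine (l2_affine_le _ _ _ hx hM).trans (mul_le_mul_of_nonneg_right ?_ hM)
  refine Real.sqrt_le_iff.2 ⟨by positivity, ?_⟩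
  rw [sumSq_append, sumSq_vec, sumSq_ofFn, mul_pow]
  have h1 : ∀ i j, (W - W.map φ) i j ^ 2 ≤ ρ ^ 2 := fun i j => by
    rw [← sq_abs]
    exact pow_le_pow_left₀ (abs_nonneg _)
      (hφ _ (hp _ (List.mem_append_left _ (mem_vec W i j)))) 2
  have h2 : ∀ i, (b - φ ∘ b) i ^ 2 ≤ ρ ^ 2 := fun i => by
    rw [← sq_abs]
    exact pow_le_pow_left₀ (abs_nonneg _)
      (hφ _ (hp _ (List.mem_append_right _ (by simp [List.mem_ofFn])))) 2
  calc _ ≤ ∑ _i : Fin m, ∑ _j : Fin n, ρ ^ 2 + ∑ _i : Fin m, ρ ^ 2 := by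
        refine add_le_add (Finset.sum_le_sum fun i _ => Finset.sum_le_sum fun j _ => h1 i j)
          (Finset.sum_le_sum fun i _ => h2 i)
    _ = ρ ^ 2 * ((m * (n + 1) : ℕ) : ℝ) := by simp; ring
    _ ≤ ρ ^ 2 * (w : ℝ) ^ 2 := by gcongr; exact_mod_cast hmn

lemma sqrt_sumSq_map_le {l : List ℝ} {B : ℝ} (hB : 0 ≤ B) {φ : ℝ → ℝ} (hφ : ∀ a, |φ a| ≤ |a|)
    (h : ∀ a ∈ l, |a| ≤ B) : √(sumSq (l.map φ)) ≤ B * √(nnz (l.map φ)) := by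
  rw [Real.sqrt_le_iff]
  refine ⟨by positivity, ?_⟩
  rw [mul_pow, Real.sq_sqrt (by positivity)]
  refine sumSq_le_mul_nnz fun a ha => ?_
  obtain ⟨y, hy, rfl⟩ := List.mem_map.1 ha
  exact (hφ y).trans (h y hy)

/-- This is y ≤ exp(y²/2) at y = 2κ√s/w. It absorbs the Lipschitz constant: each layer gains a
factor 1/2 over wB and pays an exponential in s/w², and these exponentials multiply to one in the
total number of nonzero parameters. -/
lemma half_mul_exp_ge {w s κ B : ℝ} (hw : 0 < w) (hs : 0 ≤ s) (hB : 0 ≤ B) :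
    κ * B * √s ≤ w * B / 2 * Real.exp (2 * κ ^ 2 * s / w ^ 2) := by
  have h : ∀ y : ℝ, y ≤ Real.exp (y ^ 2 / 2) := fun y => by
    nlinarith [Real.add_one_le_exp (y ^ 2 / 2), sq_nonneg (y - 1)]
  have h1 := mul_le_mul_of_nonneg_left (h (2 * κ * √s / w)) (by positivity : 0 ≤ w * B / 2)
  have h2 : (2 * κ * √s / w) ^ 2 / 2 = 2 * κ ^ 2 * s / w ^ 2 := by
    rw [div_pow, mul_pow, mul_pow, Real.sq_sqrt hs]; ring
  rw [h2] at h1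
  refine le_trans (le_of_eq ?_) h1
  field_simp

set_option maxHeartbeats 800000 in
/-- Propagation of a perturbation of the parameters through a network. Layers with `s` nonzero
parameters contribute a factor `(w + 1) B / 2 * exp (2 κ² s / (w + 1)²)`. -/
lemma eval_sub_eval_map_le {σ : ℝ → ℝ} {c s₀ κ K₀ : ℝ} (hc : 1 ≤ c)
    (hσ : ∀ x y, |σ x - σ y| ≤ c * |x - y|) (hs₀ : |σ 0| ≤ s₀) (hκ : κ = 4 * c + 1)
    (hK₀ : K₀ = 2 * (s₀ + 1)) {w : ℕ} (hw : 1 ≤ w) {B ρ : ℝ} (hB : 1 ≤ B) (hρ : 0 ≤ ρ)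
    (hρw : 4 * c * ρ * (w + 1) ≤ 1) {φ : ℝ → ℝ} (hφ : ∀ a, |a| ≤ B → |a - φ a| ≤ ρ)
    (hφ' : ∀ a, |φ a| ≤ |a|) {n : ℕ} (f : DNN n) :
    n ≤ w → f.width ≤ w → (∀ a ∈ f.params, |a| ≤ B) → ∀ (x x' : Fin n → ℝ) (E M : ℝ),
      l2 x ≤ M → K₀ * √(w + 1) ≤ M → l2 (x - x') ≤ E →
      |f.eval σ x - (f.map φ).eval σ x'| ≤
        κ * B * √(w + 1) * ((w + 1) * B / 2) ^ f.depth *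
          Real.exp (2 * κ ^ 2 * nnz (f.map φ).params / (w + 1) ^ 2) *
          (E + (f.depth + 1) * (2 * c * ρ * (w + 1) * M)) := by
  have hs0 : 0 ≤ s₀ := (abs_nonneg _).trans hs₀
  have hκ0 : 0 < κ := by rw [hκ]; linarith
  have hwR : (1 : ℝ) ≤ w := by exact_mod_cast hw
  have hsq1 : 1 ≤ √((w : ℝ) + 1) := Real.one_le_sqrt.2 (by linarith)
  have hM1 : ∀ {M : ℝ}, K₀ * √(w + 1) ≤ M → 1 ≤ M := fun {M} hM => by
    rw [hK₀] at hM; nlinarith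
  have haux : ∀ {n : ℕ} {x : Fin n → ℝ} {M : ℝ}, l2 x ≤ M → 1 ≤ M →
      l2 x ^ 2 + 1 ≤ (2 * M) ^ 2 := fun {n x M} hx hM => by
    nlinarith [l2_nonneg x, mul_self_le_mul_self (l2_nonneg x) hx]
  have hsplit : ∀ {m n : ℕ} (W : Matrix (Fin m) (Fin n) ℝ) (b : Fin m → ℝ) (x x' : Fin n → ℝ),
      (W *ᵥ x + b) - ((W.map φ) *ᵥ x' + φ ∘ b)
        = (W.map φ) *ᵥ (x - x') + ((W - W.map φ) *ᵥ x + (b - φ ∘ b)) := by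
    intro m n W b x x'
    rw [Matrix.mulVec_sub, Matrix.sub_mulVec]; abel
  have hvl : ∀ {m n : ℕ} (W : Matrix (Fin m) (Fin n) ℝ) (b : Fin m → ℝ),
      DNN.vec (W.map φ) ++ List.ofFn (φ ∘ b) = (DNN.vec W ++ List.ofFn b).map φ := by
    intro m n W b; simp [DNN.vec_map, List.map_ofFn]
  -- the difference of the affine maps
  have hdiff : ∀ {m n : ℕ} (W : Matrix (Fin m) (Fin n) ℝ) (b : Fin m → ℝ) (x x' : Fin n → ℝ)
      (E M : ℝ), m ≤ w → n ≤ w → (∀ a ∈ DNN.vec W ++ List.ofFn b, |a| ≤ B) → l2 x ≤ M → 1 ≤ M →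
      l2 (x - x') ≤ E →
      l2 ((W *ᵥ x + b) - ((W.map φ) *ᵥ x' + φ ∘ b)) ≤
        B * √(nnz (DNN.vec (W.map φ) ++ List.ofFn (φ ∘ b))) * E + 2 * ρ * (w + 1) * M := by
    intro m n W b x x' E M hm hn hp hx hM hE
    rw [hsplit]
    refine (l2_add_le _ _).trans (add_le_add ?_ ?_)
    · refine (l2_mulVec_le _ _).trans
        (mul_le_mul ?_ hE (l2_nonneg _) (by positivity))
      refine le_trans (Real.sqrt_le_sqrt ?_) ((hvl W b) ▸ sqrt_sumSq_map_le (by linarith) hφ' hp)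
      rw [sumSq_append]
      linarith [sumSq_nonneg (List.ofFn (φ ∘ b))]
    · refine (l2_affine_sub_le (w := w + 1) hρ hφ hp ?_ (haux hx hM) (by linarith)).trans
        (le_of_eq ?_)
      · rw [sq]; exact Nat.mul_le_mul (by omega) (by omega)
      · push_cast; ring
  -- `E` bounds the discrepancy of the inputs; `M` bounds the input and dominates the contribution
  -- of σ(0). A layer with growth factor q turns (E, M) into (qE + 2cρ(w+1)M, qM), so each of the
  -- depth + 1 affine maps injects one error term.
  induction f with
  | @output n W b =>
    intro hn _ hp x x' E M hx hM hE
    have hM' := hM1 hM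
    have hE0 : 0 ≤ E := (l2_nonneg _).trans hE
    have h1 := hdiff W b x x' E M hw hn hp hx hM' hE
    have h2 : |(W *ᵥ x + b) 0 - ((W.map φ) *ᵥ x' + φ ∘ b) 0|
        ≤ l2 ((W *ᵥ x + b) - ((W.map φ) *ᵥ x' + φ ∘ b)) := by
      refine abs_le_of_sq_le_sq ?_ (l2_nonneg _)
      rw [l2_sq]; simp
    simp only [DNN.eval, DNN.map, DNN.depth, DNN.params]
    refine h2.trans (h1.trans ?_)
    set s := nnz (DNN.vec (W.map φ) ++ List.ofFn (φ ∘ b)) with hs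
    -- The output map has a single row, so its norm costs only √(w+1).
    have hsw : (s : ℝ) ≤ w + 1 := by
      have : s ≤ w + 1 := by
        refine (nnz_le_length _).trans ?_
        simp [length_vec]; omega
      exact_mod_cast this
    have hexp : 1 ≤ Real.exp (2 * κ ^ 2 * s / ((w : ℝ) + 1) ^ 2) :=
      Real.one_le_exp (by positivity)
    have hQ : B * √s ≤ κ * B * √((w : ℝ) + 1) := by
      have := Real.sqrt_le_sqrt hsw
      have hκ1 : 1 ≤ κ := by rw [hκ]; linarith
      calc B * √s ≤ B * √((w : ℝ) + 1) := by gcongr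
        _ ≤ κ * (B * √((w : ℝ) + 1)) := le_mul_of_one_le_left (by positivity) hκ1
        _ = _ := by ring
    have hQ1 : 1 ≤ κ * B * √((w : ℝ) + 1) := by
      have hκ1 : 1 ≤ κ := by rw [hκ]; linarith
      exact one_le_mul_of_one_le_of_one_le (one_le_mul_of_one_le_of_one_le hκ1 hB) hsq1
    calc B * √s * E + 2 * ρ * (w + 1) * M
        ≤ κ * B * √((w : ℝ) + 1) * E + κ * B * √((w : ℝ) + 1) * (2 * c * ρ * (w + 1) * M) := by
          refine add_le_add (mul_le_mul_of_nonneg_right hQ hE0) ?_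
          calc 2 * ρ * (w + 1) * M ≤ c * (2 * ρ * (w + 1) * M) :=
                le_mul_of_one_le_left (by positivity) hc
            _ = 2 * c * ρ * (w + 1) * M := by ring
            _ ≤ _ := le_mul_of_one_le_left (by positivity) hQ1
      _ = κ * B * √((w : ℝ) + 1) * (E + 2 * c * ρ * (w + 1) * M) := by ring
      _ ≤ κ * B * √((w : ℝ) + 1) * Real.exp (2 * κ ^ 2 * s / ((w : ℝ) + 1) ^ 2)
            * (E + 2 * c * ρ * (w + 1) * M) := by
          refine mul_le_mul_of_nonneg_right ?_ (by positivity)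
          exact le_mul_of_one_le_right (by positivity) hexp
      _ = _ := by simp
  | @hidden n m hm W b f ih =>
    intro hn hwd hp x x' E M hx hM hE
    have hM' := hM1 hM
    have hE0 : 0 ≤ E := (l2_nonneg _).trans hE
    simp only [DNN.width, max_le_iff] at hwd
    have hpl : ∀ a ∈ DNN.vec W ++ List.ofFn b, |a| ≤ B := fun a ha =>
      hp a (by simp only [DNN.params]; exact List.mem_append_left _ ha)
    have hpf : ∀ a ∈ f.params, |a| ≤ B := fun a ha =>
      hp a (by simp only [DNN.params]; exact List.mem_append_right _ ha)
    have h1 := hdiff W b x x' E M hwd.1 hn hpl hx hM' hE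
    have hgrow := l2_affine_le (W.map φ) (φ ∘ b) x (haux hx hM') (by linarith)
    have hpert := l2_affine_sub_le (w := w + 1) hρ hφ hpl
      (by rw [sq]; exact Nat.mul_le_mul (by omega) (by omega)) (haux hx hM') (by linarith)
    have hsq := sqrt_sumSq_map_le (by linarith) hφ' hpl
    rw [← hvl] at hsq
    simp only [DNN.eval, DNN.map, DNN.depth, DNN.params]
    set s := nnz (DNN.vec (W.map φ) ++ List.ofFn (φ ∘ b)) with hs
    set q := ((w : ℝ) + 1) * B / 2 * Real.exp (2 * κ ^ 2 * s / ((w : ℝ) + 1) ^ 2) with hq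
    have hq1 : 1 ≤ q := by
      have hexp : 1 ≤ Real.exp (2 * κ ^ 2 * s / ((w : ℝ) + 1) ^ 2) :=
        Real.one_le_exp (by positivity)
      exact one_le_mul_of_one_le_of_one_le (by nlinarith) hexp
    have hqs : κ * B * √s ≤ q := half_mul_exp_ge (by positivity) (by positivity) (by linarith)
    have hcs : c * (B * √s) ≤ q := by
      refine le_trans ?_ hqs
      rw [mul_assoc]
      exact mul_le_mul_of_nonneg_right (by rw [hκ]; linarith) (by positivity)
    set z : Fin m → ℝ := fun i => σ ((W *ᵥ x + b) i) with hz
    set z' : Fin m → ℝ := fun i => σ (((W.map φ) *ᵥ x' + φ ∘ b) i) with hz'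
    have hzz : l2 (z - z') ≤ q * E + 2 * c * ρ * (w + 1) * M := by
      refine (l2_le_mul_of_abs_le (c := c) (y := (W *ᵥ x + b) - ((W.map φ) *ᵥ x' + φ ∘ b))
        (by linarith) fun i => hσ _ _).trans ?_
      refine (mul_le_mul_of_nonneg_left h1 (by linarith)).trans ?_
      have := mul_le_mul_of_nonneg_right hcs hE0
      linarith
    have hzM : l2 z ≤ q * M := by
      have hz1 : l2 z ≤ c * l2 (W *ᵥ x + b) + s₀ * √m := by
        have : z = (fun i => σ ((W *ᵥ x + b) i) - σ 0) + fun _ => σ 0 := by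
          ext i; simp [hz]
        rw [this]
        refine (l2_add_le _ _).trans (add_le_add ?_ (l2_const_le hs0 fun _ => hs₀))
        exact l2_le_mul_of_abs_le (by linarith) fun i => by simpa using hσ ((W *ᵥ x + b) i) 0
      have hsm : s₀ * √m ≤ M / 2 := by
        have : √(m : ℝ) ≤ √((w : ℝ) + 1) :=
          Real.sqrt_le_sqrt (by have : (m : ℝ) ≤ w := by exact_mod_cast hwd.1
                                linarith)
        have h2 : s₀ * √m ≤ (s₀ + 1) * √((w : ℝ) + 1) := by gcongr; linarith
        rw [hK₀] at hM; linarith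
      have hz2 : l2 (W *ᵥ x + b) ≤ B * √s * (2 * M) + ρ * (w + 1) * (2 * M) := by
        have heq : W *ᵥ x + b = ((W.map φ) *ᵥ x + φ ∘ b)
            + ((W - W.map φ) *ᵥ x + (b - φ ∘ b)) := by
          rw [Matrix.sub_mulVec]; abel
        rw [heq]
        refine (l2_add_le _ _).trans (add_le_add (hgrow.trans ?_) (hpert.trans ?_))
        · exact mul_le_mul_of_nonneg_right hsq (by linarith)
        · push_cast; rfl
      have hz3 : l2 z ≤ c * (B * √s * (2 * M) + ρ * (w + 1) * (2 * M)) + M / 2 :=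
        hz1.trans (add_le_add (mul_le_mul_of_nonneg_left hz2 (by linarith)) hsm)
      have hz4 : c * (ρ * (w + 1) * (2 * M)) ≤ M / 2 := by
        have := mul_le_mul_of_nonneg_right hρw (by linarith : 0 ≤ M)
        linarith
      -- If the rounded layer is zero, rounding error and σ(0) contribute M/2 each. Otherwise B√s ≥
      -- 1 absorbs this additive M.
      rcases Nat.eq_zero_or_pos s with h0 | h0
      · have : l2 z ≤ M := by rw [h0] at hz3; simp at hz3; linarith
        exact this.trans (le_mul_of_one_le_left (by linarith) hq1)
      · have hs1 : 1 ≤ √(s : ℝ) := Real.one_le_sqrt.2 (by exact_mod_cast h0)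
        have hBs : 1 ≤ B * √s := one_le_mul_of_one_le_of_one_le hB hs1
        calc l2 z ≤ 2 * c * (B * √s) * M + M := by linarith
          _ ≤ 2 * c * (B * √s) * M + (B * √s) * M :=
            add_le_add le_rfl (le_mul_of_one_le_left (by linarith) hBs)
          _ ≤ κ * B * √s * M := by
            rw [hκ]
            have : 0 ≤ c * (B * √s) * M := by positivity
            linarith
          _ ≤ q * M := by gcongr
    have hIH := ih hwd.1 hwd.2 hpf z z' _ (q * M) hzM
      (hM.trans (le_mul_of_one_le_left (by linarith) hq1)) hzz
    refine hIH.trans ?_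
    rw [nnz_append, ← hs]
    have hexp : Real.exp (2 * κ ^ 2 * ((s + nnz (f.map φ).params : ℕ) : ℝ) / ((w : ℝ) + 1) ^ 2)
        = Real.exp (2 * κ ^ 2 * s / ((w : ℝ) + 1) ^ 2) *
          Real.exp (2 * κ ^ 2 * nnz (f.map φ).params / ((w : ℝ) + 1) ^ 2) := by
      rw [← Real.exp_add]; congr 1; push_cast; ring
    rw [hexp, pow_succ]
    set R := κ * B * √((w : ℝ) + 1) * (((w : ℝ) + 1) * B / 2) ^ f.depth *
      Real.exp (2 * κ ^ 2 * nnz (f.map φ).params / ((w : ℝ) + 1) ^ 2) with hR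
    have hR0 : 0 ≤ R := by positivity
    have hX0 : 0 ≤ 2 * c * ρ * (w + 1) * M := by positivity
    calc R * (q * E + 2 * c * ρ * (w + 1) * M + (f.depth + 1) * (2 * c * ρ * (w + 1) * (q * M)))
        ≤ R * (q * (E + (((f.depth + 1 : ℕ) : ℝ) + 1) * (2 * c * ρ * (w + 1) * M))) := by
          refine mul_le_mul_of_nonneg_left ?_ hR0
          have := le_mul_of_one_le_left hX0 hq1
          push_cast
          linarith
      _ = _ := by
          rw [hR, hq]
          push_cast
          ring_nf

end Perturbation

/-! ### Perturbation bounds on the cube -/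

section Approximation

lemma length_params_le {n w : ℕ} (f : DNN n) (hw : f.width ≤ w) :
    f.params.length ≤ (w + 1) * (n + 1) + f.depth * (w + 1) ^ 2 := by
  induction f with
  | @output n W b => simp [DNN.params, length_vec, DNN.depth]
  | @hidden n m hm W b f ih =>
    simp only [DNN.width, max_le_iff] at hw
    have := ih hw.2
    simp only [DNN.params, List.length_append, length_vec, List.length_ofFn, DNN.depth]
    have h1 : (w + 1) * (m + 1) ≤ (w + 1) * (w + 1) := Nat.mul_le_mul_left _ (by omega)
    have h2 : (n + 1) * m ≤ (n + 1) * (w + 1) := Nat.mul_le_mul_left _ (by omega)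
    nlinarith

lemma eval_eq_zero {σ : ℝ → ℝ} {n : ℕ} (f : DNN n) (h : ∀ a ∈ f.params, a = 0)
    (x : Fin n → ℝ) : f.eval σ x = 0 := by
  induction f with
  | output W b =>
    have hW : W = 0 := by
      ext i j; exact h _ (by simp only [DNN.params]; exact List.mem_append_left _ (mem_vec W i j))
    have hb : b = 0 := by
      ext i
      exact h _ (by
        simp only [DNN.params]
        exact List.mem_append_right _ ((List.mem_ofFn' _ _).2 ⟨i, rfl⟩))
    simp [DNN.eval, hW, hb]
  | hidden m hm W b f ih =>
    exact ih (fun a ha => h a (by simp only [DNN.params]; exact List.mem_append_right _ ha)) _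

lemma l2_le_of_mem_cube {d : ℕ} {x : Fin d → ℝ} (hx : x ∈ cube d) : l2 x ^ 2 ≤ d := by
  rw [l2_sq]
  refine (Finset.sum_le_card_nsmul _ _ 1 fun i _ => ?_).trans (by simp)
  have h0 : 0 ≤ x i := hx.1 i
  have h1 : x i ≤ 1 := hx.2 i
  nlinarith

set_option maxHeartbeats 800000 in
/-- The effect of a perturbation of the parameters on the values of a network on the cube. -/
lemma eval_sub_eval_map_le_of_mem_cube {σ : ℝ → ℝ} {c s₀ κ K₀ : ℝ} (hc : 1 ≤ c)
    (hσ : ∀ x y, |σ x - σ y| ≤ c * |x - y|) (hs₀ : |σ 0| ≤ s₀) (hκ : κ = 4 * c + 1)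
    (hK₀ : K₀ = 2 * (s₀ + 1)) {w : ℕ} (hw : 1 ≤ w) {B ρ : ℝ} (hB : 1 ≤ B) (hρ : 0 ≤ ρ)
    (hρw : 4 * c * ρ * (w + 1) ≤ 1) {φ : ℝ → ℝ} (hφ : ∀ a, |a| ≤ B → |a - φ a| ≤ ρ)
    (hφ' : ∀ a, |φ a| ≤ |a|) {d : ℕ} (f : DNN d) (hdep : 1 ≤ f.depth) (hwd : f.width ≤ w)
    (hp : ∀ a ∈ f.params, |a| ≤ B) {x : Fin d → ℝ} (hx : x ∈ cube d) :
    |f.eval σ x - (f.map φ).eval σ x| ≤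
      2 * c * κ * (c * (d + 1) + K₀) * ((f.depth + 1) * ρ * ((w + 1) * B) ^ (f.depth + 1) *
        ((1 / 2) ^ (f.depth - 1) *
          Real.exp (2 * κ ^ 2 * nnz (f.map φ).params / (w + 1) ^ 2))) := by
  cases f with
  | output W b => simp [DNN.depth] at hdep
  -- The first layer is treated apart because `d` may exceed the width. It contributes a factor
  -- depending on `d` and no power of 1/2, whence the exponent depth - 1.
  | @hidden _ m hm W b f =>
    have hs0 : 0 ≤ s₀ := (abs_nonneg _).trans hs₀
    have hκ0 : 0 < κ := by rw [hκ]; linarith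
    have hK0 : 2 ≤ K₀ := by rw [hK₀]; linarith
    simp only [DNN.width, max_le_iff] at hwd
    have hpl : ∀ a ∈ DNN.vec W ++ List.ofFn b, |a| ≤ B := fun a ha =>
      hp a (by simp only [DNN.params]; exact List.mem_append_left _ ha)
    have hpf : ∀ a ∈ f.params, |a| ≤ B := fun a ha =>
      hp a (by simp only [DNN.params]; exact List.mem_append_right _ ha)
    have hwR : (1 : ℝ) ≤ w := by exact_mod_cast hw
    have hmR : (m : ℝ) ≤ w := by exact_mod_cast hwd.1
    have hx1 : l2 x ^ 2 + 1 ≤ √((d : ℝ) + 1) ^ 2 := by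
      rw [Real.sq_sqrt (by positivity)]; linarith [l2_le_of_mem_cube hx]
    set S := √((w : ℝ) + 1) with hS
    have hS1 : 1 ≤ S := Real.one_le_sqrt.2 (by linarith)
    have hSS : S * S = w + 1 := Real.mul_self_sqrt (by positivity)
    have hdS : √((d : ℝ) + 1) * √((d : ℝ) + 1) = d + 1 := Real.mul_self_sqrt (by positivity)
    have hcard : √((m * (d + 1) : ℕ) : ℝ) ≤ S * √((d : ℝ) + 1) := by
      rw [hS, ← Real.sqrt_mul (by positivity)]
      refine Real.sqrt_le_sqrt ?_
      push_cast
      gcongr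
      linarith
    have hlen : (DNN.vec W ++ List.ofFn b).length = m * (d + 1) := by
      simp [length_vec]; ring
    -- size of the first layer
    have hgrow : l2 (W *ᵥ x + b) ≤ B * (S * (d + 1)) := by
      refine (l2_affine_le W b x hx1 (by positivity)).trans ?_
      have h1 : √(sumSq (DNN.vec W ++ List.ofFn b)) ≤ B * √((m * (d + 1) : ℕ) : ℝ) := by
        rw [Real.sqrt_le_iff]
        refine ⟨by positivity, ?_⟩
        rw [mul_pow, Real.sq_sqrt (by positivity)]
        refine (sumSq_le_mul_nnz hpl).trans (mul_le_mul_of_nonneg_left ?_ (by positivity))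
        exact_mod_cast (nnz_le_length _).trans hlen.le
      calc _ ≤ B * (S * √((d : ℝ) + 1)) * √((d : ℝ) + 1) := by
            refine mul_le_mul_of_nonneg_right (h1.trans ?_) (Real.sqrt_nonneg _)
            exact mul_le_mul_of_nonneg_left hcard (by linarith)
        _ = B * (S * (√((d : ℝ) + 1) * √((d : ℝ) + 1))) := by ring
        _ = _ := by rw [hdS]
    have hpert : l2 ((W - W.map φ) *ᵥ x + (b - φ ∘ b)) ≤ ρ * (S * (d + 1)) := by
      refine (l2_affine_le _ _ x hx1 (by positivity)).trans ?_
      have h1 : √(sumSq (DNN.vec (W - W.map φ) ++ List.ofFn (b - φ ∘ b)))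
          ≤ ρ * √((m * (d + 1) : ℕ) : ℝ) := by
        rw [Real.sqrt_le_iff]
        refine ⟨by positivity, ?_⟩
        rw [mul_pow, Real.sq_sqrt (by positivity)]
        have h2 : ∀ a ∈ DNN.vec (W - W.map φ) ++ List.ofFn (b - φ ∘ b), |a| ≤ ρ := by
          intro a ha
          rcases List.mem_append.1 ha with ha | ha
          · simp only [DNN.vec, List.mem_flatMap, List.mem_map] at ha
            obtain ⟨j, -, i, -, rfl⟩ := ha
            exact hφ _ (hpl _ (List.mem_append_left _ (mem_vec W i j)))
          · obtain ⟨i, rfl⟩ := (List.mem_ofFn' _ _).1 ha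
            exact hφ _ (hpl _ (List.mem_append_right _ (by simp)))
        refine (sumSq_le_mul_nnz h2).trans (mul_le_mul_of_nonneg_left ?_ (by positivity))
        have hlen' : (DNN.vec (W - W.map φ) ++ List.ofFn (b - φ ∘ b)).length = m * (d + 1) := by
          simp [length_vec]; ring
        exact_mod_cast (nnz_le_length _).trans hlen'.le
      calc _ ≤ ρ * (S * √((d : ℝ) + 1)) * √((d : ℝ) + 1) := by
            refine mul_le_mul_of_nonneg_right (h1.trans ?_) (Real.sqrt_nonneg _)
            exact mul_le_mul_of_nonneg_left hcard hρ
        _ = ρ * (S * (√((d : ℝ) + 1) * √((d : ℝ) + 1))) := by ring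
        _ = _ := by rw [hdS]
    simp only [DNN.eval, DNN.map, DNN.depth, DNN.params]
    set z : Fin m → ℝ := fun i => σ ((W *ᵥ x + b) i) with hz
    set z' : Fin m → ℝ := fun i => σ (((W.map φ) *ᵥ x + φ ∘ b) i) with hz'
    set M := (c * (d + 1) + K₀) * B * S with hM
    have hcd : 0 ≤ c * ((d : ℝ) + 1) := by positivity
    have hzz : l2 (z - z') ≤ 2 * c * ρ * (w + 1) * M := by
      have h1 : l2 (z - z') ≤ c * (ρ * (S * (d + 1))) := by
        refine (l2_le_mul_of_abs_le (c := c) (y := (W *ᵥ x + b) - ((W.map φ) *ᵥ x + φ ∘ b))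
          (by linarith) fun i => hσ _ _).trans (mul_le_mul_of_nonneg_left ?_ (by linarith))
        refine le_trans (le_of_eq ?_) hpert
        congr 1; rw [Matrix.sub_mulVec]; abel
      refine h1.trans ?_
      have h2 : S * (d + 1) ≤ M := by
        rw [hM]
        calc S * ((d : ℝ) + 1) = (d + 1) * 1 * S := by ring
          _ ≤ (c * (d + 1) + K₀) * B * S := by
            gcongr
            · nlinarith
            · linarith
      have h3 : 0 ≤ M := le_trans (by positivity) h2
      calc c * (ρ * (S * (d + 1))) ≤ c * (ρ * M) := by gcongr
        _ = 1 * (c * (ρ * M)) := by ring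
        _ ≤ (2 * (w + 1)) * (c * (ρ * M)) :=
          mul_le_mul_of_nonneg_right (by linarith) (by positivity)
        _ = _ := by ring
    have hzM : l2 z ≤ M := by
      have h1 : l2 z ≤ c * l2 (W *ᵥ x + b) + s₀ * √m := by
        have : z = (fun i => σ ((W *ᵥ x + b) i) - σ 0) + fun _ => σ 0 := by
          ext i; simp [hz]
        rw [this]
        refine (l2_add_le _ _).trans (add_le_add ?_ (l2_const_le hs0 fun _ => hs₀))
        exact l2_le_mul_of_abs_le (by linarith) fun i => by simpa using hσ ((W *ᵥ x + b) i) 0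
      have h2 : s₀ * √m ≤ K₀ * B * S := by
        have : √(m : ℝ) ≤ S := Real.sqrt_le_sqrt (by linarith)
        have h3 : s₀ ≤ K₀ * B := by rw [hK₀]; nlinarith
        exact mul_le_mul h3 this (Real.sqrt_nonneg _) (by positivity)
      have h4 := mul_le_mul_of_nonneg_left hgrow (by linarith : 0 ≤ c)
      rw [hM]; linarith
    have hKM : K₀ * S ≤ M := by
      rw [hM]
      refine mul_le_mul_of_nonneg_right ?_ (by positivity)
      nlinarith
    have key := eval_sub_eval_map_le hc hσ hs₀ hκ hK₀ hw hB hρ hρw hφ hφ' f hwd.1 hwd.2 hpf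
      z z' _ M hzM hKM hzz
    refine key.trans ?_
    have hnn : Real.exp (2 * κ ^ 2 * nnz (f.map φ).params / ((w : ℝ) + 1) ^ 2)
        ≤ Real.exp (2 * κ ^ 2 * (nnz (DNN.vec (W.map φ) ++ List.ofFn (φ ∘ b) ++
          (f.map φ).params) : ℕ) / ((w : ℝ) + 1) ^ 2) := by
      refine Real.exp_le_exp.2 ?_
      rw [nnz_append]
      push_cast
      gcongr
      linarith [Nat.cast_nonneg (α := ℝ) (nnz (DNN.vec (W.map φ) ++ List.ofFn (φ ∘ b)))]
    have hM0 : 0 ≤ M := (l2_nonneg _).trans hzM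
    calc _ ≤ κ * B * S * (((w : ℝ) + 1) * B / 2) ^ f.depth *
          Real.exp (2 * κ ^ 2 * (nnz (DNN.vec (W.map φ) ++ List.ofFn (φ ∘ b) ++
          (f.map φ).params) : ℕ) / ((w : ℝ) + 1) ^ 2) *
          (2 * c * ρ * (w + 1) * M + (f.depth + 1) * (2 * c * ρ * (w + 1) * M)) := by
          gcongr
      _ = 2 * c * κ * (c * (d + 1) + K₀) * ((((f.depth + 1 : ℕ) : ℝ) + 1) * ρ *
            ((S * S) * (((w : ℝ) + 1) * B * (B * (((w : ℝ) + 1) * B / 2) ^ f.depth))) *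
            Real.exp (2 * κ ^ 2 * (nnz (DNN.vec (W.map φ) ++ List.ofFn (φ ∘ b) ++
          (f.map φ).params) : ℕ) / ((w : ℝ) + 1) ^ 2)) := by
          rw [hM]; push_cast; ring
      _ = _ := by
          rw [hSS, Nat.add_sub_cancel, div_eq_mul_one_div _ (2 : ℝ), mul_pow]
          ring

end Approximation

/-! ### Rounding and thresholding of parameters -/

section Rounding

/-- The integer `k` for which `g * k` is the rounding of `a` towards zero. -/
def truncInt (g a : ℝ) : ℤ := if 0 ≤ a then ⌊a / g⌋ else ⌈a / g⌉

lemma abs_mul_truncInt_le {g : ℝ} (hg : 0 < g) (a : ℝ) : |g * truncInt g a| ≤ |a| := by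
  unfold truncInt
  split_ifs with h
  · rw [abs_of_nonneg h, abs_of_nonneg
      (mul_nonneg hg.le (Int.cast_nonneg (Int.floor_nonneg.2 (div_nonneg h hg.le))))]
    calc g * ⌊a / g⌋ ≤ g * (a / g) := mul_le_mul_of_nonneg_left (Int.floor_le _) hg.le
      _ = a := by field_simp
  · have h := not_le.1 h
    have h1 : ⌈a / g⌉ ≤ 0 := Int.ceil_le.2 (by simpa using (div_neg_of_neg_of_pos h hg).le)
    have h2 : (⌈a / g⌉ : ℝ) ≤ 0 := by exact_mod_cast h1
    rw [abs_of_neg h, abs_of_nonpos (mul_nonpos_of_nonneg_of_nonpos hg.le h2)]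
    have h3 : a / g ≤ ⌈a / g⌉ := Int.le_ceil _
    rw [div_le_iff₀ hg] at h3
    linarith

lemma abs_sub_mul_truncInt_le {g : ℝ} (hg : 0 < g) (a : ℝ) : |a - g * truncInt g a| ≤ g := by
  have hag : a = g * (a / g) := by field_simp
  have key : ∀ k : ℤ, |a / g - k| ≤ 1 → |a - g * k| ≤ g := by
    intro k hk
    have : a - g * k = g * (a / g - k) := by rw [mul_sub, ← hag]
    rw [this, abs_mul, abs_of_pos hg]
    exact mul_le_of_le_one_right hg.le hk
  unfold truncInt
  split_ifs with h
  · refine key _ (abs_le.2 ⟨?_, ?_⟩)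
    · linarith [Int.floor_le (a / g)]
    · linarith [Int.lt_floor_add_one (a / g)]
  · refine key _ (abs_le.2 ⟨?_, ?_⟩)
    · linarith [Int.ceil_lt_add_one (a / g)]
    · linarith [Int.le_ceil (a / g)]

/-- Rounding towards zero to a multiple of `g`, after setting numbers below `ρ` to zero. -/
def roundInt (ρ g a : ℝ) : ℤ := if |a| < ρ then 0 else truncInt g a

lemma abs_mul_roundInt_le {ρ g : ℝ} (hg : 0 < g) (a : ℝ) : |g * roundInt ρ g a| ≤ |a| := by
  unfold roundInt
  split_ifs with h
  · simp
  · exact abs_mul_truncInt_le hg a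

lemma abs_sub_mul_roundInt_le {ρ g : ℝ} (hg : 0 < g) (a : ℝ) :
    |a - g * roundInt ρ g a| ≤ max ρ g := by
  unfold roundInt
  split_ifs with h
  · simp [h.le]
  · exact (abs_sub_mul_truncInt_le hg a).trans (le_max_right _ _)

/-- A parameter that survives the threshold has |a| ≥ ρ ≥ τ and so contributes exactly 1 to the
clipped norm. -/
lemma nnz_map_le_clipNorm {ρ τ : ℝ} (hτ : 0 < τ) (hτρ : τ ≤ ρ) {φ : ℝ → ℝ}
    (hφ : ∀ a, |a| < ρ → φ a = 0) (l : List ℝ) : (nnz (l.map φ) : ℝ) ≤ clipNorm τ l := by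
  induction l with
  | nil => simp [nnz, clipNorm]
  | cons a l ih =>
    simp only [nnz, clipNorm, List.map_cons, List.sum_cons, List.countP_cons] at ih ⊢
    have h0 : 0 ≤ min (|a| / τ) 1 := le_min (by positivity) zero_le_one
    by_cases h : φ a = 0
    · simp only [h, ne_eq, not_true_eq_false, decide_false, Bool.false_eq_true, if_false, add_zero]
      simp only [ne_eq] at ih
      linarith
    · have h1 : min (|a| / τ) 1 = 1 := by
        refine min_eq_right ((one_le_div hτ).2 (hτρ.trans ?_))
        by_contra hlt
        exact h (hφ a (not_le.1 hlt))
      simp only [h, ne_eq, not_false_eq_true, decide_true, if_true, h1]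
      push_cast
      simp only [ne_eq] at ih
      linarith

lemma clipNorm_nonneg {τ : ℝ} (hτ : 0 < τ) (l : List ℝ) : 0 ≤ clipNorm τ l :=
  List.sum_nonneg fun a ha => by
    obtain ⟨x, -, rfl⟩ := List.mem_map.1 ha
    exact le_min (by positivity) zero_le_one

lemma clipNorm_le_length {τ : ℝ} (l : List ℝ) : clipNorm τ l ≤ l.length := by
  refine (List.sum_le_card_nsmul _ 1 fun a ha => ?_).trans (by simp)
  obtain ⟨x, -, rfl⟩ := List.mem_map.1 ha
  exact min_le_right _ _

end Rounding

/-! ### Approximation by sparse networks on a grid -/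

section SparseApproximation

lemma width_pos {n : ℕ} (f : DNN n) (h : 1 ≤ f.depth) : 1 ≤ f.width := by
  cases f with
  | output W b => simp [DNN.depth] at h
  | hidden m hm W b f => exact le_max_of_le_left hm

set_option maxHeartbeats 800000 in
/-- Every network of the class is close to one whose parameters are multiples of `g` and whose
number of nonzero parameters is controlled by the clipped norm. -/
lemma exists_sparse_approx {σ : ℝ → ℝ} {c s₀ κ K₀ : ℝ} (hc : 1 ≤ c)
    (hσ : ∀ x y, |σ x - σ y| ≤ c * |x - y|) (hs₀ : |σ 0| ≤ s₀) (hκ : κ = 4 * c + 1)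
    (hK₀ : K₀ = 2 * (s₀ + 1)) {d : ℕ} {L N B F ρ τ ε g : ℝ} (hB : 1 ≤ B) (hτ : 0 < τ)
    (hτρ : τ ≤ ρ) (hρε : ρ * (L + 1) * ((N + 1) * B) ^ (L + 1) ≤ ε) (hε : 4 * c * ε ≤ 1)
    (hg : g = ρ * Real.exp (-(2 * κ ^ 2 * (L + 1)))) {f : DNN d} (hf : f ∈ dnnClass σ d L N B F) :
    ∃ ρ', (∀ x ∈ cube d, |f.eval σ x - (f.map fun a => g * roundInt ρ' g a).eval σ x| ≤
        2 * c * κ * (c * (d + 1) + K₀) * Real.exp (2 * κ ^ 2 * (d + 2)) * ε) ∧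
      (nnz (f.map fun a => g * roundInt ρ' g a).params : ℝ) ≤ 4 * κ ^ 2 * clipNorm τ f.params := by
  obtain ⟨hdep, hdL, hwN, hpB, -⟩ := hf
  have hρ : 0 < ρ := hτ.trans_le hτρ
  have hκ5 : 5 ≤ κ := by rw [hκ]; linarith
  have hs0 : 0 ≤ s₀ := (abs_nonneg _).trans hs₀
  have hL1 : 1 ≤ L := le_trans (by exact_mod_cast hdep) hdL
  have hg0 : 0 < g := by rw [hg]; positivity
  have hgρ : g ≤ ρ := by
    rw [hg]
    refine mul_le_of_le_one_right hρ.le (Real.exp_le_one_iff.2 ?_)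
    have : 0 ≤ κ ^ 2 * (L + 1) := by positivity
    linarith
  set w := f.width with hwdef
  set D := f.depth with hDdef
  have hw1 : 1 ≤ w := width_pos f hdep
  have hwR : (1 : ℝ) ≤ w := by exact_mod_cast hw1
  have hbase : 1 ≤ ((w : ℝ) + 1) * B := one_le_mul_of_one_le_of_one_le (by linarith) hB
  have hpow : ((w : ℝ) + 1) * B ≤ (((w : ℝ) + 1) * B) ^ (D + 1) :=
    le_self_pow₀ hbase (by omega)
  have hpow2 : (((w : ℝ) + 1) * B) ^ (D + 1) ≤ ((N + 1) * B) ^ (L + 1) := by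
    rw [← Real.rpow_natCast]
    have h1 : ((w : ℝ) + 1) * B ≤ (N + 1) * B := by gcongr
    refine (Real.rpow_le_rpow (by positivity) h1 (by positivity)).trans ?_
    refine Real.rpow_le_rpow_of_exponent_le (hbase.trans h1) ?_
    push_cast; linarith
  have hmain : (D + 1) * ρ * (((w : ℝ) + 1) * B) ^ (D + 1) ≤ ε := by
    refine le_trans ?_ hρε
    have : ((D : ℝ) + 1) * ρ ≤ ρ * (L + 1) := by nlinarith
    exact mul_le_mul this hpow2 (by positivity) (by positivity)
  have hρw : 4 * c * ρ * (w + 1) ≤ 1 := by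
    refine le_trans ?_ hε
    have h1 : ρ * (w + 1) ≤ ε := by
      refine le_trans ?_ hmain
      have h2 : (w : ℝ) + 1 ≤ ((w : ℝ) + 1) * B := le_mul_of_one_le_right (by positivity) hB
      calc ρ * (w + 1) ≤ ρ * (((w : ℝ) + 1) * B) ^ (D + 1) := by
            gcongr; exact h2.trans hpow
        _ ≤ (D + 1) * (ρ * (((w : ℝ) + 1) * B) ^ (D + 1)) :=
          le_mul_of_one_le_left (by positivity) (by linarith [Nat.cast_nonneg (α := ℝ) D])
        _ = _ := by ring
    calc 4 * c * ρ * (w + 1) = 4 * c * (ρ * (w + 1)) := by ring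
      _ ≤ 4 * c * ε := by gcongr
  have hε0 : 0 ≤ ε := le_trans (by positivity) hmain
  have hlen : (f.params.length : ℝ) ≤ (d + 1 + D) * ((w : ℝ) + 1) ^ 2 := by
    have := length_params_le f (le_refl f.width)
    have h2 : (f.params.length : ℝ) ≤ (w + 1) * (d + 1) + D * (w + 1) ^ 2 := by exact_mod_cast this
    have h3 : ((w : ℝ) + 1) * (d + 1) ≤ (d + 1) * (w + 1) ^ 2 := by
      have : (w : ℝ) + 1 ≤ (w + 1) ^ 2 := by nlinarith
      rw [mul_comm]; gcongr
    linarith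
  set s := nnz (f.map fun a => g * roundInt ρ g a).params with hs
  have hsclip : (s : ℝ) ≤ clipNorm τ f.params := by
    rw [hs, DNN.params_map]
    refine nnz_map_le_clipNorm hτ hτρ (fun a ha => ?_) _
    simp [roundInt, ha]
  have hclip0 := clipNorm_nonneg hτ f.params
  have hlog : Real.log 2 ≤ 1 := by
    have := Real.log_two_lt_d9; linarith
  have hlog' : 1 / 2 ≤ Real.log 2 := by
    have := Real.log_two_gt_d9; linarith
  have hC0 : 0 ≤ 2 * c * κ * (c * (d + 1) + K₀) := by rw [hK₀]; positivity
  -- Sparse case: the factor 2^{-(D-1)} cancels the exponential up to exp(d + 2), so thresholding at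
  -- `ρ` is affordable.
  by_cases hcase : 2 * κ ^ 2 * s / ((w : ℝ) + 1) ^ 2 ≤ ((D : ℝ) - 1) * Real.log 2 + (d + 2)
  · refine ⟨ρ, fun x hx => ?_, ?_⟩
    · have h := eval_sub_eval_map_le_of_mem_cube hc hσ hs₀ hκ hK₀ hw1 hB hρ.le hρw
        (φ := fun a => g * roundInt ρ g a)
        (fun a _ => (abs_sub_mul_roundInt_le hg0 a).trans (max_le le_rfl hgρ))
        (fun a => abs_mul_roundInt_le hg0 a) f hdep le_rfl hpB hx
      refine h.trans ?_
      rw [mul_assoc (2 * c * κ * (c * (d + 1) + K₀))]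
      refine mul_le_mul_of_nonneg_left ?_ hC0
      rw [mul_comm (Real.exp _) ε]
      refine mul_le_mul hmain ?_ (by positivity) hε0
      have h2 : Real.exp (((D : ℝ) - 1) * Real.log 2) = 2 ^ (D - 1) := by
        rw [mul_comm, Real.exp_mul, Real.exp_log two_pos, ← Real.rpow_natCast,
          Nat.cast_sub hdep]; simp
      calc (1 / 2 : ℝ) ^ (D - 1) * Real.exp (2 * κ ^ 2 * s / ((w : ℝ) + 1) ^ 2)
          ≤ (1 / 2 : ℝ) ^ (D - 1) * (2 ^ (D - 1) * Real.exp (d + 2)) := by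
            rw [← h2, ← Real.exp_add]
            gcongr
        _ = Real.exp (d + 2) := by rw [← mul_assoc, ← mul_pow]; norm_num
        _ ≤ _ := by
            refine Real.exp_le_exp.2 (le_mul_of_one_le_left (by positivity) (by nlinarith))
    · refine hsclip.trans (le_mul_of_one_le_left hclip0 (by nlinarith))
  · push Not at hcase
    rw [lt_div_iff₀ (by positivity)] at hcase
    -- Dense case: since log 2 ≥ 1/2, the number `s` of parameters surviving the threshold is
    -- comparable to the number of all parameters. Even a fully dense approximation is then paid for
    -- by the clipped norm.
    have hlens : (f.params.length : ℝ) ≤ 4 * κ ^ 2 * s := by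
      have h1 : ((d : ℝ) + 1 + D) * ((w : ℝ) + 1) ^ 2
          ≤ 2 * ((((D : ℝ) - 1) * Real.log 2 + (d + 2)) * ((w : ℝ) + 1) ^ 2) := by
        rw [← mul_assoc]
        refine mul_le_mul_of_nonneg_right ?_ (by positivity)
        have hD1 : (1 : ℝ) ≤ D := by exact_mod_cast hdep
        nlinarith [Nat.cast_nonneg (α := ℝ) d]
      linarith
    -- With threshold 0 nothing is set to zero beforehand and the error is `g`, whose factor
    -- exp(-2κ²(L+1)) compensates the exponential of the full network size.
    refine ⟨0, fun x hx => ?_, ?_⟩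
    · have h := eval_sub_eval_map_le_of_mem_cube hc hσ hs₀ hκ hK₀ hw1 hB hg0.le
        (le_trans (by gcongr) hρw) (φ := fun a => g * roundInt 0 g a)
        (fun a _ => (abs_sub_mul_roundInt_le hg0 a).trans (max_le hg0.le le_rfl))
        (fun a => abs_mul_roundInt_le hg0 a) f hdep le_rfl hpB hx
      refine h.trans ?_
      rw [mul_assoc (2 * c * κ * (c * (d + 1) + K₀))]
      refine mul_le_mul_of_nonneg_left ?_ hC0
      set s' := nnz (f.map fun a => g * roundInt 0 g a).params with hs'
      have hs'len : (s' : ℝ) ≤ (d + 1 + D) * ((w : ℝ) + 1) ^ 2 := by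
        refine le_trans ?_ hlen
        rw [hs', DNN.params_map]
        exact_mod_cast (nnz_le_length _).trans (by simp)
      have h1 : Real.exp (2 * κ ^ 2 * s' / ((w : ℝ) + 1) ^ 2)
          ≤ Real.exp (2 * κ ^ 2 * (d + 1 + D)) := by
        refine Real.exp_le_exp.2 ?_
        rw [div_le_iff₀ (by positivity), mul_assoc (2 * κ ^ 2)]
        exact mul_le_mul_of_nonneg_left hs'len (by positivity)
      have h2 : (1 / 2 : ℝ) ^ (D - 1) ≤ 1 := pow_le_one₀ (by norm_num) (by norm_num)
      have h3 : Real.exp (-(2 * κ ^ 2 * (L + 1))) * Real.exp (2 * κ ^ 2 * (d + 1 + D))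
          ≤ Real.exp (2 * κ ^ 2 * (d + 2)) := by
        rw [← Real.exp_add]
        refine Real.exp_le_exp.2 ?_
        have : 0 ≤ κ ^ 2 * (L - D) := mul_nonneg (by positivity) (by linarith)
        nlinarith [sq_nonneg κ]
      calc _ ≤ ((D : ℝ) + 1) * g * (((w : ℝ) + 1) * B) ^ (D + 1) *
            (1 * Real.exp (2 * κ ^ 2 * (d + 1 + D))) := by gcongr
        _ = ((D + 1) * ρ * (((w : ℝ) + 1) * B) ^ (D + 1)) *
            (Real.exp (-(2 * κ ^ 2 * (L + 1))) * Real.exp (2 * κ ^ 2 * (d + 1 + D))) := by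
            rw [hg]; ring
        _ ≤ ε * Real.exp (2 * κ ^ 2 * (d + 2)) :=
            mul_le_mul hmain h3 (by positivity) hε0
        _ = _ := by ring
    · have h1 : (nnz (f.map fun a => g * roundInt 0 g a).params : ℝ) ≤ f.params.length := by
        rw [DNN.params_map]
        exact_mod_cast (nnz_le_length _).trans (by simp)
      exact h1.trans (hlens.trans (by gcongr))

end SparseApproximation

/-! ### Encoding networks by widths and parameter lists -/

section Net

namespace DNN

/-- The dimensions of the hidden layers. -/
def widths : {n : ℕ} → DNN n → List ℕ
  | _, output _ _ => []
  | _, hidden m _ _ _ f => m :: widths f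

lemma length_widths {n : ℕ} (f : DNN n) : f.widths.length = f.depth := by
  induction f with
  | output W b => rfl
  | hidden m hm W b f ih => simp [widths, depth, ih]

lemma le_width_of_mem_widths {n : ℕ} (f : DNN n) : ∀ k ∈ f.widths, k ≤ f.width := by
  induction f with
  | output W b => simp [widths]
  | hidden m hm W b f ih =>
    intro k hk
    rcases List.mem_cons.1 hk with rfl | hk
    · exact le_max_left _ _
    · exact (ih k hk).trans (le_max_right _ _)

lemma length_params_eq {n : ℕ} (f f' : DNN n) (h : f.widths = f'.widths) :
    f.params.length = f'.params.length := by
  induction f with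
  | output W b =>
    cases f' with
    | output W' b' => simp [params, length_vec]
    | hidden m hm W' b' f' => simp [widths] at h
  | hidden m hm W b f ih =>
    cases f' with
    | output W' b' => simp [widths] at h
    | hidden m' hm' W' b' f' =>
      simp only [widths, List.cons.injEq] at h
      obtain ⟨rfl, h⟩ := h
      simp [params, length_vec, ih f' h]

lemma vec_injective {m n : ℕ} {W W' : Matrix (Fin m) (Fin n) ℝ} (h : vec W = vec W') :
    W = W' := by
  have key : ∀ l : List (Fin n), l.flatMap (fun j => (List.finRange m).map fun i => W i j)
      = l.flatMap (fun j => (List.finRange m).map fun i => W' i j) →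
      ∀ j ∈ l, ∀ i, W i j = W' i j := by
    intro l
    induction l with
    | nil => simp
    | cons j l ih =>
      intro h
      rw [List.flatMap_cons, List.flatMap_cons] at h
      obtain ⟨h1, h2⟩ := List.append_inj h (by simp)
      intro k hk i
      rcases List.mem_cons.1 hk with rfl | hk
      · exact List.map_inj_left.1 h1 i (List.mem_finRange i)
      · exact ih h2 k hk i
  ext i j
  exact key _ h j (List.mem_finRange j) i

/-- The widths determine where the flat parameter list is to be cut. This makes the codes of the net
unambiguous. -/
lemma ext_of_widths_of_params {n : ℕ} (f f' : DNN n) (h : f.widths = f'.widths)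
    (hp : f.params = f'.params) : f = f' := by
  induction f with
  | output W b =>
    cases f' with
    | output W' b' =>
      obtain ⟨h1, h2⟩ := List.append_inj hp (by simp [length_vec])
      rw [vec_injective h1, List.ofFn_injective h2]
    | hidden m hm W' b' f' => simp [widths] at h
  | hidden m hm W b f ih =>
    cases f' with
    | output W' b' => simp [widths] at h
    | hidden m' hm' W' b' f' =>
      simp only [widths, List.cons.injEq] at h
      obtain ⟨rfl, h⟩ := h
      obtain ⟨h1, h3⟩ := List.append_inj hp (by simp [length_vec])
      obtain ⟨h1, h2⟩ := List.append_inj h1 (by simp [length_vec])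
      rw [vec_injective h1, List.ofFn_injective h2, ih f' h h3]

end DNN

lemma exists_ofFn_eq_append_replicate {α : Type*} (l : List α) (a : α) {n : ℕ}
    (h : l.length ≤ n) : ∃ v : Fin n → α, List.ofFn v = l ++ List.replicate (n - l.length) a := by
  have hlen : (l ++ List.replicate (n - l.length) a).length = n := by simp; omega
  refine ⟨fun k => (l ++ List.replicate (n - l.length) a)[k.1]'(by rw [hlen]; exact k.2), ?_⟩
  refine List.ext_getElem (by simp; omega) fun k h1 h2 => ?_
  simp

/-- The weight factorizes over coordinates: a coordinate equal to `z₀` contributes 1 and any other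
value exp(-E). -/
lemma sum_exp_neg_card {P : ℕ} {Z : Type*} [Fintype Z] [DecidableEq Z] (z₀ : Z) (E : ℝ) :
    ∑ θ : Fin P → Z, Real.exp (-(E * (Finset.univ.filter fun k => θ k ≠ z₀).card))
      = (1 + (Fintype.card Z - 1) * Real.exp (-E)) ^ P := by
  have h1 : ∀ θ : Fin P → Z, Real.exp (-(E * (Finset.univ.filter fun k => θ k ≠ z₀).card))
      = ∏ k, (if θ k = z₀ then 1 else Real.exp (-E)) := by
    intro θ
    rw [Finset.card_filter, Nat.cast_sum, Finset.mul_sum, ← Finset.sum_neg_distrib, Real.exp_sum]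
    refine Finset.prod_congr rfl fun k _ => ?_
    by_cases h : θ k = z₀ <;> simp [h]
  simp_rw [h1]
  have h2 := Fintype.sum_pow (fun z : Z => if z = z₀ then (1 : ℝ) else Real.exp (-E)) P
  refine h2.symm.trans ?_
  congr 1
  rw [← Finset.add_sum_erase _ _ (Finset.mem_univ z₀), if_pos rfl]
  congr 1
  rw [Finset.sum_congr rfl fun z hz => if_neg (Finset.ne_of_mem_erase hz), Finset.sum_const,
    Finset.card_erase_of_mem (Finset.mem_univ _), nsmul_eq_mul, Finset.card_univ,
    Nat.cast_sub (Fintype.card_pos_iff.2 ⟨z₀⟩)]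
  simp

end Net

/-! ### The weighted finite net -/

section NetExistence

lemma continuous_eval {σ : ℝ → ℝ} (hσ : Continuous σ) {n : ℕ} (f : DNN n) :
    Continuous (f.eval σ) := by
  induction f with
  | output W b =>
    have : Continuous fun x => (W *ᵥ x + b) 0 := by fun_prop
    exact this
  | hidden m hm W b f ih =>
    have : Continuous fun x => f.eval σ (fun i => σ ((W *ᵥ x + b) i)) := by fun_prop
    exact this

lemma countP_ofFn_eq_card {α : Type*} (p : α → Prop) [DecidablePred p] {n : ℕ} (v : Fin n → α) :
    (List.ofFn v).countP (fun a => decide (p a)) = (Finset.univ.filter fun k => p (v k)).card := by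
  rw [Finset.card_filter]
  induction n with
  | zero => simp
  | succ n ih =>
    rw [List.ofFn_succ, List.countP_cons, ih, Fin.sum_univ_succ, add_comm]
    simp

lemma length_params_le_of_le {d : ℕ} (f : DNN d) {L N : ℕ} (hL : f.depth ≤ L) (hN : f.width ≤ N) :
    f.params.length ≤ (N + 1) * (d + 1) + L * (N + 1) ^ 2 :=
  (length_params_le f hN).trans (by gcongr)

set_option maxHeartbeats 800000 in
/-- A finite net of the network class, weighted by sparsity. -/
lemma exists_net {σ : ℝ → ℝ} {c s₀ κ K₀ : ℝ} (hc : 1 ≤ c)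
    (hσ : ∀ x y, |σ x - σ y| ≤ c * |x - y|) (hσc : Continuous σ) (hs₀ : |σ 0| ≤ s₀)
    (hκ : κ = 4 * c + 1)
    (hK₀ : K₀ = 2 * (s₀ + 1)) {d : ℕ} {L N B F ρ τ ε g E δ : ℝ} (hL : 0 < L) (hN : 0 < N)
    (hB : 1 ≤ B) (hF : 0 ≤ F) (hτ : 0 < τ)
    (hτρ : τ ≤ ρ) (hρε : ρ * (L + 1) * ((N + 1) * B) ^ (L + 1) ≤ ε) (hε : 4 * c * ε ≤ 1)
    (hg : g = ρ * Real.exp (-(2 * κ ^ 2 * (L + 1))))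
    (hδ : δ = 2 * c * κ * (c * (d + 1) + K₀) * Real.exp (2 * κ ^ 2 * (d + 2)) * ε)
    (hE : 0 ≤ E) (hE1 : (L + 1) * (N + 1) ^ L ≤ Real.exp (E / 2))
    (hE2 : 2 * (B / g + 1) * ((d + 1 + L) * (N + 1) ^ 2) ≤ Real.exp (E / 2)) :
    ∃ (I : Type) (_ : Fintype I) (G : I → (Fin d → ℝ) → ℝ) (p : I → ℝ),
      (∀ i, Measurable (G i)) ∧ (∀ i x, |G i x| ≤ F) ∧ (∀ i, 0 ≤ p i) ∧
      ∑ i, Real.exp (-p i) ≤ 4 ∧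
      ∀ f ∈ dnnClass σ d L N B F, ∃ i, (∀ x ∈ cube d, |f.eval σ x - G i x| ≤ δ) ∧
        p i ≤ E * (4 * κ ^ 2 * clipNorm τ f.params) := by
  classical
  have hρ : 0 < ρ := hτ.trans_le hτρ
  have hg0 : 0 < g := by rw [hg]; positivity
  set Lₙ := ⌊L⌋₊ with hLₙ
  set Nₙ := ⌊N⌋₊ with hNₙ
  set Pₙ := (Nₙ + 1) * (d + 1) + Lₙ * (Nₙ + 1) ^ 2 with hPₙ
  have hLle : (Lₙ : ℝ) ≤ L := Nat.floor_le hL.le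
  have hNle : (Nₙ : ℝ) ≤ N := Nat.floor_le hN.le
  set K : ℕ := ⌈B / g⌉₊ with hK
  let Z := Finset.Icc (-(K : ℤ)) K
  let z₀ : Z := ⟨0, by simp [Z]⟩
  -- A code is a depth, a list of widths and a list of grid coordinates. Both lists are padded by
  -- zeros to a common length, so decoding works with prefixes; padding does not affect the count of
  -- nonzero coordinates.
  let I₀ := (Fin (Lₙ + 1) × (Fin Lₙ → Fin (Nₙ + 1))) × (Fin Pₙ → Z)
  let Code : I₀ → DNN d → Prop := fun i f => f.widths.length = i.1.1 ∧
    f.widths <+: List.ofFn (fun k => (i.1.2 k : ℕ)) ∧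
    f.params <+: List.ofFn (fun k => g * ((i.2 k : ℤ) : ℝ))
  have huniq : ∀ i f f', Code i f → Code i f' → f = f' := by
    rintro i f f' ⟨h1, h2, h3⟩ ⟨h1', h2', h3'⟩
    have hw : f.widths = f'.widths :=
      (List.prefix_of_prefix_length_le h2 h2' (h1.trans h1'.symm).le).eq_of_length
        (h1.trans h1'.symm)
    have hl := DNN.length_params_eq f f' hw
    exact DNN.ext_of_widths_of_params f f' hw
      ((List.prefix_of_prefix_length_le h3 h3' hl.le).eq_of_length hl)
  let net : I₀ → DNN d := fun i => if h : ∃ f, Code i f then h.choose else .output 0 0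
  have hnet : ∀ i f, Code i f → net i = f := by
    intro i f h
    have hex : ∃ f, Code i f := ⟨f, h⟩
    simp only [net, dif_pos hex]
    exact huniq i _ _ hex.choose_spec h
  let num : I₀ → ℕ := fun i => (Finset.univ.filter fun k => i.2 k ≠ z₀).card
  let clip : ℝ → ℝ := fun y => max (-F) (min F y)
  -- Rounding may push values beyond `F`; clipping restores the bound without increasing the
  -- distance to functions bounded by `F`. The index `none` is the zero function.
  let G : Option I₀ → (Fin d → ℝ) → ℝ := fun o x => o.elim 0 fun i => clip ((net i).eval σ x)
  let p : Option I₀ → ℝ := fun o => o.elim 0 fun i => E * max 1 (num i : ℝ)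
  have hclip : ∀ y, |clip y| ≤ F := fun y =>
    abs_le.2 ⟨le_max_left _ _, max_le (by linarith) (min_le_left _ _)⟩
  have hclip2 : ∀ y y' : ℝ, |y| ≤ F → |y - clip y'| ≤ |y - y'| := by
    intro y y' hy
    have h1 : clip y = y := by
      simp only [clip]
      rw [min_eq_right (abs_le.1 hy).2, max_eq_right (abs_le.1 hy).1]
    calc |y - clip y'| = |clip y - clip y'| := by rw [h1]
      _ ≤ |min F y - min F y'| := by
        simpa [clip] using abs_max_sub_max_le_abs (min F y) (min F y') (-F) |>.trans_eq' (by
          simp [max_comm])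
      _ ≤ |y - y'| := by
        have := abs_min_sub_min_le_max F y F y'
        simpa using this
  refine ⟨Option I₀, inferInstance, G, p, ?_, ?_, ?_, ?_, ?_⟩
  · rintro (_ | i)
    · exact measurable_const
    · have := (continuous_eval hσc (net i))
      exact (by fun_prop : Continuous fun x => max (-F) (min F ((net i).eval σ x))).measurable
  · rintro (_ | i) x
    · simpa [G] using hF
    · exact hclip _
  · rintro (_ | i)
    · exact le_rfl
    · exact mul_nonneg hE (le_trans zero_le_one (le_max_left _ _))
  · rw [Fintype.sum_option]
    have h1 : ∀ i : I₀, Real.exp (-p (some i))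
        ≤ Real.exp (-(E / 2)) * Real.exp (-(E / 2 * num i)) := by
      intro i
      rw [← Real.exp_add]
      refine Real.exp_le_exp.2 ?_
      -- The weight splits into E/2, which pays for the architectures, and E/2 per nonzero
      -- coordinate, which pays for the grid values.
      have h2 : (1 : ℝ) + num i ≤ 2 * max 1 (num i : ℝ) := by
        linarith [le_max_left (1 : ℝ) (num i), le_max_right (1 : ℝ) (num i)]
      simp only [p, Option.elim]
      nlinarith
    have h3 : ∑ i : I₀, Real.exp (-(E / 2 * num i))
        = ((Lₙ + 1) * (Nₙ + 1) ^ Lₙ) * (1 + (Fintype.card Z - 1) * Real.exp (-(E / 2))) ^ Pₙ := by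
      rw [Fintype.sum_prod_type, ← sum_exp_neg_card z₀ (E / 2)]
      simp [num]
    have hcard : (Fintype.card Z : ℝ) - 1 = 2 * K := by
      have : Fintype.card Z = 2 * K + 1 := by
        rw [Fintype.card_coe, Int.card_Icc]; omega
      rw [this]; push_cast; ring
    have hK1 : (K : ℝ) ≤ B / g + 1 := (Nat.ceil_lt_add_one (by positivity)).le
    have hPle : (Pₙ : ℝ) ≤ (d + 1 + L) * (N + 1) ^ 2 := by
      rw [hPₙ]
      push_cast
      have h4 : ((Nₙ : ℝ) + 1) ≤ (N + 1) ^ 2 := by nlinarith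
      have h5 : ((Nₙ : ℝ) + 1) ^ 2 ≤ (N + 1) ^ 2 := by gcongr
      calc ((Nₙ : ℝ) + 1) * (d + 1) + Lₙ * (Nₙ + 1) ^ 2
          ≤ (N + 1) ^ 2 * (d + 1) + L * (N + 1) ^ 2 := by gcongr
        _ = _ := by ring
    have hexp0 : Real.exp (-(E / 2)) * Real.exp (E / 2) = 1 := by rw [← Real.exp_add]; simp
    have hpow : (1 + (Fintype.card Z - 1) * Real.exp (-(E / 2))) ^ Pₙ ≤ Real.exp 1 := by
      rw [hcard]
      have h6 : 1 + 2 * (K : ℝ) * Real.exp (-(E / 2)) ≤ Real.exp (2 * K * Real.exp (-(E / 2))) := by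
        linarith [Real.add_one_le_exp (2 * K * Real.exp (-(E / 2)))]
      refine (pow_le_pow_left₀ (by positivity) h6 _).trans ?_
      rw [← Real.exp_nat_mul]
      refine Real.exp_le_exp.2 ?_
      calc (Pₙ : ℝ) * (2 * K * Real.exp (-(E / 2)))
          = (2 * K * Pₙ) * Real.exp (-(E / 2)) := by ring
        _ ≤ (2 * (B / g + 1) * ((d + 1 + L) * (N + 1) ^ 2)) * Real.exp (-(E / 2)) := by gcongr
        _ ≤ Real.exp (E / 2) * Real.exp (-(E / 2)) := by gcongr
        _ = 1 := by rw [mul_comm, hexp0]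
    have harch : ((Lₙ : ℝ) + 1) * (Nₙ + 1) ^ Lₙ ≤ Real.exp (E / 2) := by
      refine le_trans ?_ hE1
      rw [← Real.rpow_natCast]
      refine mul_le_mul (by linarith) ?_ (by positivity) (by positivity)
      refine (Real.rpow_le_rpow (by positivity) (by linarith : (Nₙ : ℝ) + 1 ≤ N + 1)
        (by positivity)).trans ?_
      exact Real.rpow_le_rpow_of_exponent_le (by linarith) hLle
    calc Real.exp (-p none) + ∑ i : I₀, Real.exp (-p (some i))
        ≤ 1 + ∑ i : I₀, Real.exp (-(E / 2)) * Real.exp (-(E / 2 * num i)) := by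
          refine add_le_add (by simp [p]) (Finset.sum_le_sum fun i _ => h1 i)
      _ = 1 + Real.exp (-(E / 2)) * (((Lₙ + 1) * (Nₙ + 1) ^ Lₙ) *
            (1 + (Fintype.card Z - 1) * Real.exp (-(E / 2))) ^ Pₙ) := by
          rw [← Finset.mul_sum, h3]
      _ ≤ 1 + Real.exp (-(E / 2)) * (Real.exp (E / 2) * Real.exp 1) := by
          gcongr
          rw [hcard]; positivity
      _ = 1 + Real.exp 1 := by rw [← mul_assoc, hexp0, one_mul]
      _ ≤ 4 := by have := Real.exp_one_lt_d9; linarith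
  · intro f hf
    obtain ⟨ρ', happ, hnnz⟩ := exists_sparse_approx hc hσ hs₀ hκ hK₀ hB hτ hτρ hρε hε hg hf
    rw [← hδ] at happ
    obtain ⟨hdep, hdL, hwN, hpB, hfF⟩ := hf
    have hclip0 := clipNorm_nonneg hτ f.params
    set f' := f.map fun a => g * roundInt ρ' g a with hf'
    -- If every rounded parameter vanishes, the clipped norm may be too small to pay even for one
    -- unit `E`; the zero function with weight 0 is then used.
    rcases Nat.eq_zero_or_pos (nnz f'.params) with h0 | h0
    · refine ⟨none, fun x hx => ?_, ?_⟩
      · have h1 : f'.eval σ x = 0 := by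
          refine eval_eq_zero f' (fun a ha => ?_) x
          have := List.countP_eq_zero.1 h0 a ha
          simpa using this
        have := happ x hx
        rwa [h1] at this
      · simp only [p, Option.elim]
        positivity
    · have hdep' : f'.depth ≤ Lₙ := by rw [hf', DNN.depth_map]; exact Nat.le_floor hdL
      have hwid' : f'.width ≤ Nₙ := by rw [hf', DNN.width_map]; exact Nat.le_floor hwN
      obtain ⟨ws, hws⟩ := exists_ofFn_eq_append_replicate f'.widths 0 (n := Lₙ)
        (by rw [DNN.length_widths]; exact hdep')
      have hws_le : ∀ k, ws k < Nₙ + 1 := by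
        intro k
        have h1 : ws k ∈ List.ofFn ws := by simp
        rw [hws] at h1
        rcases List.mem_append.1 h1 with h1 | h1
        · have := DNN.le_width_of_mem_widths f' _ h1; omega
        · rw [List.eq_of_mem_replicate h1]; omega
      have hlenp : (f.params.map (roundInt ρ' g)).length ≤ Pₙ := by
        have := length_params_le_of_le f' hdep' hwid'
        rw [hf', DNN.params_map] at this
        simpa using this
      obtain ⟨θ, hθ⟩ := exists_ofFn_eq_append_replicate (f.params.map (roundInt ρ' g)) 0 hlenp
      have hθ_mem : ∀ k, θ k ∈ Finset.Icc (-(K : ℤ)) K := by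
        intro k
        have h1 : θ k ∈ List.ofFn θ := by simp
        rw [hθ] at h1
        rcases List.mem_append.1 h1 with h1 | h1
        · obtain ⟨a, ha, hak⟩ := List.mem_map.1 h1
          have h2 := (abs_mul_roundInt_le (ρ := ρ') hg0 a).trans (hpB a ha)
          rw [hak, abs_mul, abs_of_pos hg0] at h2
          have h3 : |(θ k : ℝ)| ≤ K := by
            refine le_trans ?_ (Nat.le_ceil (B / g))
            rw [le_div_iff₀ hg0]; linarith
          rw [Finset.mem_Icc, ← abs_le]
          exact_mod_cast h3
        · rw [List.eq_of_mem_replicate h1]; simp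
      let i : I₀ := ((⟨f'.depth, by omega⟩, fun k => ⟨ws k, hws_le k⟩), fun k => ⟨θ k, hθ_mem k⟩)
      have hcode : Code i f' := by
        refine ⟨DNN.length_widths f', ?_, ?_⟩
        · change f'.widths <+: List.ofFn ws
          rw [hws]; exact List.prefix_append _ _
        · change f'.params <+: List.ofFn (fun k => g * ((θ k : ℤ) : ℝ))
          have h1 : List.ofFn (fun k => g * ((θ k : ℤ) : ℝ))
              = (List.ofFn θ).map fun z : ℤ => g * (z : ℝ) := by
            rw [List.map_ofFn]; rfl
          rw [h1, hθ, List.map_append, hf', DNN.params_map, List.map_map]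
          exact List.prefix_append _ _
      have hnum : num i = nnz f'.params := by
        have h1 : num i = (Finset.univ.filter fun k => θ k ≠ 0).card := by
          simp only [num, i, z₀]
          congr 1
          ext k
          simp [Subtype.ext_iff]
        rw [h1, ← countP_ofFn_eq_card (fun z : ℤ => z ≠ 0) θ, hθ, List.countP_append, nnz, hf',
          DNN.params_map, List.countP_map, List.countP_map]
        have h2 : List.countP (fun z : ℤ => decide (z ≠ 0))
            (List.replicate (Pₙ - (f.params.map (roundInt ρ' g)).length) 0) = 0 := by
          rw [List.countP_eq_zero]
          intro a ha
          simp [List.eq_of_mem_replicate ha]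
        rw [h2, add_zero]
        congr 1
        ext a
        simp [hg0.ne']
      refine ⟨some i, fun x hx => ?_, ?_⟩
      · simp only [G, Option.elim]
        rw [hnet i f' hcode]
        exact (hclip2 _ _ (hfF x hx)).trans (happ x hx)
      · simp only [p, Option.elim]
        refine mul_le_mul_of_nonneg_left ?_ hE
        rw [hnum]
        refine max_le (le_trans ?_ hnnz) hnnz
        exact_mod_cast h0

end NetExistence

/-! ### Remainder terms of the oracle inequality -/

section Remainder

variable {Ω : Type*} {mΩ : MeasurableSpace Ω} {P : Measure Ω} {d : ℕ}

/-- The empirical squared distance of `h` and `f₀`. -/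
def sqDist {E : Type*} (T : ℕ) (X : ℕ → Ω → E) (f₀ h : E → ℝ) (ω : Ω) : ℝ :=
  (1 / (T : ℝ)) * ∑ t ∈ Finset.Icc 1 T, (h (X t ω) - f₀ (X t ω)) ^ 2

/-- The noise term of the basic inequality. -/
def noise (T : ℕ) (X : ℕ → Ω → Fin d → ℝ) (v : ℕ → Ω → ℝ) (η f₀ h : (Fin d → ℝ) → ℝ)
    (ω : Ω) : ℝ :=
  (2 / (T : ℝ)) * ∑ t ∈ Finset.Icc 1 T,
    (cube d).indicator η (X t ω) * v t ω * (h (X t ω) - f₀ (X t ω))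

lemma sqDist_nonneg {E : Type*} {T : ℕ} {X : ℕ → Ω → E} {f₀ h : E → ℝ} (ω : Ω) :
    0 ≤ sqDist T X f₀ h ω :=
  mul_nonneg (by positivity) (Finset.sum_nonneg fun _ _ => sq_nonneg _)

lemma sq_sub_le {F a b : ℝ} (ha : |a| ≤ F) (hb : |b| ≤ F) : (a - b) ^ 2 ≤ 4 * F ^ 2 := by
  have h1 : |a - b| ≤ 2 * F := (abs_sub a b).trans (by linarith)
  have h2 : |a - b| ^ 2 ≤ (2 * F) ^ 2 := pow_le_pow_left₀ (abs_nonneg _) h1 2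
  rw [sq_abs] at h2
  linarith

lemma mean_le {T : ℕ} (hT : 0 < T) {u : ℕ → ℝ} {c : ℝ} (h : ∀ t ∈ Finset.Icc 1 T, u t ≤ c) :
    (1 / (T : ℝ)) * ∑ t ∈ Finset.Icc 1 T, u t ≤ c := by
  have hTr : (0 : ℝ) < T := by exact_mod_cast hT
  rw [one_div, inv_mul_le_iff₀ hTr]
  refine (Finset.sum_le_card_nsmul _ _ c h).trans (by simp)

lemma sqDist_le {E : Type*} {T : ℕ} (hT : 0 < T) {X : ℕ → Ω → E} {f₀ h : E → ℝ} {F : ℝ}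
    (hf₀ : ∀ x, |f₀ x| ≤ F) (hh : ∀ x, |h x| ≤ F) (ω : Ω) :
    sqDist T X f₀ h ω ≤ 4 * F ^ 2 :=
  mean_le hT fun _ _ => sq_sub_le (hh _) (hf₀ _)

lemma measurable_sqDist {E : Type*} [MeasurableSpace E] {T : ℕ} {X : ℕ → Ω → E}
    (hX : ∀ t ∈ Finset.Icc 1 T, Measurable (X t)) {f₀ h : E → ℝ} (hf₀ : Measurable f₀)
    (hh : Measurable h) : Measurable (sqDist T X f₀ h) :=
  Measurable.const_mul (Finset.measurable_fun_sum _ fun t ht =>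
    ((hh.comp (hX t ht)).sub (hf₀.comp (hX t ht))).pow_const 2) _

lemma integrable_sqDist [IsFiniteMeasure P] {E : Type*} [MeasurableSpace E] {T : ℕ} (hT : 0 < T)
    {X : ℕ → Ω → E} (hX : ∀ t ∈ Finset.Icc 1 T, Measurable (X t)) {f₀ h : E → ℝ}
    (hf₀ : Measurable f₀) (hh : Measurable h) {F : ℝ}
    (hf₀F : ∀ x, |f₀ x| ≤ F) (hhF : ∀ x, |h x| ≤ F) : Integrable (sqDist T X f₀ h) P :=
  Integrable.of_bound (measurable_sqDist hX hf₀ hh).aestronglyMeasurable (4 * F ^ 2)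
    (ae_of_all _ fun ω => by
      rw [Real.norm_eq_abs, abs_of_nonneg (sqDist_nonneg ω)]; exact sqDist_le hT hf₀F hhF ω)

/-- Comparison of population and empirical distance, uniformly over a finite weighted family. -/
lemma exists_mixing_remainder [IsProbabilityMeasure P] {E : Type*} [MeasurableSpace E]
    {I : Type*} [Fintype I] {T : ℕ} (hT : 0 < T) {X : ℕ → Ω → E}
    (hX : ∀ t ∈ Finset.Icc 1 T, Measurable (X t)) {f₀ : E → ℝ} (hf₀ : Measurable f₀)
    {H : I → E → ℝ} (hH : ∀ i, Measurable (H i)) {F : ℝ} (hF : 1 ≤ F)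
    (hf₀F : ∀ x, |f₀ x| ≤ F) (hHF : ∀ i x, |H i x| ≤ F)
    {a : ℕ} (ha : 0 < a) {b : ℝ} (hb : 0 ≤ b) (hβ : betaMixing P T X a ≤ ENNReal.ofReal b)
    {p : I → ℝ} (hp : ∀ i, 0 ≤ p i) :
    ∃ Z : Ω → ℝ, Integrable Z P ∧
      ∫ ω, Z ω ∂P ≤ 16 * F ^ 2 * b * (T + 1) + 16 * a * F ^ 2 / T * ∑ i, Real.exp (-p i) ∧
      ∀ i ω, ∫ ω', sqDist T X f₀ (H i) ω' ∂P
        ≤ 2 * sqDist T X f₀ (H i) ω + 2 * (8 * a * F ^ 2 / T) * p i + Z ω := by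
  have hTr : (0 : ℝ) < T := by exact_mod_cast hT
  have har : (0 : ℝ) < a := by exact_mod_cast ha
  set M := 4 * F ^ 2 with hM
  have hM0 : 0 < M := by positivity
  set θ : ℝ := T / (2 * (a * M)) with hθ
  have hθ0 : 0 < θ := by positivity
  set D : I → E → ℝ := fun i x => (H i x - f₀ x) ^ 2 with hD
  have hDm : ∀ i, Measurable (D i) := fun i => ((hH i).sub hf₀).pow_const 2
  have hD0 : ∀ i x, 0 ≤ D i x := fun i x => sq_nonneg _
  have hDM : ∀ i x, D i x ≤ M := fun i x => sq_sub_le (hHF i x) (hf₀F x)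
  have hDi : ∀ i, ∀ t ∈ Finset.Icc 1 T, Integrable (fun ω => D i (X t ω)) P := fun i t ht =>
    Integrable.of_bound ((hDm i).comp (hX t ht)).aestronglyMeasurable M (ae_of_all _ fun ω => by
      rw [Real.norm_eq_abs, abs_of_nonneg (hD0 _ _)]; exact hDM _ _)
  set S : ℕ → I → Ω → ℝ := fun r i ω => (1 / (T : ℝ)) *
      ∑ t ∈ (Finset.Icc 1 T).filter (fun t => t / a % 2 = r),
        (∫ ω', D i (X t ω') ∂P - 2 * D i (X t ω)) with hS
  -- With these weights Mw_i exp(θS) = exp(θS - p_i)/θ, which dominates S - p_i/θ by x ≤ e^x. The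
  -- other branch of the minimum is harmless because S ≤ M always.
  set w : I → ℝ := fun i => Real.exp (-p i) / (M * θ) with hw
  have hw0 : ∀ i, 0 ≤ w i := fun i => by positivity
  set Z : ℕ → Ω → ℝ := fun r ω => M * min 1 (∑ i, w i * Real.exp (θ * S r i ω)) with hZ
  have hSm : ∀ r i, Measurable (S r i) := fun r i =>
    Measurable.const_mul (Finset.measurable_fun_sum _ fun t ht => measurable_const.sub
      (Measurable.const_mul ((hDm i).comp (hX t (Finset.mem_filter.1 ht).1)) 2)) _
  have hZm : ∀ r, Measurable (Z r) := fun r =>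
    Measurable.const_mul (measurable_const.min (Finset.measurable_fun_sum _ fun i _ =>
      Measurable.const_mul ((hSm r i).const_mul _).exp _)) _
  have hmin0 : ∀ r ω, 0 ≤ min 1 (∑ i, w i * Real.exp (θ * S r i ω)) := fun r ω =>
    le_min zero_le_one (Finset.sum_nonneg fun i _ => mul_nonneg (hw0 i) (Real.exp_pos _).le)
  have hZi : ∀ r, Integrable (Z r) P := fun r =>
    Integrable.of_bound (hZm r).aestronglyMeasurable M (ae_of_all _ fun ω => by
      rw [Real.norm_eq_abs, abs_of_nonneg (mul_nonneg hM0.le (hmin0 r ω))]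
      exact mul_le_of_le_one_right hM0.le (min_le_left _ _))
  have hZint : ∀ r < 2, ∫ ω, Z r ω ∂P ≤ M * (2 * b * (T + 1) + ∑ i, w i) := by
    intro r hr
    rw [integral_const_mul]
    exact mul_le_mul_of_nonneg_left
      (integral_min_one_sum_exp_block_le hT hX hDm hM0 hD0 hDM ha hb hβ hw0 hr) hM0.le
  have hSle : ∀ r i ω, S r i ω ≤ M := by
    intro r i ω
    have h1 : ∑ t ∈ (Finset.Icc 1 T).filter (fun t => t / a % 2 = r),
        (∫ ω', D i (X t ω') ∂P - 2 * D i (X t ω)) ≤ ∑ _t ∈ Finset.Icc 1 T, M := by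
      refine (Finset.sum_le_sum fun t ht => ?_).trans
        (Finset.sum_le_sum_of_subset_of_nonneg (Finset.filter_subset _ _) fun _ _ _ => hM0.le)
      have h2 : ∫ ω', D i (X t ω') ∂P ≤ M := by
        refine (integral_mono (hDi i t (Finset.mem_filter.1 ht).1) (integrable_const M)
          fun ω => hDM i _).trans (by simp)
      linarith [hD0 i (X t ω)]
    simp only [hS]
    rw [one_div, inv_mul_le_iff₀ hTr]
    simpa using h1
  have hSZ : ∀ r i ω, S r i ω - p i / θ ≤ Z r ω := by
    intro r i ω
    simp only [hZ]
    rw [mul_min_of_nonneg _ _ hM0.le, mul_one]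
    refine le_min ?_ ?_
    · have : 0 ≤ p i / θ := div_nonneg (hp i) hθ0.le
      linarith [hSle r i ω]
    · have h1 : w i * Real.exp (θ * S r i ω) ≤ ∑ j, w j * Real.exp (θ * S r j ω) :=
        Finset.single_le_sum (f := fun j => w j * Real.exp (θ * S r j ω))
          (fun j _ => mul_nonneg (hw0 j) (Real.exp_pos _).le) (Finset.mem_univ i)
      refine le_trans ?_ (mul_le_mul_of_nonneg_left h1 hM0.le)
      have h2 : M * (w i * Real.exp (θ * S r i ω)) = Real.exp (θ * S r i ω - p i) / θ := by
        rw [sub_eq_add_neg, Real.exp_add]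
        simp only [hw]
        field_simp
      rw [h2, le_div_iff₀ hθ0, sub_mul, div_mul_cancel₀ _ hθ0.ne']
      linarith [Real.add_one_le_exp (θ * S r i ω - p i)]
  refine ⟨fun ω => Z 0 ω + Z 1 ω, (hZi 0).add (hZi 1), ?_, fun i ω => ?_⟩
  · rw [integral_add (hZi 0) (hZi 1)]
    have h3 : M * ∑ i, w i = 8 * a * F ^ 2 / T * ∑ i, Real.exp (-p i) := by
      simp only [hw]
      rw [← Finset.sum_div, hθ, hM]
      field_simp
      ring
    have h4 := hZint 0 (by norm_num)
    have h5 := hZint 1 (by norm_num)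
    rw [mul_add, h3] at h4 h5
    have : 16 * (a : ℝ) * F ^ 2 / T = 2 * (8 * a * F ^ 2 / T) := by ring
    rw [this]
    rw [hM] at h4 h5
    linarith
  · have h1 := hSZ 0 i ω
    have h2 := hSZ 1 i ω
    have hθinv : p i / θ = 8 * a * F ^ 2 / T * p i := by
      rw [hθ, hM]; field_simp; ring
    rw [hθinv] at h1 h2
    have h3 : S 0 i ω + S 1 i ω = ∫ ω', sqDist T X f₀ (H i) ω' ∂P - 2 * sqDist T X f₀ (H i) ω := by
      simp only [hS, sqDist]
      rw [integral_const_mul, integral_finsetSum _ (hDi i), ← mul_add]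
      have h4 := Finset.sum_filter_add_sum_filter_not (Finset.Icc 1 T) (fun t => t / a % 2 = 0)
        (fun t => ∫ ω', D i (X t ω') ∂P - 2 * D i (X t ω))
      have h5 : (Finset.Icc 1 T).filter (fun t => ¬ t / a % 2 = 0)
          = (Finset.Icc 1 T).filter (fun t => t / a % 2 = 1) := by
        refine Finset.filter_congr fun t _ => by omega
      rw [h5] at h4
      rw [h4, Finset.sum_sub_distrib, ← Finset.mul_sum]
      simp only [hD]
      ring
    linarith

end Remainder

/-! ### The noise term -/

section Noise

variable {Ω : Type*} {mΩ : MeasurableSpace Ω} {P : Measure Ω} {𝒢 : Filtration ℕ mΩ} {d T : ℕ}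
  {m η : (Fin d → ℝ) → ℝ} {X : ℕ → Ω → Fin d → ℝ} {Y v : ℕ → Ω → ℝ} {Cη C₁ C₂ K : ℝ}

lemma measurableSet_cube (d : ℕ) : MeasurableSet (cube d) := measurableSet_Icc

namespace RegressionModel

lemma measurable_X (hm : RegressionModel P 𝒢 T m η X Y v Cη C₁ C₂ K) :
    ∀ t ∈ Finset.Icc 1 T, Measurable (X t) := fun t ht =>
  (hm.predictable t ht).mono (𝒢.le _) le_rfl

lemma measurable_v (hm : RegressionModel P 𝒢 T m η X Y v Cη C₁ C₂ K) :
    ∀ t ∈ Finset.Icc 1 T, Measurable (v t) := fun t ht =>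
  (hm.adapted t ht).mono (𝒢.le _) le_rfl

lemma measurable_Y (hm : RegressionModel P 𝒢 T m η X Y v Cη C₁ C₂ K) :
    ∀ t ∈ Finset.Icc 1 T, Measurable (Y t) := fun t ht => by
  have h : Y t = fun ω => m (X t ω) + η (X t ω) * v t ω := funext (hm.model t ht)
  rw [h]
  exact (hm.measurable_m.comp (hm.measurable_X t ht)).add
    ((hm.measurable_η.comp (hm.measurable_X t ht)).mul (hm.measurable_v t ht))

lemma integrable_v_sq [IsProbabilityMeasure P]
    (hm : RegressionModel P 𝒢 T m η X Y v Cη C₁ C₂ K) {t : ℕ} (ht : t ∈ Finset.Icc 1 T) :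
    Integrable (fun ω => v t ω ^ 2) P := by
  -- The conditional expectation of a nonintegrable function is 0 by convention, which contradicts
  -- the conditional variance 1.
  by_contra h
  have h1 := hm.variance_one t ht
  rw [condExp_of_not_integrable h] at h1
  obtain ⟨ω, hω⟩ := h1.exists
  simp at hω

lemma integral_v_sq [IsProbabilityMeasure P]
    (hm : RegressionModel P 𝒢 T m η X Y v Cη C₁ C₂ K) {t : ℕ} (ht : t ∈ Finset.Icc 1 T) :
    ∫ ω, v t ω ^ 2 ∂P = 1 := by
  rw [← integral_condExp (𝒢.le (t - 1)), integral_congr_ae (hm.variance_one t ht)]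
  simp

lemma abs_v_le (x : ℝ) : |x| ≤ (1 + x ^ 2) / 2 := by
  rw [← sq_abs]; nlinarith [sq_nonneg (|x| - 1)]

lemma integrable_v [IsProbabilityMeasure P]
    (hm : RegressionModel P 𝒢 T m η X Y v Cη C₁ C₂ K) {t : ℕ} (ht : t ∈ Finset.Icc 1 T) :
    Integrable (v t) P :=
  (((integrable_const 1).add (hm.integrable_v_sq ht)).div_const 2).mono'
    (hm.measurable_v t ht).aestronglyMeasurable (ae_of_all _ fun _ => abs_v_le _)

lemma integral_abs_v_le [IsProbabilityMeasure P]
    (hm : RegressionModel P 𝒢 T m η X Y v Cη C₁ C₂ K) {t : ℕ} (ht : t ∈ Finset.Icc 1 T) :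
    ∫ ω, |v t ω| ∂P ≤ 1 := by
  have hi := hm.integrable_v_sq ht
  calc ∫ ω, |v t ω| ∂P ≤ ∫ ω, (1 + v t ω ^ 2) / 2 ∂P :=
        integral_mono (hm.integrable_v ht).abs (((integrable_const 1).add hi).div_const 2)
          fun ω => abs_v_le _
    _ = 1 := by
      rw [integral_div, integral_add (integrable_const 1) hi, hm.integral_v_sq ht]; simp

lemma abs_indicator_η_le (hm : RegressionModel P 𝒢 T m η X Y v Cη C₁ C₂ K) {C : ℝ} (hC : 1 ≤ C)
    (hCη : Cη ≤ C) (x : Fin d → ℝ) : |(cube d).indicator η x| ≤ C := by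
  by_cases hx : x ∈ cube d
  · rw [Set.indicator_of_mem hx]; exact (hm.η_le x hx).trans hCη
  · rw [Set.indicator_of_notMem hx]; simpa using le_trans zero_le_one hC

lemma measurable_indicator_η (hm : RegressionModel P 𝒢 T m η X Y v Cη C₁ C₂ K) :
    Measurable ((cube d).indicator η) :=
  hm.measurable_η.indicator (measurableSet_cube d)

lemma measurable_noise (hm : RegressionModel P 𝒢 T m η X Y v Cη C₁ C₂ K)
    {f₀ h : (Fin d → ℝ) → ℝ} (hf₀ : Measurable f₀) (hh : Measurable h) :
    Measurable (noise T X v η f₀ h) :=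
  Measurable.const_mul (Finset.measurable_fun_sum _ fun t ht =>
    ((hm.measurable_indicator_η.comp (hm.measurable_X t ht)).mul (hm.measurable_v t ht)).mul
      ((hh.comp (hm.measurable_X t ht)).sub (hf₀.comp (hm.measurable_X t ht)))) _

/-- The noise term of a fixed function is integrable and centered. -/
lemma integral_noise [IsProbabilityMeasure P]
    (hm : RegressionModel P 𝒢 T m η X Y v Cη C₁ C₂ K) {f₀ h : (Fin d → ℝ) → ℝ}
    (hf₀ : Measurable f₀) (hh : Measurable h) {F : ℝ} (hf₀F : ∀ x, |f₀ x| ≤ F)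
    (hhF : ∀ x, |h x| ≤ F) :
    Integrable (noise T X v η f₀ h) P ∧ ∫ ω, noise T X v η f₀ h ω ∂P = 0 := by
  set C := max 1 Cη
  set g : (Fin d → ℝ) → ℝ := fun x => (cube d).indicator η x * (h x - f₀ x) with hg
  have hgm : Measurable g := hm.measurable_indicator_η.mul (hh.sub hf₀)
  have hgb : ∀ x, |g x| ≤ C * (F + F) := fun x => by
    rw [hg, abs_mul]
    exact mul_le_mul (hm.abs_indicator_η_le (le_max_left _ _) (le_max_right _ _) x)
      ((abs_sub _ _).trans (add_le_add (hhF x) (hf₀F x))) (abs_nonneg _)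
      (le_trans zero_le_one (le_max_left _ _))
  have heq : noise T X v η f₀ h
      = fun ω => (2 / (T : ℝ)) * ∑ t ∈ Finset.Icc 1 T, g (X t ω) * v t ω := by
    ext ω
    simp only [noise, hg]
    congr 1
    exact Finset.sum_congr rfl fun t _ => by ring
  have hi : ∀ t ∈ Finset.Icc 1 T, Integrable (fun ω => g (X t ω) * v t ω) P := fun t ht =>
    (hm.integrable_v ht).bdd_mul (hgm.comp (hm.measurable_X t ht)).aestronglyMeasurable
      (ae_of_all _ fun ω => hgb _)
  rw [heq]
  refine ⟨(integrable_finsetSum _ hi).const_mul _, ?_⟩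
  rw [integral_const_mul, integral_finsetSum _ hi, Finset.sum_eq_zero, mul_zero]
  intro t ht
  rw [integral_mul_condExp_eq (𝒢.le (t - 1)) (g := fun ω => g (X t ω))
    (hgm.comp (hm.predictable t ht)) (fun ω => hgb _) (hm.integrable_v ht)]
  refine (integral_congr_ae ?_).trans (integral_zero _ _)
  filter_upwards [hm.centered t ht] with ω hω
  simp [hω]

/-- Control of the noise term, uniformly over a finite weighted family. -/
lemma exists_noise_remainder [IsProbabilityMeasure P]
    (hm : RegressionModel P 𝒢 T m η X Y v Cη C₁ C₂ K) (hT : 0 < T) {I : Type*} [Fintype I]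
    {f₀ : (Fin d → ℝ) → ℝ} (hf₀ : Measurable f₀) {H : I → (Fin d → ℝ) → ℝ}
    (hH : ∀ i, Measurable (H i)) {F : ℝ} (hF : 1 ≤ F) (hf₀F : ∀ x, |f₀ x| ≤ F)
    (hHF : ∀ i x, |H i x| ≤ F) {C K' : ℝ} (hC : 1 ≤ C) (hCη : Cη ≤ C) (hK' : 1 ≤ K')
    (hKK' : K ≤ K') (p : I → ℝ) :
    ∃ Z : Ω → ℝ, Integrable Z P ∧
      ∫ ω, Z ω ∂P ≤ 8 * F ^ 2 * K' ^ 2 * C ^ 2 / T * ∑ i, Real.exp (-p i) ∧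
      ∀ i ω, noise T X v η f₀ (H i) ω ≤ 1 / 2 * sqDist T X f₀ (H i) ω
        + 8 * F ^ 2 * K' ^ 2 * C ^ 2 / T * p i + Z ω := by
  have hTr : (0 : ℝ) < T := by exact_mod_cast hT
  -- This scale keeps the predictable coefficients below 1/K' in absolute value and bounds the
  -- compensator ∑ K'²c_t² by θ/2 times the empirical squared distance.
  set θ : ℝ := T / (8 * F ^ 2 * K' ^ 2 * C ^ 2) with hθ
  have hθ0 : 0 < θ := by positivity
  have hθinv : 8 * F ^ 2 * K' ^ 2 * C ^ 2 / T = 1 / θ := by rw [hθ]; field_simp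
  set e : I → Ω → ℝ := fun i ω =>
    Real.exp (θ * noise T X v η f₀ (H i) ω - θ / 2 * sqDist T X f₀ (H i) ω) with he
  have hem : ∀ i, Measurable (e i) := fun i =>
    (((hm.measurable_noise hf₀ (hH i)).const_mul _).sub
      ((measurable_sqDist hm.measurable_X hf₀ (hH i)).const_mul _)).exp
  have hle : ∀ i, ∫⁻ ω, ENNReal.ofReal (e i ω) ∂P ≤ 1 := by
    intro i
    set c : ℕ → Ω → ℝ := fun t ω =>
      θ * (2 / T) * ((cube d).indicator η (X t ω) * (H i (X t ω) - f₀ (X t ω))) with hc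
    have hcm : ∀ t ∈ Finset.Icc 1 T, Measurable[𝒢 (t - 1)] (c t) := fun t ht =>
      ((hm.measurable_indicator_η.mul ((hH i).sub hf₀)).const_mul _).comp (hm.predictable t ht)
    have hθT : θ * (2 / T) = 1 / (4 * F ^ 2 * K' ^ 2 * C ^ 2) := by
      rw [hθ]; field_simp; norm_num
    have hcK : ∀ t ∈ Finset.Icc 1 T, ∀ ω, |c t ω| * K' ≤ 1 := by
      intro t _ ω
      have h1 : |(cube d).indicator η (X t ω) * (H i (X t ω) - f₀ (X t ω))| ≤ C * (F + F) := by
        rw [abs_mul]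
        exact mul_le_mul (hm.abs_indicator_η_le hC hCη _)
          ((abs_sub _ _).trans (add_le_add (hHF i _) (hf₀F _))) (abs_nonneg _) (by linarith)
      rw [hc, abs_mul, abs_of_pos (by positivity : 0 < θ * (2 / T)), hθT]
      have h2 : 1 ≤ F * K' * C := one_le_mul_of_one_le_of_one_le
        (one_le_mul_of_one_le_of_one_le hF hK') hC
      calc 1 / (4 * F ^ 2 * K' ^ 2 * C ^ 2) *
            |(cube d).indicator η (X t ω) * (H i (X t ω) - f₀ (X t ω))| * K'
          ≤ 1 / (4 * F ^ 2 * K' ^ 2 * C ^ 2) * (C * (F + F)) * K' := by gcongr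
        _ = 1 / (2 * (F * K' * C)) := by field_simp; ring
        _ ≤ 1 := by rw [div_le_one (by positivity)]; linarith
    have hsub : ∀ t ∈ Finset.Icc 1 T, ∃ Kt : ℝ, 0 < Kt ∧ Kt ≤ K' ∧
        Integrable (fun ω => Real.exp (v t ω ^ 2 / Kt ^ 2)) P ∧
        ∀ᵐ ω ∂P, (P[fun ω' => Real.exp (v t ω' ^ 2 / Kt ^ 2) | 𝒢 (t - 1)]) ω ≤ 2 := by
      intro t ht
      obtain ⟨Kt, h1, h2, h3⟩ := hm.subgaussian t ht
      exact ⟨Kt, h1, h2.trans hKK', h3⟩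
    refine le_trans (lintegral_mono fun ω => ENNReal.ofReal_le_ofReal (Real.exp_le_exp.2 ?_))
      (lintegral_exp_sum_le_one hm.adapted hm.centered hsub hcm hcK)
    rw [Finset.sum_sub_distrib, noise, sqDist]
    have h1 : θ * (2 / T * ∑ t ∈ Finset.Icc 1 T, (cube d).indicator η (X t ω) * v t ω *
        (H i (X t ω) - f₀ (X t ω))) = ∑ t ∈ Finset.Icc 1 T, c t ω * v t ω := by
      rw [← mul_assoc, Finset.mul_sum]
      exact Finset.sum_congr rfl fun t _ => by simp only [hc]; ring
    have h2 : ∑ t ∈ Finset.Icc 1 T, K' ^ 2 * c t ω ^ 2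
        ≤ θ / 2 * (1 / T * ∑ t ∈ Finset.Icc 1 T, (H i (X t ω) - f₀ (X t ω)) ^ 2) := by
      rw [← mul_assoc, Finset.mul_sum]
      refine Finset.sum_le_sum fun t _ => ?_
      have h3 : (cube d).indicator η (X t ω) ^ 2 ≤ C ^ 2 := by
        rw [← sq_abs]
        exact pow_le_pow_left₀ (abs_nonneg _) (hm.abs_indicator_η_le hC hCη _) 2
      have h4 : K' ^ 2 * c t ω ^ 2 = θ / T * (1 / (2 * F ^ 2 * C ^ 2)) *
          ((cube d).indicator η (X t ω) ^ 2 * (H i (X t ω) - f₀ (X t ω)) ^ 2) := by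
        have : c t ω ^ 2 = (θ * (2 / T)) * (θ * (2 / T)) *
            ((cube d).indicator η (X t ω) ^ 2 * (H i (X t ω) - f₀ (X t ω)) ^ 2) := by
          simp only [hc]; ring
        rw [this]
        nth_rewrite 1 [hθT]
        field_simp
        ring
      rw [h4]
      calc _ ≤ θ / T * (1 / (2 * F ^ 2 * C ^ 2)) * (C ^ 2 * (H i (X t ω) - f₀ (X t ω)) ^ 2) := by
            gcongr
        _ = (1 / F ^ 2) * (θ / 2 * (1 / T) * (H i (X t ω) - f₀ (X t ω)) ^ 2) := by
            field_simp
        _ ≤ _ := by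
            refine mul_le_of_le_one_left (by positivity) ?_
            rw [div_le_one (by positivity)]
            exact one_le_pow₀ hF
    rw [h1]
    linarith
  have hei : ∀ i, Integrable (e i) P := fun i =>
    ⟨(hem i).aestronglyMeasurable, by
      rw [hasFiniteIntegral_iff_ofReal (ae_of_all _ fun ω => (Real.exp_pos _).le)]
      exact (hle i).trans_lt ENNReal.one_lt_top⟩
  have h_int : ∀ i, ∫ ω, e i ω ∂P ≤ 1 := fun i => by
    rw [integral_eq_lintegral_of_nonneg_ae (ae_of_all _ fun ω => (Real.exp_pos _).le)
      (hem i).aestronglyMeasurable]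
    exact ENNReal.toReal_le_of_le_ofReal zero_le_one (by simpa using hle i)
  refine ⟨fun ω => (1 / θ) * ∑ i, Real.exp (-p i) * e i ω,
    (integrable_finsetSum _ fun i _ => (hei i).const_mul _).const_mul _, ?_, fun i ω => ?_⟩
  · rw [integral_const_mul, integral_finsetSum _ fun i _ => (hei i).const_mul _, hθinv]
    refine mul_le_mul_of_nonneg_left (Finset.sum_le_sum fun i _ => ?_) (by positivity)
    rw [integral_const_mul]
    exact mul_le_of_le_one_right (Real.exp_pos _).le (h_int i)
  · have h1 : Real.exp (-p i) * e i ω ≤ ∑ j, Real.exp (-p j) * e j ω :=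
      Finset.single_le_sum (f := fun j => Real.exp (-p j) * e j ω)
        (fun j _ => mul_nonneg (Real.exp_pos _).le (Real.exp_pos _).le) (Finset.mem_univ i)
    have h2 := mul_le_mul_of_nonneg_left h1 (by positivity : 0 ≤ 1 / θ)
    have h3 : -p i + (θ * noise T X v η f₀ (H i) ω - θ / 2 * sqDist T X f₀ (H i) ω)
        ≤ Real.exp (-p i) * e i ω := by
      simp only [he]
      rw [← Real.exp_add]
      linarith [Real.add_one_le_exp
        (-p i + (θ * noise T X v η f₀ (H i) ω - θ / 2 * sqDist T X f₀ (H i) ω))]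
    have h4 := (mul_le_mul_of_nonneg_left h3 (by positivity : 0 ≤ 1 / θ)).trans h2
    rw [hθinv]
    have h5 : 1 / θ * (-p i + (θ * noise T X v η f₀ (H i) ω - θ / 2 * sqDist T X f₀ (H i) ω))
        = noise T X v η f₀ (H i) ω - 1 / 2 * sqDist T X f₀ (H i) ω - 1 / θ * p i := by
      field_simp; ring
    rw [h5] at h4
    linarith

end RegressionModel

end Noise

/-! ### The oracle inequality for a network class with a finite net -/

section Oracle

variable {Ω : Type*} {mΩ : MeasurableSpace Ω} {P : Measure Ω} {𝒢 : Filtration ℕ mΩ} {d T : ℕ}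
  {m η : (Fin d → ℝ) → ℝ} {X : ℕ → Ω → Fin d → ℝ} {Y v : ℕ → Ω → ℝ} {Cη C₁ C₂ K : ℝ}
  {σ : ℝ → ℝ} {L N B F lam τ : ℝ}

lemma measurable_fn (hσ : Continuous σ) (f : DNN d) : Measurable (f.fn σ) :=
  (continuous_eval hσ f).measurable.indicator (measurableSet_cube d)

lemma abs_indicator_le {h : (Fin d → ℝ) → ℝ} (hF : 0 ≤ F) (hh : ∀ x ∈ cube d, |h x| ≤ F)
    (x : Fin d → ℝ) : |(cube d).indicator h x| ≤ F := by
  by_cases hx : x ∈ cube d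
  · rw [Set.indicator_of_mem hx]; exact hh x hx
  · rw [Set.indicator_of_notMem hx]; simpa using hF

lemma abs_fn_le (hF : 0 ≤ F) {f : DNN d} (hf : f ∈ dnnClass σ d L N B F) (x : Fin d → ℝ) :
    |f.fn σ x| ≤ F :=
  abs_indicator_le hF hf.2.2.2.2 x

lemma penalty_nonneg (hlam : 0 ≤ lam) (hτ : 0 < τ) (f : DNN d) : 0 ≤ penalty lam τ f :=
  mul_nonneg hlam (clipNorm_nonneg hτ _)

/-- Each parameter costs at most `lam`, and depth and width bound their number. This uniform bound
enters the integrability of the optimization gap. -/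
lemma exists_penalty_le (hlam : 0 ≤ lam) (σ : ℝ → ℝ) (d : ℕ) (L N B F τ : ℝ) :
    ∃ J : ℝ, ∀ f ∈ dnnClass σ d L N B F, penalty lam τ f ≤ J := by
  refine ⟨lam * ((⌊N⌋₊ + 1) * (d + 1) + ⌊L⌋₊ * (⌊N⌋₊ + 1) ^ 2 : ℕ), fun f hf => ?_⟩
  refine mul_le_mul_of_nonneg_left ((clipNorm_le_length _).trans ?_) hlam
  exact_mod_cast length_params_le_of_le f (Nat.le_floor hf.2.1) (Nat.le_floor hf.2.2.1)

lemma penRisk_nonneg (hlam : 0 ≤ lam) (hτ : 0 < τ) (ω : Ω) (f : DNN d) :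
    0 ≤ penRisk T X Y σ lam τ ω f :=
  add_nonneg (mul_nonneg (by positivity) (Finset.sum_nonneg fun _ _ => sq_nonneg _))
    (penalty_nonneg hlam hτ f)

/-- The basic identity for differences of penalized empirical risks. -/
lemma RegressionModel.penRisk_sub (hm : RegressionModel P 𝒢 T m η X Y v Cη C₁ C₂ K)
    (ω : Ω) (f f' : DNN d) :
    penRisk T X Y σ lam τ ω f - penRisk T X Y σ lam τ ω f' =
      sqDist T X ((cube d).indicator m) (f.fn σ) ω - sqDist T X ((cube d).indicator m) (f'.fn σ) ω
      - noise T X v η ((cube d).indicator m) (f.fn σ) ω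
      + noise T X v η ((cube d).indicator m) (f'.fn σ) ω
      + penalty lam τ f - penalty lam τ f' := by
  have key : ∀ t ∈ Finset.Icc 1 T, (Y t ω - f.fn σ (X t ω)) ^ 2 - (Y t ω - f'.fn σ (X t ω)) ^ 2
      = (f.fn σ (X t ω) - (cube d).indicator m (X t ω)) ^ 2
        - (f'.fn σ (X t ω) - (cube d).indicator m (X t ω)) ^ 2
        - 2 * ((cube d).indicator η (X t ω) * v t ω *
          (f.fn σ (X t ω) - (cube d).indicator m (X t ω)))
        + 2 * ((cube d).indicator η (X t ω) * v t ω *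
          (f'.fn σ (X t ω) - (cube d).indicator m (X t ω))) := by
    intro t ht
    by_cases hx : X t ω ∈ cube d
    · rw [hm.model t ht ω, Set.indicator_of_mem hx, Set.indicator_of_mem hx]
      ring
    -- Off the cube both networks vanish and the responses cancel; no bound on `m` or `η` is needed
    -- there.
    · simp only [DNN.fn, Set.indicator_of_notMem hx]
      ring
  have hsum := Finset.sum_congr rfl key
  simp only [Finset.sum_add_distrib, Finset.sum_sub_distrib, ← Finset.mul_sum] at hsum
  simp only [penRisk, sqDist, noise]
  linear_combination (1 / (T : ℝ)) * hsum

/-- The family is uncountable, but an infimum of continuous functions is upper semicontinuous. To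
have continuity, the indicator of the cube at each X_t is treated as an additional coordinate of the
data. -/
lemma measurable_iInf_penRisk (hσ : Continuous σ)
    (hX : ∀ t ∈ Finset.Icc 1 T, Measurable (X t)) (hY : ∀ t ∈ Finset.Icc 1 T, Measurable (Y t))
    (hlam : 0 ≤ lam) (hτ : 0 < τ) (𝓕 : Set (DNN d)) :
    Measurable fun ω => ⨅ f : 𝓕, penRisk T X Y σ lam τ ω f := by
  classical
  rcases isEmpty_or_nonempty 𝓕 with h𝓕 | h𝓕
  · simp only [Real.iInf_of_isEmpty]; exact measurable_const
  let S := Finset.Icc 1 T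
  let Φ : 𝓕 → ((S → Fin d → ℝ) × (S → ℝ) × (S → ℝ)) → ℝ := fun f z =>
    (1 / (T : ℝ)) * ∑ t : S, (z.2.2 t - z.2.1 t * (f : DNN d).eval σ (z.1 t)) ^ 2
      + penalty lam τ (f : DNN d)
  have hΦ : ∀ f, Continuous (Φ f) := fun f => by
    have := continuous_eval hσ (f : DNN d)
    fun_prop
  have hΦ0 : ∀ f z, 0 ≤ Φ f z := fun f z =>
    add_nonneg (mul_nonneg (by positivity) (Finset.sum_nonneg fun _ _ => sq_nonneg _))
      (penalty_nonneg hlam hτ _)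
  have husc : UpperSemicontinuous fun z => ⨅ f, Φ f z :=
    upperSemicontinuous_ciInf (fun z => ⟨0, by rintro _ ⟨f, rfl⟩; exact hΦ0 f z⟩)
      fun f => (hΦ f).upperSemicontinuous
  let D : Ω → (S → Fin d → ℝ) × (S → ℝ) × (S → ℝ) := fun ω =>
    (fun t => X t ω, fun t => (cube d).indicator 1 (X t ω), fun t => Y t ω)
  have hD : Measurable D := by
    refine Measurable.prodMk (measurable_pi_iff.2 fun t => hX t t.2)
      (Measurable.prodMk (measurable_pi_iff.2 fun t => ?_) (measurable_pi_iff.2 fun t => hY t t.2))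
    exact (measurable_one.indicator (measurableSet_cube d)).comp (hX t t.2)
  have heq : (fun ω => ⨅ f : 𝓕, penRisk T X Y σ lam τ ω f) = (fun z => ⨅ f, Φ f z) ∘ D := by
    ext ω
    simp only [Function.comp_apply]
    congr 1
    ext f
    simp only [penRisk, Φ, D]
    congr 2
    rw [← Finset.sum_coe_sort]
    refine Finset.sum_congr rfl fun t _ => ?_
    by_cases hx : X t ω ∈ cube d <;> simp [DNN.fn, hx]
  rw [heq]
  exact husc.measurable.comp hD

variable {fhat : Ω → DNN d}

lemma IsEstimator.measurable_uncurry
    (hm : RegressionModel P 𝒢 T m η X Y v Cη C₁ C₂ K)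
    (he : IsEstimator T X Y σ lam τ (dnnClass σ d L N B F) fhat) :
    Measurable fun q : Ω × (Fin d → ℝ) => (fhat q.1).fn σ q.2 := by
  refine he.measurable_fn.mono ?_ le_rfl
  refine sup_le_sup (MeasurableSpace.comap_mono (sup_le ?_ ?_)) le_rfl
  · exact iSup₂_le fun t ht => measurable_iff_comap_le.1 (hm.measurable_Y t ht)
  · exact iSup₂_le fun t ht => measurable_iff_comap_le.1 (hm.measurable_X t ht)

/-- The optimization gap at an outcome. -/
def gap (T : ℕ) (X : ℕ → Ω → Fin d → ℝ) (Y : ℕ → Ω → ℝ) (σ : ℝ → ℝ) (lam τ : ℝ)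
    (𝓕 : Set (DNN d)) (fhat : Ω → DNN d) (ω : Ω) : ℝ :=
  penRisk T X Y σ lam τ ω (fhat ω) - ⨅ f : 𝓕, penRisk T X Y σ lam τ ω f

lemma penRisk_sub_le_gap (hlam : 0 ≤ lam) (hτ : 0 < τ) {𝓕 : Set (DNN d)} {f : DNN d}
    (hf : f ∈ 𝓕) (ω : Ω) :
    penRisk T X Y σ lam τ ω (fhat ω) - penRisk T X Y σ lam τ ω f
      ≤ gap T X Y σ lam τ 𝓕 fhat ω := by
  have hbdd : BddBelow (Set.range fun f : 𝓕 => penRisk T X Y σ lam τ ω f) :=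
    ⟨0, by rintro _ ⟨f, rfl⟩; exact penRisk_nonneg hlam hτ ω _⟩
  have := ciInf_le hbdd ⟨f, hf⟩
  simp only [gap]
  linarith

lemma gap_nonneg (hlam : 0 ≤ lam) (hτ : 0 < τ) {𝓕 : Set (DNN d)} (hmem : ∀ ω, fhat ω ∈ 𝓕)
    (ω : Ω) : 0 ≤ gap T X Y σ lam τ 𝓕 fhat ω := by
  have := penRisk_sub_le_gap (T := T) (X := X) (Y := Y) (σ := σ) (fhat := fhat) hlam hτ (hmem ω) ω
  linarith

/-- The mean absolute noise. -/
def meanAbs (T : ℕ) (v : ℕ → Ω → ℝ) (ω : Ω) : ℝ := (1 / (T : ℝ)) * ∑ t ∈ Finset.Icc 1 T, |v t ω|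

lemma RegressionModel.integrable_meanAbs [IsProbabilityMeasure P]
    (hm : RegressionModel P 𝒢 T m η X Y v Cη C₁ C₂ K) : Integrable (meanAbs T v) P :=
  (integrable_finsetSum _ fun _ ht => (hm.integrable_v ht).abs).const_mul _

lemma RegressionModel.integral_meanAbs_le [IsProbabilityMeasure P] (hT : 0 < T)
    (hm : RegressionModel P 𝒢 T m η X Y v Cη C₁ C₂ K) : ∫ ω, meanAbs T v ω ∂P ≤ 1 := by
  simp only [meanAbs]
  rw [integral_const_mul, integral_finsetSum _ fun t ht => (hm.integrable_v ht).abs]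
  exact mean_le hT fun t ht => hm.integral_abs_v_le ht

lemma RegressionModel.noise_sub_le (hm : RegressionModel P 𝒢 T m η X Y v Cη C₁ C₂ K) {C : ℝ}
    (hC : 1 ≤ C) (hCη : Cη ≤ C) {f₀ h h' : (Fin d → ℝ) → ℝ} {δ : ℝ}
    (hδ : ∀ x, |h x - h' x| ≤ δ) (ω : Ω) :
    |noise T X v η f₀ h ω - noise T X v η f₀ h' ω| ≤ 2 * C * δ * meanAbs T v ω := by
  have hδ0 : 0 ≤ δ := (abs_nonneg _).trans (hδ 0)
  have h1 : noise T X v η f₀ h ω - noise T X v η f₀ h' ω = (2 / (T : ℝ)) *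
      ∑ t ∈ Finset.Icc 1 T, (cube d).indicator η (X t ω) * v t ω * (h (X t ω) - h' (X t ω)) := by
    simp only [noise]
    rw [← mul_sub, ← Finset.sum_sub_distrib]
    congr 1
    exact Finset.sum_congr rfl fun t _ => by ring
  rw [h1, abs_mul, abs_of_nonneg (by positivity)]
  have h2 : |∑ t ∈ Finset.Icc 1 T, (cube d).indicator η (X t ω) * v t ω *
      (h (X t ω) - h' (X t ω))| ≤ ∑ t ∈ Finset.Icc 1 T, C * |v t ω| * δ := by
    refine (Finset.abs_sum_le_sum_abs _ _).trans (Finset.sum_le_sum fun t _ => ?_)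
    rw [abs_mul, abs_mul]
    have := hm.abs_indicator_η_le hC hCη (X t ω)
    gcongr
    exact hδ _
  refine (mul_le_mul_of_nonneg_left h2 (by positivity)).trans (le_of_eq ?_)
  rw [← Finset.sum_mul, ← Finset.mul_sum, meanAbs]
  ring

lemma RegressionModel.abs_noise_le (hm : RegressionModel P 𝒢 T m η X Y v Cη C₁ C₂ K) {C : ℝ}
    (hC : 1 ≤ C) (hCη : Cη ≤ C) {f₀ h : (Fin d → ℝ) → ℝ} (hf₀ : ∀ x, |f₀ x| ≤ F)
    (hh : ∀ x, |h x| ≤ F) (ω : Ω) :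
    |noise T X v η f₀ h ω| ≤ 4 * C * F * meanAbs T v ω := by
  have h1 : noise T X v η f₀ f₀ ω = 0 := by simp [noise]
  have h2 := hm.noise_sub_le hC hCη (f₀ := f₀) (h := h) (h' := f₀) (δ := F + F)
    (fun x => (abs_sub _ _).trans (add_le_add (hh x) (hf₀ x))) ω
  rw [h1, sub_zero] at h2
  linarith

lemma RegressionModel.integrable_gap [IsProbabilityMeasure P] (hT : 0 < T)
    (hm : RegressionModel P 𝒢 T m η X Y v Cη C₁ C₂ K) (hσ : Continuous σ) (hF : 1 ≤ F)
    (hmF : ∀ x ∈ cube d, |m x| ≤ F) (hlam : 0 ≤ lam) (hτ : 0 < τ)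
    (he : IsEstimator T X Y σ lam τ (dnnClass σ d L N B F) fhat) :
    Integrable (gap T X Y σ lam τ (dnnClass σ d L N B F) fhat) P := by
  set C := max 1 Cη with hCdef
  have hC : 1 ≤ C := le_max_left _ _
  have hCη : Cη ≤ C := le_max_right _ _
  have hF0 : 0 ≤ F := by linarith
  obtain ⟨J, hJ⟩ := exists_penalty_le hlam σ d L N B F τ
  have hmeas : Measurable (gap T X Y σ lam τ (dnnClass σ d L N B F) fhat) := by
    refine Measurable.sub (Measurable.add (Measurable.const_mul
      (Finset.measurable_fun_sum _ fun t ht => ?_) _) he.measurable_penalty)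
      (measurable_iInf_penRisk hσ hm.measurable_X hm.measurable_Y hlam hτ _)
    refine ((hm.measurable_Y t ht).sub ?_).pow_const 2
    exact (he.measurable_uncurry hm).comp (measurable_id.prodMk (hm.measurable_X t ht))
  refine Integrable.mono' (g := fun ω => 4 * F ^ 2 + 8 * C * F * meanAbs T v ω + J)
    (((integrable_const _).add (hm.integrable_meanAbs.const_mul _)).add (integrable_const _))
    hmeas.aestronglyMeasurable (ae_of_all _ fun ω => ?_)
  rw [Real.norm_eq_abs, abs_of_nonneg (gap_nonneg hlam hτ he.mem ω)]
  have : Nonempty (dnnClass σ d L N B F) := ⟨⟨fhat ω, he.mem ω⟩⟩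
  have hf₀ := abs_indicator_le hF0 hmF
  -- The responses are uncontrolled off the cube, so a single risk need not be integrable.
  -- Differences of risks are bounded by the mean absolute noise plus a constant, uniformly in the
  -- competitor.
  suffices h : penRisk T X Y σ lam τ ω (fhat ω)
      - (4 * F ^ 2 + 8 * C * F * meanAbs T v ω + J)
      ≤ ⨅ f : dnnClass σ d L N B F, penRisk T X Y σ lam τ ω f by
    simp only [gap]; linarith
  refine le_ciInf fun f => ?_
  have h1 := hm.penRisk_sub (σ := σ) (lam := lam) (τ := τ) ω (fhat ω) f
  have h2 := (abs_le.1 (hm.abs_noise_le hC hCη hf₀ (abs_fn_le hF0 (he.mem ω)) ω)).1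
  have h3 := (abs_le.1 (hm.abs_noise_le hC hCη hf₀ (abs_fn_le hF0 f.2) ω)).2
  have h4 := sqDist_le (X := X) hT hf₀ (abs_fn_le hF0 (he.mem ω)) ω
  have h5 := sqDist_nonneg (T := T) (X := X) (f₀ := (cube d).indicator m)
    (h := (f : DNN d).fn σ) ω
  have h6 := hJ _ (he.mem ω)
  have h7 := penalty_nonneg (τ := τ) hlam hτ (f : DNN d)
  linarith

lemma risk_const [IsProbabilityMeasure P] (h f₀ : (Fin d → ℝ) → ℝ) :
    risk P T X (fun _ => h) f₀ = ∫ ω, sqDist T X f₀ h ω ∂P := by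
  have := integral_fun_snd (μ := P) (ν := P) (sqDist T X f₀ h)
  simpa [risk, sqDist] using this

lemma RegressionModel.risk_eq [IsProbabilityMeasure P] (hT : 0 < T)
    (hm : RegressionModel P 𝒢 T m η X Y v Cη C₁ C₂ K) (hF : 1 ≤ F)
    (hmF : ∀ x ∈ cube d, |m x| ≤ F)
    (he : IsEstimator T X Y σ lam τ (dnnClass σ d L N B F) fhat) :
    Integrable (fun ω => ∫ ω', sqDist T X ((cube d).indicator m) ((fhat ω).fn σ) ω' ∂P) P ∧
    risk P T X (fun ω => (fhat ω).fn σ) ((cube d).indicator m)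
      = ∫ ω, ∫ ω', sqDist T X ((cube d).indicator m) ((fhat ω).fn σ) ω' ∂P ∂P := by
  have hF0 : 0 ≤ F := by linarith
  have hf₀ := abs_indicator_le hF0 hmF
  have hm₀ : Measurable ((cube d).indicator m) := hm.measurable_m.indicator (measurableSet_cube d)
  have hmeas : Measurable fun q : Ω × Ω =>
      sqDist T X ((cube d).indicator m) ((fhat q.1).fn σ) q.2 := by
    refine Measurable.const_mul (Finset.measurable_fun_sum _ fun t ht => ?_) _
    have hXt := hm.measurable_X t ht
    refine Measurable.pow_const (Measurable.sub ?_ (hm₀.comp (hXt.comp measurable_snd))) 2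
    exact (he.measurable_uncurry hm).comp
      (measurable_fst.prodMk (hXt.comp measurable_snd))
  have h_int : Integrable (fun q : Ω × Ω =>
      sqDist T X ((cube d).indicator m) ((fhat q.1).fn σ) q.2) (P.prod P) :=
    Integrable.of_bound hmeas.aestronglyMeasurable (4 * F ^ 2) (ae_of_all _ fun q => by
      rw [Real.norm_eq_abs, abs_of_nonneg (sqDist_nonneg _)]
      exact sqDist_le hT hf₀ (abs_fn_le hF0 (he.mem _)) _)
  exact ⟨h_int.integral_prod_left, integral_prod _ h_int⟩

lemma sqDist_sub_le (hT : 0 < T) {f₀ h h' : (Fin d → ℝ) → ℝ} {δ : ℝ}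
    (hf₀ : ∀ x, |f₀ x| ≤ F) (hh : ∀ x, |h x| ≤ F) (hh' : ∀ x, |h' x| ≤ F)
    (hδ : ∀ x, |h x - h' x| ≤ δ) (ω : Ω) :
    sqDist T X f₀ h ω ≤ sqDist T X f₀ h' ω + 4 * F * δ := by
  have h1 : sqDist T X f₀ h ω - sqDist T X f₀ h' ω ≤ 4 * F * δ := by
    simp only [sqDist]
    rw [← mul_sub, ← Finset.sum_sub_distrib]
    refine mean_le hT fun t _ => ?_
    set x := X t ω
    have h2 : (h x - f₀ x) ^ 2 - (h' x - f₀ x) ^ 2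
        = (h x - h' x) * (h x - f₀ x + (h' x - f₀ x)) := by ring
    rw [h2]
    refine (le_abs_self _).trans ?_
    rw [abs_mul]
    have h3 : |h x - f₀ x + (h' x - f₀ x)| ≤ 4 * F := by
      have := abs_le.1 (hf₀ x)
      have := abs_le.1 (hh x)
      have := abs_le.1 (hh' x)
      exact abs_le.2 ⟨by linarith, by linarith⟩
    calc |h x - h' x| * |h x - f₀ x + (h' x - f₀ x)| ≤ δ * (4 * F) :=
          mul_le_mul (hδ x) h3 (abs_nonneg _) ((abs_nonneg _).trans (hδ x))
      _ = _ := by ring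
  linarith

/-- The oracle inequality in terms of a finite weighted net of the network class. -/
lemma RegressionModel.risk_le [IsProbabilityMeasure P] (hT : 0 < T)
    (hm : RegressionModel P 𝒢 T m η X Y v Cη C₁ C₂ K) (hσ : Continuous σ) (hF : 1 ≤ F)
    (hmF : ∀ x ∈ cube d, |m x| ≤ F) (hlam : 0 ≤ lam) (hτ : 0 < τ)
    (he : IsEstimator T X Y σ lam τ (dnnClass σ d L N B F) fhat)
    {C K' : ℝ} (hC : 1 ≤ C) (hCη : Cη ≤ C) (hK' : 1 ≤ K') (hKK' : K ≤ K')
    {a : ℕ} (ha : 0 < a) {b : ℝ} (hb : 0 ≤ b) (hβ : betaMixing P T X a ≤ ENNReal.ofReal b)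
    {I : Type*} [Fintype I] {G : I → (Fin d → ℝ) → ℝ} {p : I → ℝ} {δ : ℝ} (hδ0 : 0 ≤ δ)
    (hG : ∀ i, Measurable (G i)) (hGF : ∀ i x, |G i x| ≤ F) (hp : ∀ i, 0 ≤ p i)
    (hsum : ∑ i, Real.exp (-p i) ≤ 4)
    (hnet : ∀ f ∈ dnnClass σ d L N B F, ∃ i, (∀ x ∈ cube d, |f.eval σ x - G i x| ≤ δ) ∧
      (4 * (a * F ^ 2 / T) + 8 * (F ^ 2 * K' ^ 2 * C ^ 2 / T)) * p i ≤ penalty lam τ f)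
    {f : DNN d} (hf : f ∈ dnnClass σ d L N B F) :
    risk P T X (fun ω => (fhat ω).fn σ) ((cube d).indicator m) ≤
      4 * (optGap P T X Y σ lam τ (dnnClass σ d L N B F) fhat +
        (risk P T X (fun _ => f.fn σ) ((cube d).indicator m) + penalty lam τ f)) +
      (16 * F ^ 2 * b * (T + 1) + 64 * (a * F ^ 2 / T) + 128 * (F ^ 2 * K' ^ 2 * C ^ 2 / T)
        + 20 * F * δ + 8 * C * δ) := by
  have hF0 : 0 ≤ F := by linarith
  have hf₀ := abs_indicator_le hF0 hmF
  set f₀ := (cube d).indicator m with hf₀def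
  have hf₀m : Measurable f₀ := hm.measurable_m.indicator (measurableSet_cube d)
  set H : I → (Fin d → ℝ) → ℝ := fun i => (cube d).indicator (G i) with hHdef
  have hHm : ∀ i, Measurable (H i) := fun i => (hG i).indicator (measurableSet_cube d)
  have hHF : ∀ i x, |H i x| ≤ F := fun i => abs_indicator_le hF0 fun x _ => hGF i x
  obtain ⟨Z₁, hZ₁i, hZ₁, hZ₁le⟩ := exists_mixing_remainder (P := P) hT hm.measurable_X hf₀m hHm hF
    hf₀ hHF ha hb hβ hp
  obtain ⟨Z₂, hZ₂i, hZ₂, hZ₂le⟩ := hm.exists_noise_remainder hT hf₀m hHm hF hf₀ hHF hC hCη hK'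
    hKK' p
  have hfm := measurable_fn hσ f
  have hfF := abs_fn_le hF0 hf
  obtain ⟨hni, hn0⟩ := hm.integral_noise hf₀m hfm hf₀ hfF
  have hsi := integrable_sqDist (P := P) hT hm.measurable_X hf₀m hfm hf₀ hfF
  have hgi := hm.integrable_gap hT hσ hF hmF hlam hτ he
  have hvi := hm.integrable_meanAbs
  obtain ⟨hri, hreq⟩ := hm.risk_eq hT hF hmF he
  -- Four times the basic inequality. The noise of f̂ takes up half of the empirical distance,
  -- leaving the factor 2 that the mixing comparison requires; 4J(f̂) cancels the weights of both
  -- remainders. The term 20Fδ collects 4Fδ, 8Fδ and 8Fδ from the three passages between f̂ and the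
  -- net.
  have hpath : ∀ ω, ∫ ω', sqDist T X f₀ ((fhat ω).fn σ) ω' ∂P ≤
      4 * (sqDist T X f₀ (f.fn σ) ω + gap T X Y σ lam τ (dnnClass σ d L N B F) fhat ω
        - noise T X v η f₀ (f.fn σ) ω) + (Z₁ ω + 4 * Z₂ ω)
        + (8 * C * δ * meanAbs T v ω + (4 * penalty lam τ f + 20 * F * δ)) := by
    intro ω
    obtain ⟨i, hiδ, hip⟩ := hnet (fhat ω) (he.mem ω)
    have hfh := abs_fn_le hF0 (he.mem ω)
    have hfhm := measurable_fn hσ (fhat ω)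
    have hd : ∀ x, |(fhat ω).fn σ x - H i x| ≤ δ := by
      intro x
      by_cases hx : x ∈ cube d
      · simp only [DNN.fn, hHdef, Set.indicator_of_mem hx]; exact hiδ x hx
      · simp only [DNN.fn, hHdef, Set.indicator_of_notMem hx]; simpa using hδ0
    have h1 : ∫ ω', sqDist T X f₀ ((fhat ω).fn σ) ω' ∂P
        ≤ ∫ ω', sqDist T X f₀ (H i) ω' ∂P + 4 * F * δ := by
      have hi := integrable_sqDist (P := P) hT hm.measurable_X hf₀m (hHm i) hf₀ (hHF i)
      refine (integral_mono (integrable_sqDist hT hm.measurable_X hf₀m hfhm hf₀ hfh)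
        (hi.add (integrable_const (4 * F * δ)))
        fun ω' => sqDist_sub_le hT hf₀ hfh (hHF i) hd ω').trans (le_of_eq ?_)
      refine (integral_add hi (integrable_const _)).trans ?_
      simp
    have h2 := hZ₁le i ω
    have h3 : sqDist T X f₀ (H i) ω ≤ sqDist T X f₀ ((fhat ω).fn σ) ω + 4 * F * δ :=
      sqDist_sub_le hT hf₀ (hHF i) hfh (fun x => by rw [abs_sub_comm]; exact hd x) ω
    have h4 := penRisk_sub_le_gap (T := T) (X := X) (Y := Y) (σ := σ) (fhat := fhat) hlam hτ hf ω
    rw [hm.penRisk_sub] at h4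
    have h5 := (abs_le.1 (hm.noise_sub_le hC hCη (f₀ := f₀) hd ω)).2
    have h6 := hZ₂le i ω
    have h7 : 2 * (8 * a * F ^ 2 / T) * p i + 4 * (8 * F ^ 2 * K' ^ 2 * C ^ 2 / T * p i)
        = 4 * ((4 * (a * F ^ 2 / T) + 8 * (F ^ 2 * K' ^ 2 * C ^ 2 / T)) * p i) := by ring
    linarith
  have hbound := integral_mono hri
    ((((hsi.add hgi).sub hni).const_mul 4).add (hZ₁i.add (hZ₂i.const_mul 4)) |>.add
      ((hvi.const_mul (8 * C * δ)).add (integrable_const (4 * penalty lam τ f + 20 * F * δ))))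
    hpath
  have hcalc : ∫ ω, (4 * (sqDist T X f₀ (f.fn σ) ω
        + gap T X Y σ lam τ (dnnClass σ d L N B F) fhat ω
        - noise T X v η f₀ (f.fn σ) ω) + (Z₁ ω + 4 * Z₂ ω)
        + (8 * C * δ * meanAbs T v ω + (4 * penalty lam τ f + 20 * F * δ))) ∂P
      = 4 * (∫ ω, sqDist T X f₀ (f.fn σ) ω ∂P
        + ∫ ω, gap T X Y σ lam τ (dnnClass σ d L N B F) fhat ω ∂P) + (∫ ω, Z₁ ω ∂P
        + 4 * ∫ ω, Z₂ ω ∂P) + (8 * C * δ * ∫ ω, meanAbs T v ω ∂P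
        + (4 * penalty lam τ f + 20 * F * δ)) := by
    refine (integral_add ((((hsi.add hgi).sub hni).const_mul 4).add
      (hZ₁i.add (hZ₂i.const_mul 4))) ((hvi.const_mul (8 * C * δ)).add
        (integrable_const (4 * penalty lam τ f + 20 * F * δ)))).trans ?_
    congr 1
    · refine (integral_add (((hsi.add hgi).sub hni).const_mul 4)
        (hZ₁i.add (hZ₂i.const_mul 4))).trans ?_
      congr 1
      · refine (integral_const_mul 4 _).trans ?_
        congr 1
        refine (integral_sub (hsi.add hgi) hni).trans ?_
        rw [hn0, sub_zero]
        exact integral_add hsi hgi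
      · refine (integral_add hZ₁i (hZ₂i.const_mul 4)).trans ?_
        rw [integral_const_mul]
    · refine (integral_add (hvi.const_mul (8 * C * δ)) (integrable_const _)).trans ?_
      rw [integral_const_mul]
      simp
  have hopt : optGap P T X Y σ lam τ (dnnClass σ d L N B F) fhat
      = ∫ ω, gap T X Y σ lam τ (dnnClass σ d L N B F) fhat ω ∂P := rfl
  rw [hreq, hopt, risk_const]
  refine (hbound.trans hcalc.le).trans ?_
  have h8 := hm.integral_meanAbs_le hT
  have h9 : 8 * C * δ * ∫ ω, meanAbs T v ω ∂P ≤ 8 * C * δ :=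
    mul_le_of_le_one_right (by positivity) h8
  have h10 : 16 * a * F ^ 2 / T * ∑ i, Real.exp (-p i) ≤ 64 * (a * F ^ 2 / T) := by
    refine (mul_le_mul_of_nonneg_left hsum (by positivity)).trans (le_of_eq ?_)
    ring
  have h11 : 8 * F ^ 2 * K' ^ 2 * C ^ 2 / T * ∑ i, Real.exp (-p i)
      ≤ 32 * (F ^ 2 * K' ^ 2 * C ^ 2 / T) := by
    refine (mul_le_mul_of_nonneg_left hsum (by positivity)).trans (le_of_eq ?_)
    ring
  linarith

end Oracle

/-! ### Entropy of the net under the growth conditions -/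

section Rates

variable {ℓ u a₁ a₂ a₃ a₅ L N B : ℝ}

/-- The logarithm of the number of architectures is of order L log N, hence of order ℓu with ℓ = log
T and u = ℓ^{ν₀}. -/
lemma entropy_depth_le (hℓ : 1 ≤ ℓ) (hL : 0 < L) (hN : 0 < N)
    (hLu : L + 1 ≤ a₁ * u) (hNl : N + 1 ≤ Real.exp (a₂ * ℓ)) (ha₂ : 0 ≤ a₂) :
    (L + 1) * (N + 1) ^ L ≤ Real.exp ((1 + a₂) * a₁ * (ℓ * u)) := by
  have hℓ0 : 0 < ℓ := by linarith
  have h1 : L + 1 ≤ Real.exp L := Real.add_one_le_exp L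
  have h2 : (N + 1) ^ L ≤ Real.exp (a₂ * ℓ * L) := by
    rw [Real.exp_mul]
    exact Real.rpow_le_rpow (by linarith) hNl hL.le
  calc (L + 1) * (N + 1) ^ L ≤ Real.exp L * Real.exp (a₂ * ℓ * L) := by gcongr
    _ = Real.exp (L + a₂ * ℓ * L) := (Real.exp_add _ _).symm
    _ ≤ _ := by
      refine Real.exp_le_exp.2 ?_
      have h3 : ℓ * L ≤ ℓ * (a₁ * u) := by gcongr; linarith
      have h4 : L ≤ ℓ * L := le_mul_of_one_le_left hL.le hℓ
      have h5 : a₂ * (ℓ * L) ≤ a₂ * (ℓ * (a₁ * u)) := by gcongr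
      nlinarith

/-- The logarithm of the grid size is of order L log(NB) + κ²L + log T. All of these are of order
ℓu; in particular the refinement exp(-2κ²(L+1)) of the grid costs nothing in order. -/
lemma entropy_grid_le (hℓ : 1 ≤ ℓ) (hu : 1 ≤ u) (hL : 0 < L) (hN : 0 < N) (hB : 1 ≤ B)
    (hLu : L + 1 ≤ a₁ * u) (hNl : N + 1 ≤ Real.exp (a₂ * ℓ)) (hBl : B ≤ Real.exp (a₃ * ℓ))
    (ha₂ : 0 ≤ a₂) (ha₃ : 0 ≤ a₃) (ha₅ : 0 ≤ a₅) {d : ℕ} {κ t g : ℝ} (ht : 0 < t)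
    (hta : t⁻¹ ≤ Real.exp (ℓ + a₅))
    (hg : g = t / ((L + 1) * ((N + 1) * B) ^ (L + 1)) * Real.exp (-(2 * κ ^ 2 * (L + 1)))) :
    2 * (B / g + 1) * ((d + 1 + L) * (N + 1) ^ 2) ≤
      Real.exp ((a₃ + a₁ + (a₂ + a₃) * a₁ + 2 * κ ^ 2 * a₁ + 1 + a₅ + 2 + d + a₁ + 2 * a₂)
        * (ℓ * u)) := by
  have hℓ0 : 0 < ℓ := by linarith
  have hu0 : 0 < u := by linarith
  have hw : 1 ≤ ℓ * u := one_le_mul_of_one_le_of_one_le hℓ hu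
  have hℓw : ℓ ≤ ℓ * u := le_mul_of_one_le_right hℓ0.le hu
  have hLw : ℓ * (L + 1) ≤ a₁ * (ℓ * u) := by nlinarith
  have hLw' : L + 1 ≤ a₁ * (ℓ * u) :=
    (le_mul_of_one_le_left (by linarith) hℓ).trans hLw
  have hpow : ((N + 1) * B) ^ (L + 1) ≤ Real.exp ((a₂ * ℓ + a₃ * ℓ) * (L + 1)) := by
    rw [Real.exp_mul, Real.exp_add]
    exact Real.rpow_le_rpow (by positivity) (by gcongr) (by linarith)
  have hBg : B / g ≤ Real.exp
      ((a₃ + a₁ + (a₂ + a₃) * a₁ + 2 * κ ^ 2 * a₁ + 1 + a₅) * (ℓ * u)) := by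
    have hpos : 0 < ((N + 1) * B) ^ (L + 1) := Real.rpow_pos_of_pos (by positivity) _
    have e1 : B / g = B * (L + 1) * ((N + 1) * B) ^ (L + 1)
        * Real.exp (2 * κ ^ 2 * (L + 1)) * t⁻¹ := by
      rw [hg, Real.exp_neg]
      field_simp
    rw [e1]
    calc _ ≤ Real.exp (a₃ * ℓ) * Real.exp L * Real.exp ((a₂ * ℓ + a₃ * ℓ) * (L + 1))
          * Real.exp (2 * κ ^ 2 * (L + 1)) * Real.exp (ℓ + a₅) := by
          gcongr
          exact Real.add_one_le_exp L
      _ = Real.exp (a₃ * ℓ + L + (a₂ * ℓ + a₃ * ℓ) * (L + 1) + 2 * κ ^ 2 * (L + 1)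
          + (ℓ + a₅)) := by simp only [Real.exp_add]
      _ ≤ _ := by
        refine Real.exp_le_exp.2 ?_
        have k1 : a₃ * ℓ ≤ a₃ * (ℓ * u) := by gcongr
        have k2 : (a₂ + a₃) * (ℓ * (L + 1)) ≤ (a₂ + a₃) * (a₁ * (ℓ * u)) := by gcongr
        have k3 : 2 * κ ^ 2 * (L + 1) ≤ 2 * κ ^ 2 * (a₁ * (ℓ * u)) := by gcongr
        have k4 : a₅ ≤ a₅ * (ℓ * u) := le_mul_of_one_le_right ha₅ hw
        linarith
  set a₄ := a₃ + a₁ + (a₂ + a₃) * a₁ + 2 * κ ^ 2 * a₁ + 1 + a₅ with ha₄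
  have hg0 : 0 < g := by
    rw [hg]
    have : 0 < ((N + 1) * B) ^ (L + 1) := Real.rpow_pos_of_pos (by positivity) _
    positivity
  have h1 : 1 ≤ Real.exp (a₄ * (ℓ * u)) := by
    refine Real.one_le_exp (mul_nonneg ?_ (by linarith))
    have : 0 < a₁ := by
      by_contra h
      have : a₁ * u ≤ 0 := mul_nonpos_of_nonpos_of_nonneg (not_lt.1 h) hu0.le
      linarith
    positivity
  have h2 : (2 : ℝ) ≤ Real.exp 1 := by have := Real.add_one_le_exp 1; linarith
  have h3 : (d + 1 + L : ℝ) ≤ Real.exp (d + L) := by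
    have := Real.add_one_le_exp (d + L); linarith
  have h4 : (N + 1) ^ 2 ≤ Real.exp (2 * (a₂ * ℓ)) := by
    rw [two_mul, Real.exp_add, ← sq]; gcongr
  calc 2 * (B / g + 1) * ((d + 1 + L) * (N + 1) ^ 2)
      ≤ Real.exp 1 * (Real.exp 1 * Real.exp (a₄ * (ℓ * u)))
        * (Real.exp (d + L) * Real.exp (2 * (a₂ * ℓ))) := by
        gcongr
        nlinarith
    _ = Real.exp (1 + (1 + a₄ * (ℓ * u)) + (d + L + 2 * (a₂ * ℓ))) := by
        simp only [Real.exp_add]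
    _ ≤ _ := by
        refine Real.exp_le_exp.2 ?_
        have k1 : a₂ * ℓ ≤ a₂ * (ℓ * u) := by gcongr
        have k2 : (d : ℝ) ≤ d * (ℓ * u) := le_mul_of_one_le_right (by positivity) hw
        linarith

lemma one_le_log_of_three_le {T : ℝ} (hT : 3 ≤ T) : 1 ≤ Real.log T := by
  rw [Real.le_log_iff_exp_le (by linarith)]
  linarith [Real.exp_one_lt_d9]

lemma mul_rpow_le_exp {C ν T : ℝ} (hT : 3 ≤ T) (hC : 0 ≤ C) :
    C * T ^ ν + 1 ≤ Real.exp ((C + |ν|) * Real.log T) := by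
  have hℓ := one_le_log_of_three_le hT
  have hT0 : 0 < T := by linarith
  have h1 : C + 1 ≤ Real.exp (C * Real.log T) :=
    (Real.add_one_le_exp C).trans (Real.exp_le_exp.2 (le_mul_of_one_le_right hC hℓ))
  have h2 : T ^ ν ≤ Real.exp (|ν| * Real.log T) := by
    rw [Real.rpow_def_of_pos hT0, mul_comm]
    refine Real.exp_le_exp.2 ?_
    gcongr
    exact le_abs_self ν
  have h3 : 1 ≤ Real.exp (|ν| * Real.log T) := Real.one_le_exp (by positivity)
  rw [add_mul, Real.exp_add]
  calc C * T ^ ν + 1 ≤ C * Real.exp (|ν| * Real.log T) + 1 * Real.exp (|ν| * Real.log T) := by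
        gcongr; linarith
    _ = (C + 1) * Real.exp (|ν| * Real.log T) := by ring
    _ ≤ _ := by gcongr

end Rates

/-- Nets of the network classes at the resolution `1 / T`, with weights that are controlled by the
clipped norm up to the factor `log ^ (1 + ν₀) T`. -/
lemma exists_net_of_rates {σ : ℝ → ℝ} {c : ℝ} (hc : 1 ≤ c)
    (hσ : ∀ x y, |σ x - σ y| ≤ c * |x - y|) (hσc : Continuous σ) (d : ℕ)
    {C_L C_N C_B C_τ ν₀ : ℝ} (ν₁ ν₂ : ℝ) (hC_L : 0 < C_L) (hC_N : 0 < C_N) (hC_B : 0 < C_B)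
    (hC_τ : 0 < C_τ) (hν₀ : 0 < ν₀) :
    ∃ A D : ℝ, 0 ≤ A ∧ 0 ≤ D ∧ ∀ T : ℕ, 3 ≤ T → 4 * c * C_τ ≤ T →
      ∀ F L N B τ : ℝ, 0 ≤ F → 0 < L → L ≤ C_L * Real.log T ^ ν₀ →
      0 < N → N ≤ C_N * (T : ℝ) ^ ν₁ → 1 ≤ B → B ≤ C_B * (T : ℝ) ^ ν₂ →
      0 < τ → τ * (L + 1) * ((N + 1) * B) ^ (L + 1) ≤ C_τ * (T : ℝ)⁻¹ →
      ∃ (I : Type) (_ : Fintype I) (G : I → (Fin d → ℝ) → ℝ) (p : I → ℝ),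
        (∀ i, Measurable (G i)) ∧ (∀ i x, |G i x| ≤ F) ∧ (∀ i, 0 ≤ p i) ∧
        ∑ i, Real.exp (-p i) ≤ 4 ∧
        ∀ f ∈ dnnClass σ d L N B F, ∃ i, (∀ x ∈ cube d, |f.eval σ x - G i x| ≤ D / T) ∧
          p i ≤ A * (Real.log T * Real.log T ^ ν₀) * clipNorm τ f.params := by
  set κ := 4 * c + 1 with hκ
  set K₀ := 2 * (|σ 0| + 1) with hK₀
  set a₁ := C_L + 1 with ha₁
  set a₂ := C_N + |ν₁| with ha₂
  set a₃ := C_B + |ν₂| with ha₃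
  set a₅ := C_τ⁻¹ with ha₅
  set e₁ := (1 + a₂) * a₁ with he₁
  set e₂ := a₃ + a₁ + (a₂ + a₃) * a₁ + 2 * κ ^ 2 * a₁ + 1 + a₅ + 2 + d + a₁ + 2 * a₂ with he₂
  have ha₁0 : 0 ≤ a₁ := by positivity
  have ha₂0 : 0 ≤ a₂ := by positivity
  have ha₃0 : 0 ≤ a₃ := by positivity
  have ha₅0 : 0 ≤ a₅ := by positivity
  have he₁0 : 0 ≤ e₁ := by positivity
  have he₂0 : 0 ≤ e₂ := by positivity
  have hc0 : 0 < c := by linarith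
  set D := 2 * c * κ * (c * (d + 1) + K₀) * Real.exp (2 * κ ^ 2 * (d + 2)) * C_τ with hD
  refine ⟨2 * (e₁ + e₂) * (4 * κ ^ 2), D, by positivity, by positivity, ?_⟩
  intro T hT hTc F L N B τ hF hL hLT hN hNT hB hBT hτ hτT
  have hT3 : (3 : ℝ) ≤ T := by exact_mod_cast hT
  have hT0 : (0 : ℝ) < T := by linarith
  have hℓ := one_le_log_of_three_le hT3
  set ℓ := Real.log T with hℓdef
  set u := ℓ ^ ν₀ with hudef
  have hu : 1 ≤ u := Real.one_le_rpow hℓ hν₀.le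
  have hw : 0 ≤ ℓ * u := mul_nonneg (by linarith) (by linarith)
  have hLu : L + 1 ≤ a₁ * u := by rw [ha₁]; linarith
  have hNl : N + 1 ≤ Real.exp (a₂ * ℓ) :=
    (add_le_add_left hNT 1).trans (mul_rpow_le_exp hT3 hC_N.le)
  have hBl : B ≤ Real.exp (a₃ * ℓ) := by
    have := mul_rpow_le_exp (ν := ν₂) hT3 hC_B.le
    linarith
  have ht : 0 < C_τ / T := by positivity
  have hta : (C_τ / T)⁻¹ ≤ Real.exp (ℓ + a₅) := by
    rw [inv_div, Real.exp_add, hℓdef, Real.exp_log hT0, div_eq_mul_inv]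
    gcongr
    have := Real.add_one_le_exp a₅
    linarith
  have hpos : 0 < (L + 1) * ((N + 1) * B) ^ (L + 1) :=
    mul_pos (by linarith) (Real.rpow_pos_of_pos (by positivity) _)
  have hE1 : (L + 1) * (N + 1) ^ L ≤ Real.exp (2 * (e₁ + e₂) * (ℓ * u) / 2) := by
    have h : (L + 1) * (N + 1) ^ L ≤ Real.exp (e₁ * (ℓ * u)) :=
      entropy_depth_le hℓ hL hN hLu hNl ha₂0
    refine h.trans (Real.exp_le_exp.2 ?_)
    linarith [mul_nonneg he₂0 hw]
  have hE2 := (entropy_grid_le (κ := κ) (d := d) hℓ hu hL hN hB hLu hNl hBl ha₂0 ha₃0 ha₅0 ht hta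
    rfl).trans (Real.exp_le_exp.2 (by
      rw [← he₂]; linarith [mul_nonneg he₁0 hw] :
      _ ≤ 2 * (e₁ + e₂) * (ℓ * u) / 2))
  clear_value e₁ e₂ u ℓ a₁ a₂ a₃
  obtain ⟨I, hI, G, p, h1, h2, h3, h4, h5⟩ := exists_net hc hσ hσc le_rfl hκ hK₀ (d := d)
    (L := L) (N := N) (B := B) (F := F) (ρ := C_τ / T / ((L + 1) * ((N + 1) * B) ^ (L + 1)))
    (τ := τ) (ε := C_τ / T) (E := 2 * (e₁ + e₂) * (ℓ * u)) hL hN hB hF hτ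
    (by rw [le_div_iff₀ hpos, ← mul_assoc]; simpa [div_eq_mul_inv] using hτT)
    (by rw [mul_assoc, div_mul_cancel₀ _ hpos.ne'])
    (by rw [← mul_div_assoc, div_le_one hT0]; exact hTc)
    rfl rfl (by positivity)
    hE1 hE2
  refine ⟨I, hI, G, p, h1, h2, h3, h4, fun f hf => ?_⟩
  obtain ⟨i, hi, hpi⟩ := h5 f hf
  refine ⟨i, fun x hx => (hi x hx).trans_eq ?_, hpi.trans_eq ?_⟩
  · rw [hD]; ring
  · ring

/-! ### The oracle inequality with logarithmic block length -/

section MainEstimate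

variable {Ω : Type*} {mΩ : MeasurableSpace Ω} {P : Measure Ω} {𝒢 : Filtration ℕ mΩ}
  {d T : ℕ} {m η : (Fin d → ℝ) → ℝ} {X : ℕ → Ω → Fin d → ℝ}
  {Y v : ℕ → Ω → ℝ} {Cη C₁ C₂ K F L N B lam τ : ℝ} {σ : ℝ → ℝ} {fhat : Ω → DNN d}

lemma optGap_nonneg (hlam : 0 ≤ lam) (hτ : 0 < τ) {𝓕 : Set (DNN d)} (hmem : ∀ ω, fhat ω ∈ 𝓕) :
    0 ≤ optGap P T X Y σ lam τ 𝓕 fhat :=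
  integral_nonneg fun ω => gap_nonneg hlam hτ hmem ω

variable [IsProbabilityMeasure P]

lemma risk_const_nonneg (h f₀ : (Fin d → ℝ) → ℝ) : 0 ≤ risk P T X (fun _ => h) f₀ := by
  rw [risk_const]
  exact integral_nonneg fun ω => sqDist_nonneg ω

lemma RegressionModel.risk_le_const (hT : 0 < T)
    (hm : RegressionModel P 𝒢 T m η X Y v Cη C₁ C₂ K) (hF : 1 ≤ F)
    (hmF : ∀ x ∈ cube d, |m x| ≤ F)
    (he : IsEstimator T X Y σ lam τ (dnnClass σ d L N B F) fhat) :
    risk P T X (fun ω => (fhat ω).fn σ) ((cube d).indicator m) ≤ 4 * F ^ 2 := by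
  have hF0 : 0 ≤ F := by linarith
  have hf₀ := abs_indicator_le hF0 hmF
  have bound : ∀ {g : Ω → ℝ}, (∀ ω, 0 ≤ g ω) → (∀ ω, g ω ≤ 4 * F ^ 2) →
      ∫ ω, g ω ∂P ≤ 4 * F ^ 2 := fun {g} h0 h => by
    simpa using integral_mono_of_nonneg (ae_of_all P h0) (integrable_const (4 * F ^ 2))
      (ae_of_all P h)
  rw [(hm.risk_eq hT hF hmF he).2]
  exact bound (fun _ => integral_nonneg fun _ => sqDist_nonneg _)
    fun ω => bound (fun _ => sqDist_nonneg _)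
      fun ω' => sqDist_le hT hf₀ (abs_fn_le hF0 (he.mem ω)) ω'

/-- The oracle inequality, given nets at the resolution `D / T` whose weights are dominated by the
penalty. -/
lemma RegressionModel.risk_le_of_net (hT : 3 ≤ T)
    (hm : RegressionModel P 𝒢 T m η X Y v Cη C₁ C₂ K) (hC₁ : 0 < C₁) (hC₂ : 0 < C₂)
    (hσ : Continuous σ) (hF : 1 ≤ F) (hmF : ∀ x ∈ cube d, |m x| ≤ F)
    (hlam : 0 ≤ lam) (hτ : 0 < τ)
    (he : IsEstimator T X Y σ lam τ (dnnClass σ d L N B F) fhat)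
    {C K' D : ℝ} (hC : 1 ≤ C) (hCη : Cη ≤ C) (hK' : 1 ≤ K') (hKK' : K ≤ K') (hD : 0 ≤ D)
    {I : Type*} [Fintype I] {G : I → (Fin d → ℝ) → ℝ} {p : I → ℝ}
    (hG : ∀ i, Measurable (G i)) (hGF : ∀ i x, |G i x| ≤ F) (hp : ∀ i, 0 ≤ p i)
    (hsum : ∑ i, Real.exp (-p i) ≤ 4)
    (hnet : ∀ f ∈ dnnClass σ d L N B F, ∃ i, (∀ x ∈ cube d, |f.eval σ x - G i x| ≤ D / T) ∧
      F ^ 2 / T * ((4 * (2 / C₂ + 2) + 8 * (K' ^ 2 * C ^ 2)) * Real.log T) * p i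
        ≤ penalty lam τ f) :
    risk P T X (fun ω => (fhat ω).fn σ) ((cube d).indicator m) ≤
      6 * (optGap P T X Y σ lam τ (dnnClass σ d L N B F) fhat +
        ⨅ f : dnnClass σ d L N B F,
          (risk P T X (fun _ => (f : DNN d).fn σ) ((cube d).indicator m) +
            penalty lam τ (f : DNN d))) +
      (32 * C₁ + 64 * (2 / C₂ + 2) + 128 * (K' ^ 2 * C ^ 2) + (20 + 8 * C) * D) * F ^ 2 *
        ((1 + Real.log T) / T) := by
  have hT3 : (3 : ℝ) ≤ T := by exact_mod_cast hT
  have hT0 : (0 : ℝ) < T := by linarith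
  have hℓ := one_le_log_of_three_le hT3
  have hTpos : 0 < T := by omega
  set ℓ := Real.log T with hℓdef
  set a : ℕ := ⌈2 / C₂ * ℓ⌉₊ + 1 with ha
  have ha0 : 0 < a := by omega
  have halo : 2 / C₂ * ℓ ≤ a := by
    have := Nat.le_ceil (2 / C₂ * ℓ)
    rw [ha]; push_cast; linarith
  have hahi : (a : ℝ) ≤ (2 / C₂ + 2) * ℓ := by
    have := (Nat.ceil_lt_add_one (a := 2 / C₂ * ℓ) (by positivity)).le
    rw [ha]; push_cast; linarith
  set b := C₁ * Real.exp (-C₂ * a) with hb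
  have hb0 : 0 ≤ b := by positivity
  have hbT : b ≤ C₁ / (T : ℝ) ^ 2 := by
    have h1 : -C₂ * a ≤ -(ℓ + ℓ) := by
      have : C₂ * (2 / C₂ * ℓ) ≤ C₂ * a := by gcongr
      have e : C₂ * (2 / C₂ * ℓ) = ℓ + ℓ := by field_simp; ring
      linarith
    calc b ≤ C₁ * Real.exp (-(ℓ + ℓ)) := by rw [hb]; gcongr
      _ = _ := by rw [Real.exp_neg, Real.exp_add, hℓdef, Real.exp_log hT0]; field_simp
  have : Nonempty Ω := P.nonempty_of_neZero
  have : Nonempty (dnnClass σ d L N B F) := ⟨⟨fhat (Classical.arbitrary Ω), he.mem _⟩⟩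
  set A := 4 * (2 / C₂ + 2) + 8 * (K' ^ 2 * C ^ 2) with hA
  set S := risk P T X (fun ω => (fhat ω).fn σ) ((cube d).indicator m) with hS
  set O := optGap P T X Y σ lam τ (dnnClass σ d L N B F) fhat with hO
  set R := 16 * F ^ 2 * b * (T + 1) + 64 * (a * F ^ 2 / T) + 128 * (F ^ 2 * K' ^ 2 * C ^ 2 / T)
    + 20 * F * (D / T) + 8 * C * (D / T) with hR
  -- The inequality is solved for the competitor's terms in order to pass to the infimum. The factor
  -- 4 is relaxed to 6 at the end, the gap and the infimum being nonnegative.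
  have hmain : ∀ f : dnnClass σ d L N B F, (S - R) / 4 - O ≤
      risk P T X (fun _ => (f : DNN d).fn σ) ((cube d).indicator m)
        + penalty lam τ (f : DNN d) := by
    intro f
    have := hm.risk_le hTpos hσ hF hmF hlam hτ he hC hCη hK' hKK' ha0 hb0
      (hm.mixing a ha0) (by positivity : 0 ≤ D / (T : ℝ)) hG hGF hp hsum
      (fun f hf => ?_) f.2
    · linarith
    · obtain ⟨i, hi, hpi⟩ := hnet f hf
      refine ⟨i, hi, le_trans ?_ hpi⟩
      refine mul_le_mul_of_nonneg_right ?_ (hp i)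
      have e1 : 4 * (a * F ^ 2 / T) + 8 * (F ^ 2 * K' ^ 2 * C ^ 2 / T)
          = F ^ 2 / T * (4 * a + 8 * (K' ^ 2 * C ^ 2)) := by ring
      rw [e1]
      gcongr
      have : 8 * (K' ^ 2 * C ^ 2) ≤ 8 * (K' ^ 2 * C ^ 2) * ℓ :=
        le_mul_of_one_le_right (by positivity) hℓ
      rw [hA]
      linarith
  have hinf := le_ciInf hmain
  have hO0 : 0 ≤ O := optGap_nonneg hlam hτ he.mem
  have hinf0 : 0 ≤ ⨅ f : dnnClass σ d L N B F,
      (risk P T X (fun _ => (f : DNN d).fn σ) ((cube d).indicator m) +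
        penalty lam τ (f : DNN d)) :=
    le_ciInf fun f => add_nonneg (risk_const_nonneg _ _) (penalty_nonneg hlam hτ _)
  have hRle : R ≤ (32 * C₁ + 64 * (2 / C₂ + 2) + 128 * (K' ^ 2 * C ^ 2) + (20 + 8 * C) * D)
      * F ^ 2 * ((1 + ℓ) / T) := by
    have hF2 : F ≤ F ^ 2 := by nlinarith
    have r1 : 16 * F ^ 2 * b * (T + 1) ≤ F ^ 2 / T * (32 * C₁) := by
      calc 16 * F ^ 2 * b * (T + 1) ≤ 16 * F ^ 2 * (C₁ / (T : ℝ) ^ 2) * (2 * T) := by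
            gcongr; linarith
        _ = _ := by field_simp; norm_num
    have r2 : 64 * (a * F ^ 2 / T) ≤ F ^ 2 / T * (64 * ((2 / C₂ + 2) * ℓ)) := by
      calc 64 * (a * F ^ 2 / T) = F ^ 2 / T * (64 * a) := by ring
        _ ≤ _ := by gcongr
    have r3 : 20 * F * (D / T) + 8 * C * (D / T) ≤ F ^ 2 / T * ((20 + 8 * C) * D) := by
      have : 20 * F + 8 * C ≤ F ^ 2 * (20 + 8 * C) := by nlinarith
      calc 20 * F * (D / T) + 8 * C * (D / T) = (20 * F + 8 * C) * (D / T) := by ring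
        _ ≤ F ^ 2 * (20 + 8 * C) * (D / T) := by gcongr
        _ = _ := by ring
    have r4 : F ^ 2 / T * (32 * C₁ + 64 * ((2 / C₂ + 2) * ℓ) + 128 * (K' ^ 2 * C ^ 2)
        + (20 + 8 * C) * D) ≤ F ^ 2 / T *
        ((32 * C₁ + 64 * (2 / C₂ + 2) + 128 * (K' ^ 2 * C ^ 2) + (20 + 8 * C) * D) * (1 + ℓ)) := by
      gcongr
      have : 0 ≤ (32 * C₁ + 128 * (K' ^ 2 * C ^ 2) + (20 + 8 * C) * D) * ℓ := by positivity
      have : 0 ≤ 64 * (2 / C₂ + 2) := by positivity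
      linarith
    have e : 128 * (F ^ 2 * K' ^ 2 * C ^ 2 / T) = F ^ 2 / T * (128 * (K' ^ 2 * C ^ 2)) := by ring
    calc R ≤ F ^ 2 / T * (32 * C₁ + 64 * ((2 / C₂ + 2) * ℓ) + 128 * (K' ^ 2 * C ^ 2)
        + (20 + 8 * C) * D) := by rw [hR]; linarith
      _ ≤ _ := r4
      _ = _ := by ring
  linarith

end MainEstimate

end SparseDNN

end

/-! ### Choice of the constants -/

open SparseDNN MeasureTheory

theorem mainTheorem1 (d : ℕ) (hd : 1 ≤ d) (σ : ℝ → ℝ) (hσ : ∃ Cσ : NNReal, LipschitzWith Cσ σ)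
    (Cη C₁ C₂ C_L C_N C_B C_τ ν₀ ν₁ ν₂ K : ℝ) (hC₁ : 0 < C₁) (hC₂ : 0 < C₂)
    (hC_L : 0 < C_L) (hC_N : 0 < C_N) (hC_B : 0 < C_B) (hC_τ : 0 < C_τ)
    (hν₀ : 0 < ν₀) (hν₁ : 0 < ν₁) (hν₂ : 0 < ν₂)
    (ι : ℝ → ℝ) (hι : StrictMonoOn ι (Set.Ici 3))
    (hι_lim : Filter.Tendsto (fun x => ι x / Real.log x) Filter.atTop Filter.atTop) :
    ∃ C : ℝ, 0 < C ∧
      ∀ {Ω : Type*} {mΩ : MeasurableSpace Ω} (P : Measure Ω) [IsProbabilityMeasure P]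
        (𝒢 : Filtration ℕ mΩ) (T : ℕ) (_ : 3 ≤ T) (m η : (Fin d → ℝ) → ℝ)
        (X : ℕ → Ω → Fin d → ℝ) (Y v : ℕ → Ω → ℝ)
        (_ : RegressionModel P 𝒢 T m η X Y v Cη C₁ C₂ K)
        (F : ℝ) (_ : 1 ≤ F) (_ : ∀ x ∈ cube d, |m x| ≤ F)
        (L N B : ℝ) (_ : 0 < L) (_ : L ≤ C_L * Real.log T ^ ν₀)
        (_ : 0 < N) (_ : N ≤ C_N * (T : ℝ) ^ ν₁)
        (_ : 1 ≤ B) (_ : B ≤ C_B * (T : ℝ) ^ ν₂)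
        (lam τ : ℝ) (_ : 0 < lam) (_ : lam = F ^ 2 * ι T * Real.log T ^ (2 + ν₀) / T)
        (_ : 0 < τ) (_ : τ * (L + 1) * ((N + 1) * B) ^ (L + 1) ≤ C_τ * (T : ℝ)⁻¹)
        (fhat : Ω → DNN d) (_ : IsEstimator T X Y σ lam τ (dnnClass σ d L N B F) fhat),
        risk P T X (fun ω => (fhat ω).fn σ) ((cube d).indicator m) ≤
          6 * (optGap P T X Y σ lam τ (dnnClass σ d L N B F) fhat +
            ⨅ f : dnnClass σ d L N B F,
              (risk P T X (fun _ => (f : DNN d).fn σ) ((cube d).indicator m) +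
                penalty lam τ (f : DNN d))) +
          C * F ^ 2 * ((1 + Real.log T) / T) := by
  obtain ⟨Cσ, hCσ⟩ := hσ
  have hσc : Continuous σ := hCσ.continuous
  set c : ℝ := max 1 Cσ with hc
  have hlip : ∀ x y, |σ x - σ y| ≤ c * |x - y| := fun x y => by
    have h := hCσ.dist_le_mul x y
    rw [Real.dist_eq, Real.dist_eq] at h
    exact h.trans (mul_le_mul_of_nonneg_right (le_max_right _ _) (abs_nonneg _))
  obtain ⟨A, D, hA, hD, hnet⟩ := exists_net_of_rates (le_max_left _ _) hlip hσc d ν₁ ν₂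
    hC_L hC_N hC_B hC_τ hν₀
  set K' := max 1 K with hK'
  set C := max 1 Cη with hC
  have hC1 : 1 ≤ C := le_max_left _ _
  set A' := 4 * (2 / C₂ + 2) + 8 * (K' ^ 2 * C ^ 2) with hA'
  have hA'0 : 0 ≤ A' := by positivity
  -- From T₀ on, the growth of `ι` makes the penalty dominate the net weights.
  obtain ⟨T₀, hT₀⟩ := Filter.eventually_atTop.1 (hι_lim.eventually_ge_atTop (A' * A))
  set S := max (max T₀ (4 * c * C_τ)) 1 with hS
  have hS1 : 1 ≤ S := le_max_right _ _
  set C' := 32 * C₁ + 64 * (2 / C₂ + 2) + 128 * (K' ^ 2 * C ^ 2) + (20 + 8 * C) * D with hC'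
  have hC'0 : 0 < C' := by positivity
  refine ⟨C' + 4 * S, by positivity, ?_⟩
  intro Ω mΩ P _ 𝒢 T hT m η X Y v hm F hF hmF L N B hL hLT hN hNT hB hBT lam τ hlam hlamT
    hτ hτT fhat he
  have hT3 : (3 : ℝ) ≤ T := by exact_mod_cast hT
  have hT0 : (0 : ℝ) < T := by linarith
  have hℓ := one_le_log_of_three_le hT3
  have hℓ0 : 0 < Real.log T := by linarith
  have hrate : 0 ≤ F ^ 2 * ((1 + Real.log T) / T) := by positivity
  -- For T < S the trivial bound 4F² on the risk is absorbed by the summand 4S of the constant.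
  rcases lt_or_ge (T : ℝ) S with hTS | hTS
  · have h1 := hm.risk_le_const (by omega) hF hmF he
    have h2 : 0 ≤ optGap P T X Y σ lam τ (dnnClass σ d L N B F) fhat :=
      optGap_nonneg hlam.le hτ he.mem
    have h3 : 0 ≤ ⨅ f : dnnClass σ d L N B F,
        (risk P T X (fun _ => (f : DNN d).fn σ) ((cube d).indicator m) +
          penalty lam τ (f : DNN d)) :=
      Real.iInf_nonneg fun f => add_nonneg (risk_const_nonneg _ _) (penalty_nonneg hlam.le hτ _)
    have h4 : 4 * F ^ 2 ≤ 4 * S * (F ^ 2 * ((1 + Real.log T) / T)) := by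
      have h5 : 1 ≤ S * ((1 + Real.log T) / T) := by
        rw [← mul_div_assoc, one_le_div hT0]
        nlinarith
      nlinarith [sq_nonneg F]
    have h6 : 0 ≤ C' * (F ^ 2 * ((1 + Real.log T) / T)) := mul_nonneg hC'0.le hrate
    linarith
  · have hTT₀ : T₀ ≤ T := (le_max_left _ _).trans ((le_max_left _ _).trans hTS)
    have hTc : 4 * c * C_τ ≤ T := (le_max_right _ _).trans ((le_max_left _ _).trans hTS)
    have hιT : A' * A ≤ ι T := by
      have h1 := hT₀ T hTT₀
      rw [le_div_iff₀ hℓ0] at h1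
      exact (le_mul_of_one_le_right (mul_nonneg hA'0 hA) hℓ).trans h1
    obtain ⟨I, _, G, p, hG, hGF, hp, hsum, hcover⟩ := hnet T hT hTc F L N B τ (by linarith)
      hL hLT hN hNT hB hBT hτ hτT
    have hmain := hm.risk_le_of_net hT hC₁ hC₂ hσc hF hmF hlam.le hτ he hC1 (le_max_right _ _)
      (le_max_left 1 K) (le_max_right _ _) hD hG hGF hp hsum (fun f hf => by
        obtain ⟨i, hi, hpi⟩ := hcover f hf
        refine ⟨i, hi, (mul_le_mul_of_nonneg_left hpi (by positivity)).trans ?_⟩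
        have hclip := clipNorm_nonneg hτ f.params
        -- One logarithm pays for the block length, the remaining power 1 + ν₀ for the entropy per
        -- nonzero parameter.
        have hpow : Real.log T ^ (2 + ν₀) = Real.log T * (Real.log T * Real.log T ^ ν₀) := by
          rw [Real.rpow_add hℓ0, Real.rpow_two]; ring
        calc _ = F ^ 2 * (A' * A) * Real.log T ^ (2 + ν₀) / T * clipNorm τ f.params := by
              rw [hpow]; ring
          _ ≤ F ^ 2 * ι T * Real.log T ^ (2 + ν₀) / T * clipNorm τ f.params := by gcongr
          _ = penalty lam τ f := by rw [penalty, hlamT])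
    have h6 : 0 ≤ 4 * S * (F ^ 2 * ((1 + Real.log T) / T)) := mul_nonneg (by linarith) hrate
    linarith
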